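/- **Setting (caching with action predictions).** A cache of size $k\ge 2$ has a known initial content of at most $k$ pages. Requests $r_1,r_2,\dots,r_T$ arrive online; after each request the requested page must be in the cache. The cost is the number of pages loaded into the cache. $\mathrm{OPT}$ denotes the number of page faults of Belady's (optimal offline) algorithm, started from the same initial cache; on a page fault with a full cache, it evicts a page whose next request is furthest in the future, with ties broken arbitrarily. A predictor has, for each time $t$, a predicted cache content $P_t$ (at most $k$ pages, otherwise arbitrary). In a query at time $t$ the algorithm names a finite set $D$ of pages known to it (pages that were in the initial cache or requested before time $t$) and a number $m$, and receives $m$ pages of $D\setminus P_t$ of the predictor's choice (all of them if there are fewer). The error of a prediction received at time $t$ is $|B_t\setminus P_t|$, where $B_t$ is the cache of Belady's algorithm after serving $r_t$; $\eta$ denotes the expected total error of the predictions that the algorithm receives. **Theorem.** There is an absolute constant $C>0$ such that the following holds for all integers $k\ge 2$ and $1\le a\le k$, and every strictly increasing convex function $f\colon[0,\infty)\to[0,\infty)$ with $f(0)=0$, $f(1)=1$ and $f(i)\le 2^i-1$ for all integers $i\ge 0$. There is $\alpha\in\mathbb R$ (independent of the set of pages, the initial cache, the input and the predictions) such that for every set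 of pages and every initial cache there is a randomized online caching algorithm $\mathrm{ALG}$ with the following properties, for every request sequence and every predictor: 1. any two queries to the predictor are at least $a$ time steps apart, in every run; 2. in every run, the number of queries and the total number of page indices asked for are each at most $C f(\log_2 k)\cdot\mathrm{OPT}$; 3. ($O(1)$-consistency) if the predictions are perfect, i.e. $P_t=B_t$ for all $t$, then $\mathbb E[\mathrm{cost}(\mathrm{ALG})]\le C\cdot\mathrm{OPT}+\alpha$; 4. ($O(\log k)$-robustness) for arbitrary predictions, $\mathbb E[\mathrm{cost}(\mathrm{ALG})]\le C\log_2 k\cdot\mathrm{OPT}+\alpha$; 5. (smoothness) for arbitrary predictions, $\mathbb E[\mathrm{cost}(\mathrm{ALG})]\le C\bigl(1+f^{-1}(a\eta/\mathrm{OPT})\bigr)\mathrm{OPT}+\alpha$ (when $\mathrm{OPT}=0$, the first term is $0$). -/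

import Mathlib

open scoped ENNReal

universe u

namespace Caching

/-- One query to the predictor: at step `time` the algorithm asks for `number` indices of pages
of the finite set `pages` that are absent from the predicted cache. -/
structure Query (Page : Type u) where
  time : ℕ
  pages : Finset Page
  number : ℕ

/-- A predictor of cache contents (action predictions) for cache size `k`. `state t` is the
predicted cache content just after request number `t` (requests are numbered from `0`) has been
served. `report t D m` answers a query made at step `t`: it consists of `m` pages of `D` that are
absent from the predicted cache (all of them if there are fewer than `m`); which ones is up to
the predictor. Nothing is assumed about the quality of the predictions. -/
structure Predictor (Page : Type u) [DecidableEq Page] (k : ℕ) where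
  state : ℕ → Finset Page
  card_state : ∀ t, (state t).card ≤ k
  report : ℕ → Finset Page → ℕ → Finset Page
  report_subset : ∀ t D m, report t D m ⊆ D \ state t
  card_report : ∀ t D m, (report t D m).card = min m (D \ state t).card

/-- A randomized online caching algorithm with cache size `k` and initial cache content `init`,
with access to a predictor. When page `r` is requested in internal state `s`, the algorithm first
decides by `ask s r` whether to query the predictor, and for what; it then draws its next internal
state from `move s r R`, where `R` is the predictor's answer (`∅` if there was no query). The
requested page has to be in the new cache. Internal states may record the whole past. -/
structure OnlineAlgorithm (Page : Type u) (k : ℕ) (init : Finset Page) where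
  State : Type u
  start : State
  cache : State → Finset Page
  cache_start : cache start = init
  card_cache : ∀ s, (cache s).card ≤ k
  ask : State → Page → Option (Finset Page × ℕ)
  move : State → Page → Finset Page → PMF State
  mem_cache : ∀ s r R, ∀ s' ∈ (move s r R).support, r ∈ cache s'

/-- `B t` is the cache content of (a run of) Belady's algorithm before request number `t`, on the
request sequence `req 0, …, req (T - 1)`: nothing changes if the requested page is in the cache;
on a page fault the page is loaded, and if the cache is full a page `p` is evicted whose next
request is furthest in the future, i.e. whenever `p` is requested later, every page `q` of the
cache is requested no later than that. Ties are broken arbitrarily. -/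
structure IsBelady {Page : Type u} [DecidableEq Page] (k : ℕ) (init : Finset Page)
    (req : ℕ → Page) (T : ℕ) (B : ℕ → Finset Page) : Prop where
  zero : B 0 = init
  hit : ∀ t < T, req t ∈ B t → B (t + 1) = B t
  load : ∀ t < T, req t ∉ B t → (B t).card < k → B (t + 1) = insert (req t) (B t)
  evict : ∀ t < T, req t ∉ B t → k ≤ (B t).card →
    ∃ p ∈ B t,
      (∀ q ∈ B t, ∀ s, t < s → s < T → req s = p → ∃ s', t < s' ∧ s' ≤ s ∧ req s' = q) ∧
      B (t + 1) = insert (req t) ((B t).erase p)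

/-- The number of page faults among the first `T` requests of a run with cache contents `B`. -/
def faults {Page : Type u} [DecidableEq Page] (req : ℕ → Page) (T : ℕ)
    (B : ℕ → Finset Page) : ℕ :=
  ((Finset.range T).filter fun t => req t ∉ B t).card

/-- Total error, with respect to the run `B`, of the predictions received in the given queries:
each prediction contributes the number of pages in the cache of `B` that are absent from the
predicted cache. -/
def totalError {Page : Type u} [DecidableEq Page] {k : ℕ} (P : Predictor Page k)
    (B : ℕ → Finset Page) (L : List (Query Page)) : ℕ :=
  (L.map fun q => (B (q.time + 1) \ P.state q.time).card).sum

/-- Expectation of an `ℕ`-valued quantity. -/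
noncomputable def expect {α : Type u} (p : PMF α) (X : α → ℕ) : ℝ≥0∞ :=
  ∑' x, p x * (X x : ℝ≥0∞)

namespace OnlineAlgorithm

variable {Page : Type u} [DecidableEq Page] {k : ℕ} {init : Finset Page}

/-- What has happened up to some step: the current internal state, the number of pages loaded so
far, and the queries made so far (most recent first). -/
structure Outcome (A : OnlineAlgorithm Page k init) where
  state : A.State
  cost : ℕ
  queries : List (Query Page)

/-- Serving request number `t`. The cost is the number of pages loaded into the cache. -/
noncomputable def step (A : OnlineAlgorithm Page k init) (P : Predictor Page k)
    (req : ℕ → Page) (t : ℕ) (o : A.Outcome) : PMF A.Outcome :=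
  match A.ask o.state (req t) with
  | none =>
      (A.move o.state (req t) ∅).map fun s =>
        ⟨s, o.cost + (A.cache s \ A.cache o.state).card, o.queries⟩
  | some (D, m) =>
      (A.move o.state (req t) (P.report t D m)).map fun s =>
        ⟨s, o.cost + (A.cache s \ A.cache o.state).card, ⟨t, D, m⟩ :: o.queries⟩

/-- The distribution of the outcome after the first `T` requests. -/
noncomputable def run (A : OnlineAlgorithm Page k init) (P : Predictor Page k)
    (req : ℕ → Page) : ℕ → PMF A.Outcome
  | 0 => PMF.pure ⟨A.start, 0, []⟩
  | t + 1 => (run A P req t).bind (A.step P req t)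

/-- Expected cost of the algorithm on the first `T` requests. -/
noncomputable def expectedCost (A : OnlineAlgorithm Page k init) (P : Predictor Page k)
    (req : ℕ → Page) (T : ℕ) : ℝ≥0∞ :=
  expect (A.run P req T) fun o => o.cost

/-- Expected total error, with respect to `B`, of the predictions that the algorithm receives. -/
noncomputable def expectedError (A : OnlineAlgorithm Page k init) (P : Predictor Page k)
    (req : ℕ → Page) (T : ℕ) (B : ℕ → Finset Page) : ℝ≥0∞ :=
  expect (A.run P req T) fun o => totalError P B o.queries

/-- In every run, the moments of the queries are separated by at least `a` time steps. -/
def WellSeparated (A : OnlineAlgorithm Page k init) (a : ℕ) : Prop :=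
  ∀ (P : Predictor Page k) (req : ℕ → Page) (T : ℕ), ∀ o ∈ (A.run P req T).support,
    o.queries.Pairwise fun later earlier => earlier.time + a ≤ later.time

/-- The algorithm only asks about pages it was given initially or that were requested earlier. -/
def AsksAboutKnownPages (A : OnlineAlgorithm Page k init) : Prop :=
  ∀ (P : Predictor Page k) (req : ℕ → Page) (T : ℕ), ∀ o ∈ (A.run P req T).support,
    ∀ q ∈ o.queries, q.pages ⊆ init ∪ (Finset.range q.time).image req

/-- In every run, at most `b * OPT` predictions are used: this bounds both the number of queries
and the total number of indices asked for. `OPT` is the number of page faults of Belady's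
algorithm. -/
def UsesPredictions (A : OnlineAlgorithm Page k init) (b : ℝ) : Prop :=
  ∀ (P : Predictor Page k) (req : ℕ → Page) (T : ℕ) (B : ℕ → Finset Page),
    IsBelady k init req T B → ∀ o ∈ (A.run P req T).support,
      (o.queries.length : ℝ) ≤ b * faults req T B ∧
      (((o.queries.map fun q => q.number).sum : ℕ) : ℝ) ≤ b * faults req T B

/-- Competitive ratio at most `r` (with additive constant `α`) with perfect predictions. -/
def IsConsistent (A : OnlineAlgorithm Page k init) (r α : ℝ) : Prop :=
  ∀ (P : Predictor Page k) (req : ℕ → Page) (T : ℕ) (B : ℕ → Finset Page),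
    IsBelady k init req T B → (∀ t < T, P.state t = B (t + 1)) →
      A.expectedCost P req T ≤ ENNReal.ofReal (r * faults req T B + α)

/-- Competitive ratio at most `r` (with additive constant `α`) with arbitrary predictions. -/
def IsRobust (A : OnlineAlgorithm Page k init) (r α : ℝ) : Prop :=
  ∀ (P : Predictor Page k) (req : ℕ → Page) (T : ℕ) (B : ℕ → Finset Page),
    IsBelady k init req T B →
      A.expectedCost P req T ≤ ENNReal.ofReal (r * faults req T B + α)

/-- Competitive ratio at most `g η OPT` (with additive constant `α`), where `η` is the
(expected) total error of the predictions received, with respect to Belady's algorithm, and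
`OPT` is the number of page faults of Belady's algorithm. -/
def IsSmooth (A : OnlineAlgorithm Page k init) (g : ℝ → ℝ → ℝ) (α : ℝ) : Prop :=
  ∀ (P : Predictor Page k) (req : ℕ → Page) (T : ℕ) (B : ℕ → Finset Page),
    IsBelady k init req T B →
      A.expectedCost P req T ≤
        ENNReal.ofReal
          (g (A.expectedError P req T B).toReal (faults req T B) * faults req T B + α)

end OnlineAlgorithm

end Caching

/-! The requests are cut into phases with at most `k` distinct pages. A page of a phase is clean if
it is absent from the previous phase (for the first phase, from `init`). An epoch of weight `w`
starts with `w` clean pages and ends when there are `2 * w` of them, or with the phase. Weights at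
least double within a phase, and Belady's algorithm has at least as many faults in two consecutive
phases as there are clean pages in the second one; so all epochs together have weight at most `4 *
OPT` (`Track.totalWeight_le`).

Within an epoch the algorithm climbs levels `0, …, L` with `L = Nat.log 2 k`. On a level `i < L` it
trusts a reference set and gives up the level after more than `7 * w` requests outside of it. A
fault opens a period of `N i` queries; the answer to one of them, chosen uniformly at random,
becomes reference set and cache. In the meantime evictions are random. As a period has at most `2 *
k` steps, each missing page causes at most `(1 + 1 / k) ^ (2 * k) ≤ 8` expected loads, so a level
costs `O(w)`. The last level is randomized marking, for `O(w * log k)`, saved up by `12 * w` per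
level. Hence the expected cost is at most 170 times the weight of all epochs plus the expected
weight of all failures of levels (`Conf.ev_move_potential_le`).

A failure needs error. Up to clean pages and Belady's own faults, which explain at most `6 * w` of
the counted requests, the counter is driven by pages lost when predictions were adopted, so these
have total error at least `w`. Since the adopted prediction is one of `N i` chosen uniformly, `N i`
times its error is in expectation the total error of the period. Thus the expected sum of `N i * w`
over all failures is at most the expected error `η` (`Conf.ev_move_charge_le`).

`mul_ev_cost_le` combines both facts with a function `G` of the level that acts as a dual solution.
With `N i` about `(f (i + 1) - f i) / a`, take as `G` the height of the convex function `f` above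
its secant line at an integer `j`. Then `j = 0` gives consistency, and `j = ⌊f⁻¹ (a * η / OPT)⌋`
balances weight against error and gives smoothness. Robustness comes from `G i = L - i`, with the
error ignored. The number of predictions is `O(N i * w)` per level (`Conf.budget`), and the `N i`
sum to at most `2 * f L`. -/

namespace Caching

/-! ### Expectations of real-valued quantities under finitely supported distributions -/

/-- Expectation of a real-valued quantity. -/
noncomputable def ev {α : Type*} (p : PMF α) (X : α → ℝ) : ℝ := ∑' x, (p x).toReal * X x

section ev

variable {α β : Type*}

/-- All distributions below have finite support, so expectations are finite sums without summability
conditions. They are real-valued because the potentials involve subtraction. -/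
theorem ev_eq_sum (p : PMF α) (X : α → ℝ) (s : Finset α) (hs : p.support ⊆ s) :
    ev p X = ∑ x ∈ s, (p x).toReal * X x := by
  unfold ev
  apply tsum_eq_sum
  intro x hx
  have : x ∉ p.support := fun h => hx (hs h)
  rw [PMF.mem_support_iff, not_not] at this
  simp [this]

theorem sum_toReal_eq_one (p : PMF α) (s : Finset α) (hs : p.support ⊆ s) :
    ∑ x ∈ s, (p x).toReal = 1 := by
  rw [← ENNReal.toReal_sum (fun x _ => p.apply_ne_top x)]
  have : ∑ x ∈ s, p x = 1 := by
    rw [← p.tsum_coe]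
    symm
    apply tsum_eq_sum
    intro x hx
    by_contra h
    exact hx (hs ((PMF.mem_support_iff _ _).2 h))
  simp [this]

theorem ev_mono {p : PMF α} (hp : p.support.Finite) {X Y : α → ℝ}
    (h : ∀ x ∈ p.support, X x ≤ Y x) : ev p X ≤ ev p Y := by
  rw [ev_eq_sum p X hp.toFinset (by simp), ev_eq_sum p Y hp.toFinset (by simp)]
  apply Finset.sum_le_sum
  intro x hx
  exact mul_le_mul_of_nonneg_left (h x (by simpa using hx)) ENNReal.toReal_nonneg

theorem ev_const {p : PMF α} (hp : p.support.Finite) (c : ℝ) : ev p (fun _ => c) = c := by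
  rw [ev_eq_sum p _ hp.toFinset (by simp), ← Finset.sum_mul,
    sum_toReal_eq_one p _ (by simp), one_mul]

theorem ev_add {p : PMF α} (hp : p.support.Finite) (X Y : α → ℝ) :
    ev p (fun x => X x + Y x) = ev p X + ev p Y := by
  rw [ev_eq_sum p _ hp.toFinset (by simp), ev_eq_sum p X hp.toFinset (by simp),
    ev_eq_sum p Y hp.toFinset (by simp), ← Finset.sum_add_distrib]
  simp only [mul_add]

theorem ev_const_mul {p : PMF α} (hp : p.support.Finite) (c : ℝ) (X : α → ℝ) :
    ev p (fun x => c * X x) = c * ev p X := by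
  rw [ev_eq_sum p _ hp.toFinset (by simp), ev_eq_sum p X hp.toFinset (by simp), Finset.mul_sum]
  exact Finset.sum_congr rfl fun x _ => by ring

theorem ev_le_of_le {p : PMF α} (hp : p.support.Finite) {X : α → ℝ} {c : ℝ}
    (h : ∀ x ∈ p.support, X x ≤ c) : ev p X ≤ c :=
  (ev_mono hp h).trans_eq (ev_const hp c)

theorem ev_nonneg {p : PMF α} {X : α → ℝ} (h : ∀ x, 0 ≤ X x) : 0 ≤ ev p X :=
  tsum_nonneg fun x => mul_nonneg ENNReal.toReal_nonneg (h x)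

theorem ev_pure (a : α) (X : α → ℝ) : ev (PMF.pure a) X = X a := by
  rw [ev_eq_sum _ X {a} (by simp)]
  simp

theorem finite_support_bind {p : PMF α} {g : α → PMF β} (hp : p.support.Finite)
    (hg : ∀ a ∈ p.support, (g a).support.Finite) : (p.bind g).support.Finite := by
  rw [PMF.support_bind]
  exact hp.biUnion hg

theorem finite_support_map {p : PMF α} (f : α → β) (hp : p.support.Finite) :
    (p.map f).support.Finite := by
  rw [PMF.support_map]
  exact hp.image f

theorem finite_support_pure (a : α) : (PMF.pure a).support.Finite := by
  rw [PMF.support_pure]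
  exact Set.finite_singleton a

theorem finite_support_uniform (s : Finset α) (hs : s.Nonempty) :
    (PMF.uniformOfFinset s hs).support.Finite := by
  rw [PMF.support_uniformOfFinset]
  exact s.finite_toSet

theorem ev_bind {p : PMF α} {g : α → PMF β} (hp : p.support.Finite)
    (hg : ∀ a ∈ p.support, (g a).support.Finite) (X : β → ℝ) :
    ev (p.bind g) X = ev p (fun a => ev (g a) X) := by
  classical
  have hb := finite_support_bind hp hg
  rw [ev_eq_sum (p.bind g) X hb.toFinset (by simp), ev_eq_sum p _ hp.toFinset (by simp)]
  have h1 : ∀ x, ((p.bind g) x).toReal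
      = ∑ a ∈ hp.toFinset, (p a).toReal * (g a x).toReal := by
    intro x
    have : (p.bind g) x = ∑ a ∈ hp.toFinset, p a * g a x := by
      rw [PMF.bind_apply]
      apply tsum_eq_sum
      intro a ha
      have : p a = 0 := by simpa using ha
      simp [this]
    rw [this, ENNReal.toReal_sum]
    · simp [ENNReal.toReal_mul]
    · intro a _
      exact ENNReal.mul_ne_top (p.apply_ne_top a) ((g a).apply_ne_top x)
  have h2 : ∀ a ∈ hp.toFinset, ev (g a) X = ∑ x ∈ hb.toFinset, (g a x).toReal * X x := by
    intro a ha
    apply ev_eq_sum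
    intro x hx
    simp only [Set.Finite.coe_toFinset, PMF.support_bind, Set.mem_iUnion]
    exact ⟨a, by simpa using ha, hx⟩
  have h3 : ∑ a ∈ hp.toFinset, (p a).toReal * ev (g a) X
      = ∑ a ∈ hp.toFinset, (p a).toReal * ∑ x ∈ hb.toFinset, (g a x).toReal * X x :=
    Finset.sum_congr rfl fun a ha => by rw [h2 a ha]
  rw [h3]
  simp only [h1, Finset.sum_mul, Finset.mul_sum]
  rw [Finset.sum_comm]
  exact Finset.sum_congr rfl fun a _ => Finset.sum_congr rfl fun x _ => by ring

theorem ev_map {p : PMF α} (hp : p.support.Finite) (f : α → β) (X : β → ℝ) :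
    ev (p.map f) X = ev p (fun a => X (f a)) := by
  rw [PMF.map, ev_bind (g := PMF.pure ∘ f) hp (fun a _ => finite_support_pure (f a))]
  simp only [Function.comp, ev_pure]

theorem ev_uniform (s : Finset α) (hs : s.Nonempty) (X : α → ℝ) :
    ev (PMF.uniformOfFinset s hs) X = (∑ x ∈ s, X x) / s.card := by
  rw [ev_eq_sum _ X s (by rw [PMF.support_uniformOfFinset]), Finset.sum_div]
  refine Finset.sum_congr rfl fun x hx => ?_
  rw [PMF.uniformOfFinset_apply_of_mem _ hx]
  simp [div_eq_inv_mul]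

theorem expect_eq_ofReal_ev {α : Type u} {p : PMF α} (hp : p.support.Finite) (X : α → ℕ) :
    expect p X = ENNReal.ofReal (ev p fun x => (X x : ℝ)) := by
  rw [ev_eq_sum p _ hp.toFinset (by simp), ENNReal.ofReal_sum_of_nonneg
    (fun x _ => mul_nonneg ENNReal.toReal_nonneg (Nat.cast_nonneg _))]
  unfold expect
  rw [tsum_eq_sum (s := hp.toFinset)]
  · refine Finset.sum_congr rfl fun x _ => ?_
    rw [ENNReal.ofReal_mul ENNReal.toReal_nonneg, ENNReal.ofReal_toReal (p.apply_ne_top x),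
      ENNReal.ofReal_natCast]
  · intro x hx
    have : p x = 0 := by simpa using hx
    simp [this]

end ev

/-! ### Runs of an online algorithm, and the drift of a potential -/

namespace OnlineAlgorithm

variable {Page : Type u} [DecidableEq Page] {k : ℕ} {init : Finset Page}

/-- All random choices of the algorithm are among finitely many alternatives. -/
def FinitelyBranching (A : OnlineAlgorithm Page k init) : Prop :=
  ∀ s r R, (A.move s r R).support.Finite

/-- The set of pages handed over by the predictor at step `t`. -/
noncomputable def answer (A : OnlineAlgorithm Page k init) (P : Predictor Page k) (req : ℕ → Page)
    (t : ℕ) (s : A.State) : Finset Page :=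
  match A.ask s (req t) with
  | none => ∅
  | some (D, m) => P.report t D m

/-- The list of queries after step `t`. -/
noncomputable def newQueries (A : OnlineAlgorithm Page k init) (req : ℕ → Page) (t : ℕ)
    (o : A.Outcome) : List (Query Page) :=
  match A.ask o.state (req t) with
  | none => o.queries
  | some (D, m) => ⟨t, D, m⟩ :: o.queries

theorem step_eq (A : OnlineAlgorithm Page k init) (P : Predictor Page k) (req : ℕ → Page)
    (t : ℕ) (o : A.Outcome) :
    A.step P req t o = (A.move o.state (req t) (A.answer P req t o.state)).map fun s =>
      ⟨s, o.cost + (A.cache s \ A.cache o.state).card, A.newQueries req t o⟩ := by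
  unfold step answer newQueries
  rcases A.ask o.state (req t) with _ | ⟨D, m⟩ <;> rfl

variable {A : OnlineAlgorithm Page k init}

theorem FinitelyBranching.step (hA : A.FinitelyBranching) (P : Predictor Page k)
    (req : ℕ → Page) (t : ℕ) (o : A.Outcome) : (A.step P req t o).support.Finite := by
  rw [step_eq]
  exact finite_support_map _ (hA _ _ _)

theorem FinitelyBranching.run (hA : A.FinitelyBranching) (P : Predictor Page k)
    (req : ℕ → Page) : ∀ T, (A.run P req T).support.Finite
  | 0 => finite_support_pure _
  | T + 1 => finite_support_bind (FinitelyBranching.run hA P req T) fun o _ => hA.step P req T o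

theorem FinitelyBranching.ev_step (hA : A.FinitelyBranching) (P : Predictor Page k)
    (req : ℕ → Page) (t : ℕ) (o : A.Outcome) (Z : A.Outcome → ℝ) :
    ev (A.step P req t o) Z = ev (A.move o.state (req t) (A.answer P req t o.state)) fun s =>
      Z ⟨s, o.cost + (A.cache s \ A.cache o.state).card, A.newQueries req t o⟩ := by
  rw [step_eq, ev_map (hA _ _ _)]

/-- Induction over the steps of a run. -/
theorem run_induction (P : Predictor Page k) (req : ℕ → Page) (Inv : ℕ → A.Outcome → Prop)
    (h0 : Inv 0 ⟨A.start, 0, []⟩)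
    (hstep : ∀ t o, Inv t o → ∀ s ∈ (A.move o.state (req t) (A.answer P req t o.state)).support,
      Inv (t + 1) ⟨s, o.cost + (A.cache s \ A.cache o.state).card, A.newQueries req t o⟩) :
    ∀ T, ∀ o ∈ (A.run P req T).support, Inv T o
  | 0, o, ho => by
      have : o = ⟨A.start, 0, []⟩ := by simpa [OnlineAlgorithm.run] using ho
      rw [this]; exact h0
  | T + 1, o, ho => by
      have ho' : o ∈ ((A.run P req T).bind (A.step P req T)).support := ho
      rw [PMF.mem_support_bind_iff] at ho'
      obtain ⟨o', ho', h⟩ := ho'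
      have hI := run_induction P req Inv h0 hstep T o' ho'
      rw [step_eq, PMF.mem_support_map_iff] at h
      obtain ⟨s, hs, rfl⟩ := h
      exact hstep T o' hI s hs

/-- A potential whose expectation does not increase in any step. -/
theorem FinitelyBranching.drift (hA : A.FinitelyBranching) (P : Predictor Page k)
    (req : ℕ → Page) (T : ℕ) (Inv : ℕ → A.Outcome → Prop) (Z : ℕ → A.Outcome → ℝ)
    (hInv : ∀ t, ∀ o ∈ (A.run P req t).support, Inv t o)
    (hstep : ∀ t < T, ∀ o, Inv t o → ev (A.step P req t o) (Z (t + 1)) ≤ Z t o) :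
    ev (A.run P req T) (Z T) ≤ Z 0 ⟨A.start, 0, []⟩ := by
  have key : ∀ t ≤ T, ev (A.run P req t) (Z t) ≤ Z 0 ⟨A.start, 0, []⟩ := by
    intro t
    induction t with
    | zero => intro _; exact (ev_pure _ _).le
    | succ t ih =>
      intro ht
      refine le_trans ?_ (ih (by omega))
      change ev ((A.run P req t).bind (A.step P req t)) _ ≤ _
      rw [ev_bind (hA.run P req t) fun o _ => hA.step P req t o]
      exact ev_mono (hA.run P req t) fun o ho => hstep t (by omega) o (hInv t o ho)
  exact key T le_rfl

end OnlineAlgorithm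

end Caching

namespace Caching

/-! ### Weights of missing pages -/

section weights

variable {Page : Type u} [DecidableEq Page]

/-- Weight of a missing page `y` before request `t`, if evictions are uniformly random during the
next `n` steps: a power of `1 + 1 / k` that depends on the time of the first request of `y`. -/
noncomputable def randWeight (k : ℕ) (req : ℕ → Page) (y : Page) : ℕ → ℕ → ℝ
  | _, 0 => 0
  | t, n + 1 => if req t = y then (1 + 1 / (k : ℝ)) ^ n else randWeight k req y (t + 1) n

/-- Weight of a missing page `y` before request `t`, if unmarked pages are evicted uniformly at
random, the set of marked pages is `M` and there are `n` more steps. -/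
noncomputable def markWeight (k : ℕ) (req : ℕ → Page) (y : Page) : Finset Page → ℕ → ℕ → ℝ
  | _, _, 0 => 0
  | M, t, n + 1 => if req t = y then ((harmonic (k - M.card) : ℚ) : ℝ)
      else markWeight k req y (insert (req t) M) (t + 1) n

theorem one_le_growth (k : ℕ) : 1 ≤ 1 + 1 / (k : ℝ) := by
  have : 0 ≤ 1 / (k : ℝ) := by positivity
  linarith

theorem randWeight_nonneg (k : ℕ) (req : ℕ → Page) (y : Page) (t n : ℕ) :
    0 ≤ randWeight k req y t n := by
  induction n generalizing t with
  | zero => exact le_rfl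
  | succ n ih =>
    simp only [randWeight]
    split_ifs
    · have := one_le_growth k
      positivity
    · exact ih _

theorem randWeight_le (k : ℕ) (req : ℕ → Page) (y : Page) (t n : ℕ) :
    randWeight k req y t n ≤ (1 + 1 / (k : ℝ)) ^ n := by
  have h1 := one_le_growth k
  induction n generalizing t with
  | zero => simp [randWeight]
  | succ n ih =>
    have h2 : (1 + 1 / (k : ℝ)) ^ n ≤ (1 + 1 / (k : ℝ)) ^ (n + 1) :=
      pow_le_pow_right₀ h1 (by omega)
    simp only [randWeight]
    split_ifs
    · exact h2
    · exact (ih _).trans h2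

theorem randWeight_self (k : ℕ) (req : ℕ → Page) (t n : ℕ) :
    randWeight k req (req t) t (n + 1) = (1 + 1 / (k : ℝ)) ^ n := by
  simp [randWeight]

theorem randWeight_of_ne (k : ℕ) (req : ℕ → Page) {y : Page} {t : ℕ} (h : y ≠ req t) (n : ℕ) :
    randWeight k req y t (n + 1) = randWeight k req y (t + 1) n := by
  simp [randWeight, h.symm]

theorem sum_le_add_sum_erase (A : Finset Page) (x : Page) (g : Page → ℝ) (hx : 0 ≤ g x) :
    ∑ y ∈ A, g y ≤ g x + ∑ y ∈ A.erase x, g y := by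
  by_cases h : x ∈ A
  · rw [Finset.add_sum_erase _ _ h]
  · rw [Finset.erase_eq_of_notMem h]
    linarith

/-- Distinct pages have distinct first requests, so their weights are distinct terms of a geometric
series. Divided by `k`, this makes the average weight of a random victim at most `(1 + 1 / k) ^ n -
1`: exactly one less than the weight of a page requested with `n` steps to go, and the difference
pays for loading it. -/
theorem sum_randWeight_le {k : ℕ} (hk : 0 < k) (req : ℕ → Page) (A : Finset Page) (t n : ℕ) :
    ∑ y ∈ A, randWeight k req y t n ≤ k * ((1 + 1 / (k : ℝ)) ^ n - 1) := by
  induction n generalizing t A with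
  | zero => simp [randWeight]
  | succ n ih =>
    have hk' : (k : ℝ) ≠ 0 := by positivity
    refine (sum_le_add_sum_erase A (req t) _ (randWeight_nonneg _ _ _ _ _)).trans ?_
    rw [randWeight_self, Finset.sum_congr rfl fun y hy =>
      randWeight_of_ne k req (Finset.ne_of_mem_erase hy) n]
    have := ih (A.erase (req t)) (t + 1)
    have h2 : (k : ℝ) * ((1 + 1 / (k : ℝ)) ^ (n + 1) - 1)
        = (1 + 1 / (k : ℝ)) ^ n + k * ((1 + 1 / (k : ℝ)) ^ n - 1) := by
      have h3 : (k : ℝ) * (1 / k) = 1 := mul_one_div_cancel hk'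
      rw [pow_succ]
      linear_combination (1 + 1 / (k : ℝ)) ^ n * h3
    linarith

/-- Compares with `exp 2 < 8`. The number `2 * k` is the maximal length of a period. -/
theorem growth_pow_le {k : ℕ} (hk : 0 < k) {n : ℕ} (hn : n ≤ 2 * k) :
    (1 + 1 / (k : ℝ)) ^ n ≤ 8 := by
  have h1 : (1 + 1 / (k : ℝ)) ^ n ≤ (1 + 1 / (k : ℝ)) ^ (2 * k) :=
    pow_le_pow_right₀ (one_le_growth k) hn
  have h2 : 1 + 1 / (k : ℝ) ≤ Real.exp (1 / k) := by
    have := Real.add_one_le_exp (1 / (k : ℝ))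
    linarith
  have h3 : (1 + 1 / (k : ℝ)) ^ (2 * k) ≤ Real.exp (1 / k) ^ (2 * k) :=
    pow_le_pow_left₀ (by linarith [one_le_growth k]) h2 _
  have hk' : (k : ℝ) ≠ 0 := by positivity
  have h4 : Real.exp (1 / k) ^ (2 * k) = Real.exp 1 * Real.exp 1 := by
    rw [← Real.exp_nat_mul, ← Real.exp_add]
    congr 1
    push_cast
    field_simp
    norm_num
  have h5 := Real.exp_one_lt_d9
  have h6 := Real.exp_pos 1
  nlinarith

theorem harmonic_nonneg (n : ℕ) : (0 : ℝ) ≤ ((harmonic n : ℚ) : ℝ) := by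
  have : (0 : ℚ) ≤ harmonic n := by
    unfold harmonic
    positivity
  exact_mod_cast this

theorem harmonic_mono {m n : ℕ} (h : m ≤ n) :
    ((harmonic m : ℚ) : ℝ) ≤ ((harmonic n : ℚ) : ℝ) := by
  have : harmonic m ≤ harmonic n := by
    unfold harmonic
    refine Finset.sum_le_sum_of_subset_of_nonneg (Finset.range_mono h) fun i _ _ => ?_
    positivity
  exact_mod_cast this

theorem cast_harmonic_succ (n : ℕ) :
    ((harmonic (n + 1) : ℚ) : ℝ) = ((harmonic n : ℚ) : ℝ) + 1 / ((n : ℝ) + 1) := by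
  rw [harmonic_succ]
  push_cast
  rw [one_div]

theorem markWeight_nonneg (k : ℕ) (req : ℕ → Page) (y : Page) (M : Finset Page) (t n : ℕ) :
    0 ≤ markWeight k req y M t n := by
  induction n generalizing t M with
  | zero => exact le_rfl
  | succ n ih =>
    simp only [markWeight]
    split_ifs
    · exact harmonic_nonneg _
    · exact ih _ _

theorem markWeight_le (k : ℕ) (req : ℕ → Page) (y : Page) (M : Finset Page) (t n : ℕ) :
    markWeight k req y M t n ≤ ((harmonic k : ℚ) : ℝ) := by
  induction n generalizing t M with
  | zero => exact harmonic_nonneg _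
  | succ n ih =>
    simp only [markWeight]
    split_ifs
    · exact harmonic_mono (Nat.sub_le _ _)
    · exact ih _ _

theorem markWeight_self (k : ℕ) (req : ℕ → Page) (M : Finset Page) (t n : ℕ) :
    markWeight k req (req t) M t (n + 1) = ((harmonic (k - M.card) : ℚ) : ℝ) := by
  simp [markWeight]

theorem markWeight_of_ne (k : ℕ) (req : ℕ → Page) {y : Page} {t : ℕ} (h : y ≠ req t)
    (M : Finset Page) (n : ℕ) :
    markWeight k req y M t (n + 1) = markWeight k req y (insert (req t) M) (t + 1) n := by
  simp [markWeight, h.symm]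

/-- The first request of an unmarked page marks it, so the pages of `A` are first requested at
different sizes of the marked set, and the nonzero weights are harmonic numbers with different
indices. -/
theorem sum_markWeight_le (k : ℕ) (req : ℕ → Page) (A M : Finset Page) (hAM : Disjoint A M)
    (t n : ℕ) :
    ∑ y ∈ A, markWeight k req y M t n
      ≤ ∑ j ∈ Finset.range (k - M.card), ((harmonic (j + 1) : ℚ) : ℝ) := by
  induction n generalizing t A M with
  | zero =>
    simp only [markWeight, Finset.sum_const_zero]
    exact Finset.sum_nonneg fun j _ => harmonic_nonneg _
  | succ n ih =>
    by_cases hM : req t ∈ M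
    · have hA : ∀ y ∈ A, y ≠ req t := fun y hy h =>
        Finset.disjoint_left.1 hAM hy (h ▸ hM)
      rw [Finset.sum_congr rfl fun y hy => markWeight_of_ne k req (hA y hy) M n,
        Finset.insert_eq_of_mem hM]
      exact ih A M hAM (t + 1)
    · refine (sum_le_add_sum_erase A (req t) _ (markWeight_nonneg _ _ _ _ _ _)).trans ?_
      rw [markWeight_self, Finset.sum_congr rfl fun y hy =>
        markWeight_of_ne k req (Finset.ne_of_mem_erase hy) M n]
      have hd : Disjoint (A.erase (req t)) (insert (req t) M) := by
        rw [Finset.disjoint_left] at hAM ⊢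
        intro y hy hy'
        rcases Finset.mem_insert.1 hy' with h | h
        · exact Finset.ne_of_mem_erase hy h
        · exact hAM (Finset.mem_of_mem_erase hy) h
      have := ih _ _ hd (t + 1)
      rw [Finset.card_insert_of_notMem hM] at this
      -- With `k` or more marked pages, truncated subtraction turns all remaining weights into
      -- `harmonic 0 = 0`.
      rcases Nat.eq_zero_or_pos (k - M.card) with h0 | h0
      · have h1 : k - (M.card + 1) = 0 := by omega
        rw [h1] at this
        rw [h0]
        simpa using this
      · obtain ⟨v, hv⟩ : ∃ v, k - M.card = v + 1 := ⟨k - M.card - 1, by omega⟩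
        have h1 : k - (M.card + 1) = v := by omega
        rw [h1] at this
        rw [hv, Finset.sum_range_succ]
        linarith

theorem sum_harmonic (n : ℕ) :
    ∑ j ∈ Finset.range n, ((harmonic (j + 1) : ℚ) : ℝ)
      = (n + 1) * ((harmonic n : ℚ) : ℝ) - n := by
  induction n with
  | zero => simp
  | succ n ih =>
    rw [Finset.sum_range_succ, ih, cast_harmonic_succ]
    have : (n : ℝ) + 1 ≠ 0 := by positivity
    push_cast
    field_simp
    ring

/-- Average weight of a random unmarked page after the request of an unmarked page. -/
theorem sum_markWeight_div_le (k : ℕ) (req : ℕ → Page) (A M : Finset Page) (r : Page) (t n : ℕ)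
    (hAM : Disjoint A M) (hA : A.card = k - M.card) (hA0 : 0 < A.card) (ht : r ∉ A)
    (hM : r ∉ M) :
    (∑ y ∈ A, markWeight k req y (insert r M) t n) / A.card
      ≤ ((harmonic (k - M.card) : ℚ) : ℝ) - 1 := by
  have hd : Disjoint A (insert r M) := by
    rw [Finset.disjoint_insert_right]
    exact ⟨ht, hAM⟩
  have := sum_markWeight_le k req A (insert r M) hd t n
  rw [Finset.card_insert_of_notMem hM] at this
  obtain ⟨v, hv⟩ : ∃ v, k - M.card = v + 1 := ⟨k - M.card - 1, by omega⟩
  have h1 : k - (M.card + 1) = v := by omega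
  rw [h1, sum_harmonic] at this
  rw [hA, hv, cast_harmonic_succ]
  have hv' : (0 : ℝ) < (v : ℝ) + 1 := by positivity
  rw [div_le_iff₀ (by push_cast; exact hv')]
  -- The bound is exact: `((v + 1) * H v - v) / (v + 1) = H (v + 1) - 1`.
  have : (((harmonic v : ℚ) : ℝ) + 1 / ((v : ℝ) + 1) - 1) * ((v + 1 : ℕ) : ℝ)
      = (v + 1) * ((harmonic v : ℚ) : ℝ) - v := by
    push_cast
    field_simp
    ring
  linarith

/-- `H k ≤ 1 + log k ≤ 2 + L`, and `L ≥ 1` absorbs the constant. This lets the `L` lower levels save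
up for the marking level. -/
theorem harmonic_le_three_mul_log {k : ℕ} (hk : 2 ≤ k) :
    ((harmonic k : ℚ) : ℝ) ≤ 3 * (Nat.log 2 k : ℕ) := by
  have h1 : ((harmonic k : ℚ) : ℝ) ≤ 1 + Real.log k := harmonic_le_one_add_log k
  have h2 : k < 2 ^ (Nat.log 2 k + 1) := Nat.lt_pow_succ_log_self (by norm_num) k
  have h3 : Real.log k ≤ Real.log ((2 : ℝ) ^ (Nat.log 2 k + 1)) := by
    apply Real.log_le_log (by positivity)
    exact_mod_cast h2.le
  rw [Real.log_pow] at h3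
  have h4 : Real.log 2 ≤ 1 := by
    have := Real.log_two_lt_d9
    linarith
  have h5 : (1 : ℝ) ≤ (Nat.log 2 k : ℕ) := by
    exact_mod_cast Nat.log_pos (by norm_num) hk
  push_cast at h3
  nlinarith

end weights

end Caching

namespace Caching

/-! ### Phases and epochs -/

/-- The bookkeeping that depends on the requests only. A phase is a maximal interval with requests
to at most `k` pages; `req` is the set of pages requested so far in the current phase and `base` is
the set of pages of the previous phase (in the first phase, the initial cache). A phase is divided
into epochs: an epoch of weight `w` lasts until there are `2 * w` requested pages outside of
`base`. -/
structure Track (Page : Type u) where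
  base : Finset Page
  req : Finset Page
  w : ℕ

namespace Track

variable {Page : Type u} [DecidableEq Page]

/-- The number of pages requested in the current phase, but not in the previous one. -/
def clean (d : Track Page) : ℕ := (d.req \ d.base).card

/-- The pages of the current and the previous phase. -/
def pages (d : Track Page) : Finset Page := d.base ∪ d.req

/-- The request `r` starts a new phase. -/
abbrev NewPhase (k : ℕ) (d : Track Page) (r : Page) : Prop := r ∉ d.req ∧ k ≤ d.req.card

/-- The phase data after request `r`, without the update of the weight. -/
def enter (k : ℕ) (d : Track Page) (r : Page) : Track Page :=
  if d.NewPhase k r then ⟨d.req, {r}, 0⟩ else ⟨d.base, insert r d.req, d.w⟩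

/-- The request `r` starts a new epoch. -/
abbrev Reset (k : ℕ) (d : Track Page) (r : Page) : Prop :=
  2 * (d.enter k r).w ≤ (d.enter k r).clean ∧ 0 < (d.enter k r).clean

/-- The phase and epoch data after request `r`. -/
def next (k : ℕ) (d : Track Page) (r : Page) : Track Page :=
  if d.Reset k r then ⟨(d.enter k r).base, (d.enter k r).req, (d.enter k r).clean⟩
  else d.enter k r

/-- Properties that hold at all times. -/
structure Valid (k : ℕ) (d : Track Page) : Prop where
  card_base : d.base.card ≤ k
  card_req : d.req.card ≤ k
  clean_lt : d.clean < 2 * d.w ∨ (d.clean = 0 ∧ d.w = 0)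
  w_le : d.w ≤ d.clean

variable {k : ℕ} {d : Track Page} {r : Page}

/-- The page that opens a phase is clean, so the phase begins with an epoch of weight 1. -/
theorem next_of_newPhase (h : d.NewPhase k r) : d.Reset k r ∧ d.next k r = ⟨d.req, {r}, 1⟩ := by
  have h1 : d.enter k r = ⟨d.req, {r}, 0⟩ := by simp only [enter, if_pos h]
  have h2 : (d.enter k r).clean = 1 := by
    rw [h1]
    rw [clean, Finset.sdiff_eq_self_of_disjoint (Finset.disjoint_singleton_left.2 h.1)]
    exact Finset.card_singleton r
  have h3 : d.Reset k r := ⟨by rw [h2, h1]; simp, by omega⟩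
  refine ⟨h3, ?_⟩
  rw [next, if_pos h3, h2, h1]

theorem enter_of_not_newPhase (h : ¬ d.NewPhase k r) :
    d.enter k r = ⟨d.base, insert r d.req, d.w⟩ := by
  simp only [enter, if_neg h]

theorem clean_insert (b q : Finset Page) (w w' : ℕ) (r : Page) :
    (⟨b, insert r q, w⟩ : Track Page).clean
      = (⟨b, q, w'⟩ : Track Page).clean + if r ∈ b ∪ q then 0 else 1 := by
  simp only [clean]
  by_cases hb : r ∈ b
  · simp [Finset.insert_sdiff_of_mem _ hb, hb]
  · by_cases hq : r ∈ q
    · simp [Finset.insert_eq_of_mem hq, hq]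
    · rw [Finset.insert_sdiff_of_notMem _ hb, Finset.card_insert_of_notMem (by simp [hq])]
      simp [hb, hq]

/-- Before the request, `Valid` keeps the clean pages below the threshold, so within a phase only a
clean page can start an epoch; the new weight is at least twice the old one. -/
theorem next_of_reset (hd : d.Valid k) (h : ¬ d.NewPhase k r) (hr : d.Reset k r) :
    r ∉ d.pages ∧ d.next k r = ⟨d.base, insert r d.req, (d.next k r).clean⟩ ∧
      (d.next k r).clean = d.clean + 1 ∧ 2 * d.w ≤ (d.next k r).clean := by
  have h1 := enter_of_not_newPhase h
  have h2 := clean_insert d.base d.req d.w d.w r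
  have h3 := hd.clean_lt
  have h4 : d.next k r = ⟨d.base, insert r d.req, (d.enter k r).clean⟩ := by
    rw [next, if_pos hr, h1]
  have h5 : (d.next k r).clean = (d.enter k r).clean := by rw [h4, h1]; rfl
  obtain ⟨ha, hb⟩ := hr
  rw [h5]
  rw [h1] at ha hb
  rw [h1] at h4 ⊢
  simp only at ha
  refine ⟨fun hm => ?_, h4, ?_, ha⟩
  · rw [if_pos (show r ∈ d.base ∪ d.req from hm)] at h2
    change _ = d.clean + 0 at h2
    omega
  · rw [h2]
    split_ifs with hm
    · rw [if_pos hm] at h2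
      change _ = d.clean + 0 at h2
      omega
    · rfl

theorem next_of_not_reset (hr : ¬ d.Reset k r) :
    ¬ d.NewPhase k r ∧ d.next k r = ⟨d.base, insert r d.req, d.w⟩ ∧
      (d.next k r).clean = d.clean + (if r ∈ d.pages then 0 else 1) ∧
      ((d.next k r).clean < 2 * d.w ∨ ((d.next k r).clean = 0)) := by
  have h : ¬ d.NewPhase k r := fun h => hr (next_of_newPhase h).1
  have h1 := enter_of_not_newPhase h
  have h4 : d.next k r = ⟨d.base, insert r d.req, d.w⟩ := by
    rw [next, if_neg hr, h1]
  refine ⟨h, h4, ?_, ?_⟩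
  · rw [h4]
    exact clean_insert d.base d.req d.w d.w r
  · rw [h4]
    simp only [Reset, h1] at hr
    omega

theorem clean_pos_of_reset (hr : d.Reset k r) :
    (d.next k r).w = (d.next k r).clean ∧ 0 < (d.next k r).w := by
  have : d.next k r = ⟨(d.enter k r).base, (d.enter k r).req, (d.enter k r).clean⟩ := by
    rw [next, if_pos hr]
  rw [this]
  exact ⟨rfl, hr.2⟩

theorem Valid.next (hk : 0 < k) (hd : d.Valid k) (r : Page) : (d.next k r).Valid k := by
  by_cases hp : d.NewPhase k r
  · obtain ⟨hr, he⟩ := next_of_newPhase hp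
    have hw := clean_pos_of_reset hr
    rw [he] at hw ⊢
    exact ⟨hd.card_req, by simpa using Nat.succ_le_of_lt hk, by omega, hw.1.le⟩
  · have hcard : (insert r d.req).card ≤ k := by
      by_cases h : r ∈ d.req
      · rw [Finset.insert_eq_of_mem h]; exact hd.card_req
      · rw [Finset.card_insert_of_notMem h]
        by_contra h'
        exact hp ⟨h, by omega⟩
    by_cases hr : d.Reset k r
    · have hw := clean_pos_of_reset hr
      obtain ⟨-, he, -, -⟩ := next_of_reset hd hp hr
      refine ⟨?_, ?_, by omega, hw.1.le⟩
      · rw [he]; exact hd.card_base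
      · rw [he]; exact hcard
    · obtain ⟨-, he, hc, h2⟩ := next_of_not_reset hr
      have hw : (d.next k r).w = d.w := by rw [he]
      have h3 := hd.w_le
      refine ⟨?_, ?_, ?_, ?_⟩
      · rw [he]; exact hd.card_base
      · rw [he]; exact hcard
      · rw [hw]
        split_ifs at hc <;> omega
      · rw [hw]
        split_ifs at hc <;> omega

theorem mem_pages_next (k : ℕ) (d : Track Page) (r : Page) : r ∈ (d.next k r).pages := by
  by_cases hp : d.NewPhase k r
  · rw [(next_of_newPhase hp).2]
    simp [pages]
  · have h1 := enter_of_not_newPhase hp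
    rw [next]
    split_ifs <;> simp [h1, pages]

theorem pages_next_of_not_newPhase (hp : ¬ d.NewPhase k r) :
    (d.next k r).pages = insert r d.pages := by
  have h1 := enter_of_not_newPhase hp
  rw [next]
  split_ifs <;> simp [h1, pages]

/-- The phase and epoch data before request `t`. -/
def at_ (k : ℕ) (init : Finset Page) (req : ℕ → Page) : ℕ → Track Page
  | 0 => ⟨init, ∅, 0⟩
  | t + 1 => (at_ k init req t).next k (req t)

/-- The total weight of all epochs started before request `t`. -/
def totalWeight (k : ℕ) (init : Finset Page) (req : ℕ → Page) : ℕ → ℕ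
  | 0 => 0
  | t + 1 => totalWeight k init req t +
      if (at_ k init req t).Reset k (req t) then (at_ k init req (t + 1)).w else 0

/-- First request of the current phase. -/
def phaseStart (k : ℕ) (init : Finset Page) (req : ℕ → Page) : ℕ → ℕ
  | 0 => 0
  | t + 1 => if (at_ k init req t).NewPhase k (req t) then t else phaseStart k init req t

/-- First request of the previous phase. -/
def prevStart (k : ℕ) (init : Finset Page) (req : ℕ → Page) : ℕ → ℕ
  | 0 => 0
  | t + 1 => if (at_ k init req t).NewPhase k (req t) then phaseStart k init req t
      else prevStart k init req t

end Track

/-! ### Belady's algorithm -/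

section Belady

variable {Page : Type u} [DecidableEq Page] {k : ℕ} {init : Finset Page} {req : ℕ → Page}
  {T : ℕ} {B : ℕ → Finset Page}

theorem faults_succ (req : ℕ → Page) (B : ℕ → Finset Page) (t : ℕ) :
    faults req (t + 1) B = faults req t B + if req t ∈ B t then 0 else 1 := by
  unfold faults
  rw [Finset.range_add_one, Finset.filter_insert]
  split_ifs
  · rfl
  · rw [Finset.card_insert_of_notMem (by simp)]

theorem faults_mono (req : ℕ → Page) (B : ℕ → Finset Page) {s t : ℕ} (h : s ≤ t) :
    faults req s B ≤ faults req t B := by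
  unfold faults
  exact Finset.card_le_card (Finset.filter_subset_filter _ (Finset.range_mono h))

namespace IsBelady

theorem subset_insert (h : IsBelady k init req T B) {t : ℕ} (ht : t < T) :
    B (t + 1) ⊆ insert (req t) (B t) := by
  by_cases hm : req t ∈ B t
  · rw [h.hit t ht hm]; exact Finset.subset_insert _ _
  · by_cases hc : (B t).card < k
    · rw [h.load t ht hm hc]
    · obtain ⟨p, -, -, he⟩ := h.evict t ht hm (by omega)
      rw [he]
      exact Finset.insert_subset_insert _ (Finset.erase_subset _ _)

theorem mem_succ (h : IsBelady k init req T B) {t : ℕ} (ht : t < T) : req t ∈ B (t + 1) := by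
  by_cases hm : req t ∈ B t
  · rw [h.hit t ht hm]; exact hm
  · by_cases hc : (B t).card < k
    · rw [h.load t ht hm hc]; exact Finset.mem_insert_self _ _
    · obtain ⟨p, -, -, he⟩ := h.evict t ht hm (by omega)
      rw [he]; exact Finset.mem_insert_self _ _

theorem card_succ (h : IsBelady k init req T B) {t : ℕ} (ht : t < T) (hB : (B t).card ≤ k) :
    (B t).card ≤ (B (t + 1)).card ∧ (B (t + 1)).card ≤ k := by
  by_cases hm : req t ∈ B t
  · rw [h.hit t ht hm]; exact ⟨le_rfl, hB⟩
  · by_cases hc : (B t).card < k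
    · rw [h.load t ht hm hc, Finset.card_insert_of_notMem hm]; omega
    · obtain ⟨p, hp, -, he⟩ := h.evict t ht hm (by omega)
      have : req t ∉ (B t).erase p := fun h' => hm (Finset.mem_of_mem_erase h')
      have h0 := Finset.card_pos.2 ⟨p, hp⟩
      rw [he, Finset.card_insert_of_notMem this, Finset.card_erase_of_mem hp]
      omega

theorem card_le (h : IsBelady k init req T B) (hinit : init.card ≤ k) :
    ∀ t ≤ T, (B t).card ≤ k
  | 0, _ => by rw [h.zero]; exact hinit
  | t + 1, ht => (h.card_succ ht (card_le h hinit t (by omega))).2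

theorem card_mono (h : IsBelady k init req T B) (hinit : init.card ≤ k) {s t : ℕ} (hst : s ≤ t)
    (ht : t ≤ T) : (B s).card ≤ (B t).card := by
  induction t, hst using Nat.le_induction with
  | base => exact le_rfl
  | succ t hst ih =>
    exact (ih (by omega)).trans (h.card_succ ht (h.card_le hinit t (by omega))).1

theorem of_evicted (h : IsBelady k init req T B) {t : ℕ} (ht : t < T) {y : Page}
    (hy : y ∈ B t) (hy' : y ∉ B (t + 1)) :
    k ≤ (B t).card ∧ req t ∉ B t ∧
      ∀ q ∈ B t, ∀ s, t < s → s < T → req s = y → ∃ s', t < s' ∧ s' ≤ s ∧ req s' = q := by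
  by_cases hm : req t ∈ B t
  · rw [h.hit t ht hm] at hy'; exact absurd hy hy'
  · by_cases hc : (B t).card < k
    · rw [h.load t ht hm hc] at hy'
      exact absurd (Finset.mem_insert_of_mem hy) hy'
    · obtain ⟨p, hp, hq, he⟩ := h.evict t ht hm (by omega)
      have : y = p := by
        by_contra hne
        rw [he] at hy'
        exact hy' (Finset.mem_insert_of_mem (Finset.mem_erase.2 ⟨hne, hy⟩))
      subst this
      exact ⟨by omega, hm, hq⟩

theorem exists_evicted {s t : ℕ} (hst : s ≤ t) {y : Page} (hs : y ∈ B s) (ht : y ∉ B t) :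
    ∃ v, s ≤ v ∧ v < t ∧ y ∈ B v ∧ y ∉ B (v + 1) := by
  induction t, hst using Nat.le_induction with
  | base => exact absurd hs ht
  | succ t hst ih =>
    by_cases hy : y ∈ B t
    · exact ⟨t, hst, by omega, hy, ht⟩
    · obtain ⟨v, h1, h2, h3⟩ := ih hy
      exact ⟨v, h1, by omega, h3⟩

theorem subset_union (h : IsBelady k init req T B) {s t : ℕ} (hst : s ≤ t) (ht : t ≤ T) :
    B t ⊆ B s ∪ (Finset.Ico s t).image req := by
  induction t, hst using Nat.le_induction with
  | base => exact Finset.subset_union_left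
  | succ t hst ih =>
    refine (h.subset_insert ht).trans ?_
    intro y hy
    rcases Finset.mem_insert.1 hy with rfl | hy
    · exact Finset.mem_union_right _ (Finset.mem_image_of_mem _ (by simp; omega))
    · rcases Finset.mem_union.1 (ih (by omega) hy) with hy | hy
      · exact Finset.mem_union_left _ hy
      · refine Finset.mem_union_right _ (Finset.image_subset_image ?_ hy)
        exact Finset.Ico_subset_Ico_right (by omega)

/-- Every requested page that is not in the cache in the beginning causes a fault. -/
theorem card_sdiff_add_faults_le (h : IsBelady k init req T B) {s t : ℕ} (hst : s ≤ t)
    (ht : t ≤ T) :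
    ((Finset.Ico s t).image req \ B s).card + faults req s B ≤ faults req t B := by
  induction t, hst using Nat.le_induction with
  | base => simp
  | succ t hst ih =>
    have ih := ih (by omega)
    rw [faults_succ, ← Finset.insert_Ico_right_eq_Ico_add_one hst, Finset.image_insert]
    by_cases hB : req t ∈ B t
    · have := h.subset_union hst (by omega) hB
      have h2 : insert (req t) ((Finset.Ico s t).image req) \ B s
          = (Finset.Ico s t).image req \ B s := by
        rcases Finset.mem_union.1 this with h' | h'
        · rw [Finset.insert_sdiff_of_mem _ h']
        · rw [Finset.insert_eq_of_mem h']
      rw [h2]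
      omega
    · rw [if_neg hB]
      have : (insert (req t) ((Finset.Ico s t).image req) \ B s).card
          ≤ ((Finset.Ico s t).image req \ B s).card + 1 := by
        refine (Finset.card_le_card ?_).trans (Finset.card_insert_le (req t) _)
        intro y hy
        simp only [Finset.mem_sdiff, Finset.mem_insert] at hy ⊢
        tauto
      omega

/-- Within a phase, a page that has been in the cache is not missing when it is requested. -/
theorem mem_of_mem_phase (h : IsBelady k init req T B) {s v x t : ℕ} (hsv : s ≤ v) (hvx : v ≤ x)
    (hxt : x < t) (ht : t ≤ T) (hcard : ((Finset.Ico s t).image req).card ≤ k)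
    (hv : req x ∈ B v) : req x ∈ B x := by
  by_contra hx
  obtain ⟨z, h1, h2, h3, h4⟩ := exists_evicted hvx hv hx
  obtain ⟨h5, h6, h7⟩ := h.of_evicted (by omega) h3 h4
  -- By Belady's rule, all `k` pages of `B z` are requested again up to time `x`; with the faulting
  -- page `req z` these are `k + 1` pages in one phase.
  have hsub : insert (req z) (B z) ⊆ (Finset.Ico s t).image req := by
    intro q hq
    rcases Finset.mem_insert.1 hq with rfl | hq
    · exact Finset.mem_image_of_mem _ (by simp; omega)
    · obtain ⟨s', h8, h9, rfl⟩ := h7 q hq x h2 (by omega) rfl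
      exact Finset.mem_image_of_mem _ (by simp; omega)
  have := Finset.card_le_card hsub
  rw [Finset.card_insert_of_notMem h6] at this
  omega

/-- By `mem_of_mem_phase`, a page can fault at its first request in the interval only, and only if
it is missing from `B s`. -/
theorem faults_le_phase (h : IsBelady k init req T B) {s t : ℕ} (hst : s ≤ t)
    (ht : t ≤ T) (hcard : ((Finset.Ico s t).image req).card ≤ k) :
    faults req t B ≤ faults req s B + ((Finset.Ico s t).image req \ B s).card := by
  induction t, hst using Nat.le_induction with
  | base => simp
  | succ t hst ih =>
    have hsub : (Finset.Ico s t).image req ⊆ (Finset.Ico s (t + 1)).image req :=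
      Finset.image_subset_image (Finset.Ico_subset_Ico_right (by omega))
    have ih := ih (by omega) ((Finset.card_le_card hsub).trans hcard)
    rw [faults_succ]
    by_cases hB : req t ∈ B t
    · have := Finset.card_le_card (Finset.sdiff_subset_sdiff hsub (le_refl (B s)))
      simp only [hB, if_true]
      omega
    · have h1 : req t ∉ B s := fun h' =>
        hB (h.mem_of_mem_phase le_rfl hst (by omega) ht hcard h')
      have h2 : req t ∉ (Finset.Ico s t).image req := by
        intro h'
        obtain ⟨z, hz, hzt⟩ := Finset.mem_image.1 h'
        simp only [Finset.mem_Ico] at hz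
        have h3 := h.mem_succ (t := z) (by omega)
        rw [hzt] at h3
        exact hB (h.mem_of_mem_phase (s := s) (v := z + 1) (by omega) (by omega) (by omega) ht
          hcard h3)
      rw [if_neg hB, ← Finset.insert_Ico_right_eq_Ico_add_one hst, Finset.image_insert,
        Finset.insert_sdiff_of_notMem _ h1, Finset.card_insert_of_notMem (by simp [h2])]
      omega

/-- The pages of the previous phase that Belady's algorithm reloads are no more than the pages
requested for the first time in the current phase. -/
theorem card_reloaded_le (h : IsBelady k init req T B) (hinit : init.card ≤ k) {s' s t : ℕ}
    (ht : t ≤ T) (hcard : ((Finset.Ico s' s).image req).card = k) :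
    (((Finset.Ico s t).image req ∩ (Finset.Ico s' s).image req) \ B s).card
      ≤ ((Finset.Ico s t).image req \ (Finset.Ico s' s).image req).card := by
  set base := (Finset.Ico s' s).image req with hbase
  rcases Finset.eq_empty_or_nonempty (((Finset.Ico s t).image req ∩ base) \ B s) with he | ⟨p, hp⟩
  · rw [he]; simp
  simp only [Finset.mem_sdiff, Finset.mem_inter] at hp
  obtain ⟨⟨hp1, hp2⟩, hp3⟩ := hp
  rw [hbase] at hp2
  obtain ⟨z, hz, rfl⟩ := Finset.mem_image.1 hp2
  obtain ⟨x, hx, hxz⟩ := Finset.mem_image.1 hp1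
  simp only [Finset.mem_Ico] at hz hx
  -- A single reloaded page suffices: when it was evicted, at time `v` in the previous phase, every
  -- cached page was due no later than it. So the pages of `B s` outside of `base`, which were in
  -- the cache at `v`, are all requested in the current phase and are clean.
  obtain ⟨v, h1, h2, h3, h4⟩ := exists_evicted (s := z + 1) (t := s) (by omega)
    (h.mem_succ (by omega)) hp3
  obtain ⟨h5, h6, h7⟩ := h.of_evicted (by omega) h3 h4
  have hJ : B s \ base ⊆ (Finset.Ico s t).image req \ base := by
    intro y hy
    simp only [Finset.mem_sdiff] at hy ⊢
    refine ⟨?_, hy.2⟩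
    have hyv : y ∈ B v := by
      rcases Finset.mem_union.1 (h.subset_union (s := v) (t := s) (by omega) (by omega) hy.1)
        with h' | h'
      · exact h'
      · exfalso
        apply hy.2
        rw [hbase]
        exact Finset.image_subset_image (Finset.Ico_subset_Ico_left (by omega)) h'
    obtain ⟨x', h8, h9, rfl⟩ := h7 y hyv x (by omega) (by omega) hxz
    have : s ≤ x' := by
      by_contra hlt
      exact hy.2 (Finset.mem_image_of_mem _ (by simp; omega))
    exact Finset.mem_image_of_mem _ (by simp; omega)
  -- The eviction at `v` shows that the cache is full since then, while `base` has exactly `k`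
  -- pages.
  have h8 : (base \ B s).card ≤ (B s \ base).card := by
    have h9 := h.card_mono hinit (s := v) (t := s) (by omega) (by omega)
    have h10 := Finset.card_sdiff_add_card_inter base (B s)
    have h11 := Finset.card_sdiff_add_card_inter (B s) base
    rw [Finset.inter_comm] at h11
    omega
  refine le_trans (Finset.card_le_card ?_) (h8.trans (Finset.card_le_card hJ))
  exact Finset.sdiff_subset_sdiff Finset.inter_subset_right le_rfl

end IsBelady

/-! ### Epoch weights compared with the faults of Belady's algorithm -/

namespace Track

variable (k init req)

/-- What the bookkeeping data mean. -/
structure Meaning (t : ℕ) : Prop where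
  valid : (at_ k init req t).Valid k
  phase_le : phaseStart k init req t ≤ t
  prev_le : prevStart k init req t ≤ phaseStart k init req t
  req_eq : (at_ k init req t).req = (Finset.Ico (phaseStart k init req t) t).image req
  base_eq : (prevStart k init req t = 0 ∧ phaseStart k init req t = 0 ∧
      (at_ k init req t).base = init) ∨
    ((at_ k init req t).base
        = (Finset.Ico (prevStart k init req t) (phaseStart k init req t)).image req ∧
      (at_ k init req t).base.card = k)

variable {k init} in
theorem meaning (hk : 0 < k) (hinit : init.card ≤ k) : ∀ t, Meaning k init req t
  | 0 => ⟨⟨hinit, by simp [at_], by simp [at_, clean], by simp [at_]⟩, by simp [phaseStart],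
      by simp [prevStart, phaseStart], by simp [at_, phaseStart], by simp [prevStart, phaseStart, at_]⟩
  | t + 1 => by
      obtain ⟨h1, h2, h3, h4, h5⟩ := meaning hk hinit t
      have hv := h1.next hk (req t)
      by_cases hp : (at_ k init req t).NewPhase k (req t)
      · have he := (next_of_newPhase hp).2
        have hps : phaseStart k init req (t + 1) = t := by simp only [phaseStart, if_pos hp]
        have hpp : prevStart k init req (t + 1) = phaseStart k init req t := by
          simp only [prevStart, if_pos hp]
        have hat : at_ k init req (t + 1) = ⟨(at_ k init req t).req, {req t}, 1⟩ := he
        refine ⟨hv, by omega, by omega, ?_, Or.inr ⟨?_, ?_⟩⟩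
        · rw [hat, hps]; simp
        · rw [hat, hps, hpp]; exact h4
        · rw [hat]; exact le_antisymm h1.card_req hp.2
      · have hps : phaseStart k init req (t + 1) = phaseStart k init req t := by
          simp only [phaseStart, if_neg hp]
        have hpp : prevStart k init req (t + 1) = prevStart k init req t := by
          simp only [prevStart, if_neg hp]
        have hb : (at_ k init req (t + 1)).base = (at_ k init req t).base := by
          change ((at_ k init req t).next k (req t)).base = _
          rw [next]
          split_ifs <;> rw [enter_of_not_newPhase hp]
        have hq : (at_ k init req (t + 1)).req = insert (req t) (at_ k init req t).req := by
          change ((at_ k init req t).next k (req t)).req = _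
          rw [next]
          split_ifs <;> rw [enter_of_not_newPhase hp]
        refine ⟨hv, by omega, by omega, ?_, ?_⟩
        · rw [hps, hq, h4, ← Finset.insert_Ico_right_eq_Ico_add_one h2, Finset.image_insert]
        · rw [hps, hpp, hb]; exact h5

variable {k init req}

/-- Upper bound for the faults of Belady's algorithm in the current phase. -/
theorem faults_le (hk : 0 < k) (hinit : init.card ≤ k) (h : IsBelady k init req T B) {t : ℕ}
    (ht : t ≤ T) :
    faults req t B ≤ faults req (phaseStart k init req t) B + 2 * (at_ k init req t).clean := by
  obtain ⟨h1, h2, h3, h4, h5⟩ := meaning req hk hinit t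
  have h6 := h.faults_le_phase h2 ht (h4 ▸ h1.card_req)
  have h7 : ((Finset.Ico (phaseStart k init req t) t).image req
      \ B (phaseStart k init req t)).card ≤ 2 * (at_ k init req t).clean := by
    -- In the first phase `base` is Belady's own cache, so all faults are clean pages. Later, the
    -- pages missing from the cache at the start of the phase are clean or reloaded, and the latter
    -- are no more than the former.
    rcases h5 with ⟨-, h0, hb⟩ | ⟨hb, hc⟩
    · rw [← h4, h0, h.zero]
      have : (at_ k init req t).clean = ((at_ k init req t).req \ init).card := by
        rw [clean, hb]
      omega
    · have h8 := h.card_reloaded_le hinit ht (hb ▸ hc)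
      rw [← hb, ← h4] at h8
      rw [← h4]
      have h9 : (at_ k init req t).req \ B (phaseStart k init req t) ⊆
          ((at_ k init req t).req \ (at_ k init req t).base) ∪
          (((at_ k init req t).req ∩ (at_ k init req t).base) \ B (phaseStart k init req t)) := by
        intro y hy
        simp only [Finset.mem_sdiff, Finset.mem_union, Finset.mem_inter] at hy ⊢
        tauto
      have h10 := (Finset.card_le_card h9).trans (Finset.card_union_le _ _)
      unfold clean
      omega
  omega

/-- The previous phase and the current one contain `k` plus `clean` distinct pages, and at most `k`
of them can be in the cache at the beginning. In the first phase the initial cache plays the role of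
the previous phase. -/
theorem clean_add_faults_le (hk : 0 < k) (hinit : init.card ≤ k) (h : IsBelady k init req T B)
    {t : ℕ} (ht : t ≤ T) :
    (at_ k init req t).clean + faults req (prevStart k init req t) B ≤ faults req t B := by
  obtain ⟨h1, h2, h3, h4, h5⟩ := meaning req hk hinit t
  have h6 := h.card_sdiff_add_faults_le (h3.trans h2) ht
  have h7 : (at_ k init req t).clean
      ≤ ((Finset.Ico (prevStart k init req t) t).image req \ B (prevStart k init req t)).card := by
    rcases h5 with ⟨h0', h0, hb⟩ | ⟨hb, hc⟩
    · rw [h0', h.zero, clean, hb, h4, h0]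
    · have h8 : (at_ k init req t).req ∪ (at_ k init req t).base
          = (Finset.Ico (prevStart k init req t) t).image req := by
        rw [h4, hb, ← Finset.image_union, Finset.union_comm,
          Finset.Ico_union_Ico_eq_Ico h3 h2]
      rw [← h8, clean]
      have h9 := Finset.card_sdiff_add_card (at_ k init req t).req (at_ k init req t).base
      have h10 := Finset.le_card_sdiff (B (prevStart k init req t))
        ((at_ k init req t).req ∪ (at_ k init req t).base)
      have h11 := h.card_le hinit (prevStart k init req t) (by omega)
      omega
  omega

/-- The total weight of all epochs is at most four times the number of faults. -/
theorem totalWeight_le (hk : 0 < k) (hinit : init.card ≤ k) (h : IsBelady k init req T B) {t : ℕ}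
    (ht : t ≤ T) : totalWeight k init req t ≤ 4 * faults req t B := by
  -- By doubling, the weights of a phase sum to at most twice the last one. At the end of the phase,
  -- `2 * w ≤ 2 * clean` is charged to the faults in this phase and the previous one; every fault is
  -- charged by two phases, whence the factor 4.
  have key : ∀ t ≤ T, totalWeight k init req t ≤ 2 * faults req (prevStart k init req t) B
      + 2 * faults req (phaseStart k init req t) B + 2 * (at_ k init req t).w := by
    intro t
    induction t with
    | zero => intro _; simp [totalWeight]
    | succ t ih =>
      intro ht
      have ih := ih (by omega)
      have hm := meaning req hk hinit t
      by_cases hp : (at_ k init req t).NewPhase k (req t)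
      · obtain ⟨hr, he⟩ := next_of_newPhase hp
        have hat : (at_ k init req (t + 1)).w = 1 := by
          change ((at_ k init req t).next k (req t)).w = 1
          rw [he]
        have hc := clean_add_faults_le hk hinit h (t := t) (by omega)
        have hw := hm.valid.w_le
        simp only [totalWeight, if_pos hr, phaseStart, prevStart, if_pos hp, hat]
        omega
      · by_cases hr : (at_ k init req t).Reset k (req t)
        · have h1 := clean_pos_of_reset hr
          obtain ⟨-, -, -, h2⟩ := next_of_reset hm.valid hp hr
          simp only [totalWeight, if_pos hr, phaseStart, prevStart, if_neg hp]
          change _ + ((at_ k init req t).next k (req t)).w ≤ _ +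
            2 * ((at_ k init req t).next k (req t)).w
          omega
        · obtain ⟨-, h1, -, -⟩ := next_of_not_reset hr
          have h2 : (at_ k init req (t + 1)).w = (at_ k init req t).w := by
            change ((at_ k init req t).next k (req t)).w = _
            rw [h1]
          simp only [totalWeight, if_neg hr, phaseStart, prevStart, if_neg hp, h2]
          omega
  have h1 := key t ht
  have hm := meaning req hk hinit t
  have h2 := clean_add_faults_le hk hinit h ht
  have h3 := hm.valid.w_le
  have h4 := faults_mono req B hm.phase_le
  omega

end Track

end Belady

end Caching

namespace Caching

/-! ### The algorithm -/

section trim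

variable {α : Type*}

/-- Some subset with at most `n` elements, as large as possible. -/
noncomputable def trim (n : ℕ) (A : Finset α) : Finset α :=
  if h : n ≤ A.card then (Finset.exists_subset_card_eq h).choose else A

theorem trim_subset (n : ℕ) (A : Finset α) : trim n A ⊆ A := by
  unfold trim
  split_ifs with h
  · exact (Finset.exists_subset_card_eq h).choose_spec.1
  · exact le_rfl

theorem card_trim (n : ℕ) (A : Finset α) : (trim n A).card = min n A.card := by
  unfold trim
  split_ifs with h
  · rw [(Finset.exists_subset_card_eq h).choose_spec.2]; omega
  · omega

theorem trim_eq_self {n : ℕ} {A : Finset α} (h : A.card ≤ n) : trim n A = A :=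
  Finset.eq_of_subset_of_card_le (trim_subset n A) (by rw [card_trim]; omega)

end trim

/-- The configuration of the algorithm. `cached` is the content of the cache and `ref` is a set of
pages believed to contain the cache of the optimal solution. On level `lev`, the algorithm counts
in `cnt` the requests outside of `ref`; if there are too many, it proceeds to the next level. On
the last level it evicts unmarked pages at random, without predictions. On the other levels, the
first fault starts a period, in which the predictor is queried `num` times; `pos` is the number of
steps of the period that are over. The answer to the query number `sel`, chosen at random, becomes
the new reference set. If the level changes, then `sel` is withdrawn and the period is no longer
`fresh`. -/
structure Conf (Page : Type u) where
  track : Track Page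
  cached : Finset Page
  ref : Finset Page
  marked : Finset Page
  lev : ℕ
  cnt : ℕ
  num : ℕ
  pos : ℕ
  sel : Option ℕ
  fresh : Bool

section conf

variable {Page : Type u} [DecidableEq Page]

/-- Bring page `r` into the cache `X`, evicting a random page outside of `M` if necessary. -/
noncomputable def evict (k : ℕ) (r : Page) (X M : Finset Page) : PMF (Finset Page) :=
  if r ∈ X then PMF.pure X
  else if X.card < k then PMF.pure (insert r X)
  else if h : (X \ M).Nonempty then
    (PMF.uniformOfFinset (X \ M) h).map fun p => insert r (X.erase p)
  -- This default never occurs under the invariants, see `Conf.Ready.unmarked_nonempty`.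
  else PMF.pure {r}

theorem finite_support_evict (k : ℕ) (r : Page) (X M : Finset Page) :
    (evict k r X M).support.Finite := by
  unfold evict
  split_ifs
  · exact finite_support_pure _
  · exact finite_support_pure _
  · exact finite_support_map _ (finite_support_uniform _ _)
  · exact finite_support_pure _

theorem of_mem_support_evict {k : ℕ} (hk : 0 < k) {r : Page} {X M Y : Finset Page}
    (hX : X.card ≤ k) (hY : Y ∈ (evict k r X M).support) : r ∈ Y ∧ Y.card ≤ k := by
  unfold evict at hY
  split_ifs at hY with h1 h2 h3
  · rw [PMF.support_pure] at hY
    rw [Set.mem_singleton_iff.1 hY]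
    exact ⟨h1, hX⟩
  · rw [PMF.support_pure] at hY
    rw [Set.mem_singleton_iff.1 hY, Finset.card_insert_of_notMem h1]
    exact ⟨Finset.mem_insert_self _ _, h2⟩
  · rw [PMF.mem_support_map_iff] at hY
    obtain ⟨p, hp, rfl⟩ := hY
    rw [PMF.support_uniformOfFinset] at hp
    have hp' : p ∈ X := (Finset.mem_sdiff.1 hp).1
    refine ⟨Finset.mem_insert_self _ _, (Finset.card_insert_le _ _).trans ?_⟩
    have := Finset.card_pos.2 ⟨p, hp'⟩
    rw [Finset.card_erase_of_mem hp']
    omega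
  · rw [PMF.support_pure] at hY
    rw [Set.mem_singleton_iff.1 hY]
    exact ⟨Finset.mem_singleton_self _, by simpa using Nat.succ_le_of_lt hk⟩

/-- In the situations that really occur, the page that is evicted is unmarked. -/
theorem mem_support_evict_cases {k : ℕ} {r : Page} {X M Y : Finset Page}
    (hX : X.card ≤ k) (hne : r ∉ X → X.card = k → (X \ M).Nonempty)
    (hY : Y ∈ (evict k r X M).support) :
    (r ∈ X ∧ Y = X) ∨ (r ∉ X ∧ X.card < k ∧ Y = insert r X) ∨
      (r ∉ X ∧ X.card = k ∧ ∃ p ∈ X \ M, Y = insert r (X.erase p)) := by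
  unfold evict at hY
  split_ifs at hY with h1 h2 h3
  · rw [PMF.support_pure] at hY
    exact Or.inl ⟨h1, hY⟩
  · rw [PMF.support_pure] at hY
    exact Or.inr (Or.inl ⟨h1, h2, hY⟩)
  · rw [PMF.mem_support_map_iff] at hY
    obtain ⟨p, hp, rfl⟩ := hY
    rw [PMF.support_uniformOfFinset] at hp
    exact Or.inr (Or.inr ⟨h1, by omega, p, hp, rfl⟩)
  · exact absurd (hne h1 (by omega)) h3

namespace Conf

/-- The actual cache content. -/
def cache (k : ℕ) (s : Conf Page) : Finset Page := if s.cached.card ≤ k then s.cached else ∅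

theorem card_cache_le {Page : Type u} (k : ℕ) (s : Conf Page) : (s.cache k).card ≤ k := by
  unfold cache
  split_ifs with h
  · exact h
  · simp

/-- The request `r` makes the algorithm proceed to the next level. -/
abbrev Fails (k L : ℕ) (s : Conf Page) (r : Page) : Prop :=
  ¬ s.track.Reset k r ∧ s.lev < L ∧ 7 * s.track.w < s.cnt + if r ∈ s.ref then 0 else 1

/-- Deterministic part of the reaction to request `r`. -/
noncomputable def prep (k L : ℕ) (s : Conf Page) (r : Page) : Conf Page :=
  let d := s.track.next k r
  if s.track.Reset k r then
    { track := d
      -- A new phase starts with the pages of the previous one in the cache. The trimming changes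
      -- nothing under the invariants; it makes the size bound unconditional.
      cached := if s.track.NewPhase k r then trim k s.track.req else s.cache k
      ref := d.pages, marked := ∅, lev := 0, cnt := 0, num := s.num, pos := s.pos
      sel := none, fresh := false }
  else if s.Fails k L r then
    -- The running period keeps `num` and `pos`: its queries are still made, though none will be
    -- adopted. The error analysis compares the adopted prediction with all predictions of the
    -- period, so the period must not be cut short.
    { track := d, cached := s.cache k, ref := d.pages, marked := ∅, lev := s.lev + 1, cnt := 0
      num := s.num, pos := s.pos, sel := none, fresh := false }
  else
    { track := d, cached := s.cache k, ref := insert r s.ref, marked := s.marked, lev := s.lev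
      cnt := s.cnt + if r ∈ s.ref then 0 else 1
      num := s.num, pos := s.pos, sel := s.sel, fresh := s.fresh }

/-- There is a fault outside of a period. -/
abbrev Starts (a L : ℕ) (N : ℕ → ℕ) (s : Conf Page) (r : Page) : Prop :=
  s.num * a ≤ s.pos ∧ r ∉ s.cached ∧ s.lev < L ∧ 0 < N s.lev

/-- Start a new period. -/
def launch (N : ℕ → ℕ) (s : Conf Page) (l : ℕ) : Conf Page :=
  { s with num := N s.lev, pos := 0, sel := some l, fresh := true }

/-- A query is made in the current step. -/
abbrev Asks (a : ℕ) (s : Conf Page) : Prop := s.pos < s.num * a ∧ a ∣ s.pos + 1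

/-- The answer to the query in the current step is used. -/
abbrev Due (a : ℕ) (s : Conf Page) : Prop := s.Asks a ∧ s.sel = some ((s.pos + 1) / a - 1)

/-- Adopt the answer `R` of the predictor. -/
noncomputable def sync (k : ℕ) (s : Conf Page) (r : Page) (R : Finset Page) : Conf Page :=
  { s with
    cached := insert r (trim (k - 1) (s.ref.erase r \ R))
    ref := insert r (trim (k - 1) (s.ref.erase r \ R))
    pos := s.pos + 1
    sel := none }

/-- Proceed to cache content `X`. -/
def serve (a L : ℕ) (s : Conf Page) (r : Page) (X : Finset Page) : Conf Page :=
  { s with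
    cached := X
    marked := if s.lev < L then s.marked else insert r s.marked
    pos := if s.pos < s.num * a then s.pos + 1 else s.pos }

/-- Serve the request. -/
noncomputable def finish (k a L : ℕ) (s : Conf Page) (r : Page) (R : Finset Page) :
    PMF (Conf Page) :=
  if s.Due a then PMF.pure (s.sync k r R)
  else (evict k r s.cached s.marked).map (s.serve a L r)

/-- The reaction to request `r` and answer `R`. -/
noncomputable def move (k a L : ℕ) (N : ℕ → ℕ) (s : Conf Page) (r : Page) (R : Finset Page) :
    PMF (Conf Page) :=
  if h : (s.prep k L r).Starts a L N r then
    (PMF.uniformOfFinset (Finset.range (N (s.prep k L r).lev))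
      (Finset.nonempty_range_iff.2 h.2.2.2.ne')).bind
      fun l => ((s.prep k L r).launch N l).finish k a L r R
  else (s.prep k L r).finish k a L r R

/-- The configuration in which it is decided whether there is a query. -/
noncomputable def lead (k a L : ℕ) (N : ℕ → ℕ) (s : Conf Page) (r : Page) : Conf Page :=
  -- The index 0 is arbitrary, as the decision to query does not depend on `sel`.
  if (s.prep k L r).Starts a L N r then (s.prep k L r).launch N 0 else s.prep k L r

/-- The query in reaction to request `r`. -/
noncomputable def ask (k a L : ℕ) (N : ℕ → ℕ) (s : Conf Page) (r : Page) :
    Option (Finset Page × ℕ) :=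
  if (s.lead k a L N r).Asks a then
    -- Removing this number of pages leaves room for `k - 1` pages besides `r`.
    some ((s.prep k L r).ref.erase r, ((s.prep k L r).ref.erase r).card + 1 - k)
  else none

variable {k a L : ℕ} {N : ℕ → ℕ}

theorem finite_support_finish (s : Conf Page) (r : Page) (R : Finset Page) :
    (s.finish k a L r R).support.Finite := by
  unfold finish
  split_ifs
  · exact finite_support_pure _
  · exact finite_support_map _ (finite_support_evict _ _ _ _)

theorem finite_support_move (s : Conf Page) (r : Page) (R : Finset Page) :
    (s.move k a L N r R).support.Finite := by
  unfold move
  split_ifs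
  · exact finite_support_bind (finite_support_uniform _ _) fun l _ => finite_support_finish _ _ _
  · exact finite_support_finish _ _ _

theorem mem_support_finish {s s' : Conf Page} {r : Page} {R : Finset Page}
    (h : s' ∈ (s.finish k a L r R).support) :
    (s.Due a ∧ s' = s.sync k r R) ∨
      (¬ s.Due a ∧ ∃ X ∈ (evict k r s.cached s.marked).support, s' = s.serve a L r X) := by
  unfold finish at h
  split_ifs at h with hd
  · rw [PMF.support_pure] at h
    exact Or.inl ⟨hd, h⟩
  · rw [PMF.mem_support_map_iff] at h
    obtain ⟨X, hX, rfl⟩ := h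
    exact Or.inr ⟨hd, X, hX, rfl⟩

theorem mem_support_move {s s' : Conf Page} {r : Page} {R : Finset Page}
    (h : s' ∈ (s.move k a L N r R).support) :
    ((s.prep k L r).Starts a L N r ∧ ∃ l < N (s.prep k L r).lev,
        s' ∈ (((s.prep k L r).launch N l).finish k a L r R).support) ∨
      (¬ (s.prep k L r).Starts a L N r ∧ s' ∈ ((s.prep k L r).finish k a L r R).support) := by
  unfold move at h
  split_ifs at h with hs
  · rw [PMF.mem_support_bind_iff] at h
    obtain ⟨l, hl, h⟩ := h
    rw [PMF.support_uniformOfFinset] at hl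
    exact Or.inl ⟨hs, l, by simpa using hl, h⟩
  · exact Or.inr ⟨hs, h⟩

theorem card_cached_prep (s : Conf Page) (r : Page) : (s.prep k L r).cached.card ≤ k := by
  unfold prep
  split_ifs
  · simp only [card_trim]; omega
  all_goals exact card_cache_le k s

theorem of_mem_support_finish (hk : 0 < k) {s s' : Conf Page} {r : Page} {R : Finset Page}
    (hs : s.cached.card ≤ k) (h : s' ∈ (s.finish k a L r R).support) :
    r ∈ s'.cached ∧ s'.cached.card ≤ k := by
  rcases mem_support_finish h with ⟨-, rfl⟩ | ⟨-, X, hX, rfl⟩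
  · refine ⟨Finset.mem_insert_self _ _, (Finset.card_insert_le _ _).trans ?_⟩
    rw [card_trim]
    omega
  · exact of_mem_support_evict hk hs hX

theorem of_mem_support_move (hk : 0 < k) {s s' : Conf Page} {r : Page} {R : Finset Page}
    (h : s' ∈ (s.move k a L N r R).support) : r ∈ s'.cached ∧ s'.cached.card ≤ k := by
  rcases mem_support_move h with ⟨-, l, -, h⟩ | ⟨-, h⟩
  · exact of_mem_support_finish hk (s := (s.prep k L r).launch N l) (card_cached_prep s r) h
  · exact of_mem_support_finish hk (card_cached_prep s r) h

end Conf

end conf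

section algorithm

variable {Page : Type u} [DecidableEq Page]

/-- The algorithm with `L` levels and periods with `N i` queries, at distance `a`, on level `i`. -/
noncomputable def levelAlgorithm (k a L : ℕ) (N : ℕ → ℕ) (hk : 0 < k) (init : Finset Page)
    (hinit : init.card ≤ k) : OnlineAlgorithm Page k init where
  State := Conf Page
  start :=
    { track := ⟨init, ∅, 0⟩, cached := init, ref := init, marked := ∅, lev := 0, cnt := 0
      num := 0, pos := 0, sel := none, fresh := false }
  -- Not the field `cached`: the size bound is required of all internal states, including
  -- unreachable ones.
  cache := Conf.cache k
  cache_start := by simp [Conf.cache, hinit]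
  card_cache := Conf.card_cache_le k
  ask := Conf.ask k a L N
  move := Conf.move k a L N
  mem_cache := by
    intro s r R s' hs'
    obtain ⟨h1, h2⟩ := Conf.of_mem_support_move hk hs'
    simp only [Conf.cache, if_pos h2]
    exact h1

end algorithm

end Caching

namespace Caching

/-! ### Invariants of the algorithm -/

namespace Track

variable {Page : Type u} [DecidableEq Page]

theorem card_pages (d : Track Page) : d.pages.card = d.base.card + d.clean := by
  rw [pages, clean, ← Finset.card_union_of_disjoint Finset.disjoint_sdiff,
    Finset.union_sdiff_self_eq_union]

theorem mem_req_next (k : ℕ) (d : Track Page) (r : Page) : r ∈ (d.next k r).req := by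
  by_cases hp : d.NewPhase k r
  · rw [(next_of_newPhase hp).2]
    simp
  · rw [next]
    split_ifs <;> simp [enter_of_not_newPhase hp]

end Track

namespace Conf

variable {Page : Type u} [DecidableEq Page]

/-- Invariants that hold at all times. -/
structure Core (k a L : ℕ) (N : ℕ → ℕ) (s : Conf Page) : Prop where
  valid : s.track.Valid k
  cached_sub : s.cached ⊆ s.ref
  ref_sub : s.ref ⊆ s.track.pages
  card_cached : s.cached.card ≤ k
  lev_le : s.lev ≤ L
  marked_sub : s.marked ⊆ s.cached
  marked_req : s.marked ⊆ s.track.req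
  marked_eq : s.lev < L → s.marked = ∅
  final : s.lev = L → s.ref = s.track.pages ∧ s.fresh = false
  cnt_le : s.lev < L → s.cnt ≤ 7 * s.track.w
  sel_some : ∀ l, s.sel = some l → l < s.num ∧ s.pos < (l + 1) * a ∧ s.fresh = true
  fresh : s.fresh = true → s.num = N s.lev
  num : s.num = 0 ∨ ∃ i < L, s.num = N i
  pos_le : s.pos ≤ s.num * a
  w_pos : s.num ≠ 0 → 0 < s.track.w

/-- Invariants between two requests. -/
structure Good (k a L : ℕ) (N : ℕ → ℕ) (s : Conf Page) : Prop extends Core k a L N s where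
  card_eq : s.cached.card = min k s.track.pages.card

/-- Invariants while request `r` is served. -/
structure Ready (k a L : ℕ) (N : ℕ → ℕ) (r : Page) (s : Conf Page) : Prop
    extends Core k a L N s where
  mem_ref : r ∈ s.ref
  mem_req : r ∈ s.track.req
  card_eq : s.cached.card = k ∨ (s.cached.card < k ∧ s.track.pages = insert r s.cached)
  mem_of_w : s.track.w = 0 → r ∈ s.cached

variable {k a L : ℕ} {N : ℕ → ℕ} {s : Conf Page} {r : Page}

theorem Core.cache_eq (h : s.Core k a L N) : s.cache k = s.cached := if_pos h.card_cached

theorem Core.sel_lev (h : s.Core k a L N) {l : ℕ} (hl : s.sel = some l) : s.lev < L := by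
  have h1 := (h.sel_some l hl).2.2
  rcases h.lev_le.lt_or_eq with h2 | h2
  · exact h2
  · rw [(h.final h2).2] at h1; simp at h1

/-- There are at most `k + 2 * w` pages around, so a full cache misses at most `2 * w` of them. If
the cache is not full, only `r` can be missing, and then `w` is positive. -/
theorem Ready.card_sdiff_pages_le (h : s.Ready k a L N r) :
    (s.track.pages \ s.cached).card ≤ 2 * s.track.w := by
  have h1 := s.track.card_pages
  have h2 := h.valid.card_base
  have h3 := h.valid.clean_lt
  rcases h.card_eq with hc | ⟨hc, hp⟩
  · rw [Finset.card_sdiff_of_subset (h.cached_sub.trans h.ref_sub)]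
    omega
  · by_cases hr : r ∈ s.cached
    · rw [hp, Finset.insert_eq_of_mem hr]; simp
    · have hw : s.track.w ≠ 0 := fun h0 => hr (h.mem_of_w h0)
      rw [hp, Finset.insert_sdiff_of_notMem _ hr]
      simp
      omega

theorem Ready.card_sdiff_le (h : s.Ready k a L N r) :
    (s.ref \ s.cached).card ≤ 2 * s.track.w :=
  (Finset.card_le_card (Finset.sdiff_subset_sdiff h.ref_sub le_rfl)).trans h.card_sdiff_pages_le

theorem prep_reset (L : ℕ) (h : s.track.Reset k r) :
    s.prep k L r =
      { track := s.track.next k r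
        cached := if s.track.NewPhase k r then trim k s.track.req else s.cache k
        ref := (s.track.next k r).pages, marked := ∅, lev := 0, cnt := 0, num := s.num,
        pos := s.pos, sel := none, fresh := false } := by
  simp only [prep, if_pos h]

theorem prep_fails (h : s.Fails k L r) :
    s.prep k L r =
      { track := s.track.next k r, cached := s.cache k, ref := (s.track.next k r).pages,
        marked := ∅, lev := s.lev + 1, cnt := 0, num := s.num, pos := s.pos, sel := none,
        fresh := false } := by
  simp only [prep, if_neg h.1, if_pos h]

theorem prep_regular (h1 : ¬ s.track.Reset k r) (h2 : ¬ s.Fails k L r) :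
    s.prep k L r =
      { track := s.track.next k r, cached := s.cache k, ref := insert r s.ref,
        marked := s.marked, lev := s.lev, cnt := s.cnt + if r ∈ s.ref then 0 else 1
        num := s.num, pos := s.pos, sel := s.sel, fresh := s.fresh } := by
  simp only [prep, if_neg h1, if_neg h2]

theorem track_prep (k L : ℕ) (s : Conf Page) (r : Page) :
    (s.prep k L r).track = s.track.next k r := by
  unfold prep
  split_ifs <;> rfl

theorem num_prep (k L : ℕ) (s : Conf Page) (r : Page) :
    (s.prep k L r).num = s.num ∧ (s.prep k L r).pos = s.pos := by
  unfold prep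
  split_ifs <;> exact ⟨rfl, rfl⟩

/-- The cache before the request, after a possible change of the phase. -/
theorem Good.card_cached_old (h : s.Good k a L N) (hp : ¬ s.track.NewPhase k r) :
    s.cached.card = k ∨
      (s.cached.card < k ∧ (s.track.next k r).pages = insert r s.cached) := by
  have h1 := h.card_eq
  rcases h.card_cached.lt_or_eq with hc | hc
  · refine Or.inr ⟨hc, ?_⟩
    rw [Track.pages_next_of_not_newPhase hp,
      Finset.eq_of_subset_of_card_le (h.cached_sub.trans h.ref_sub) (by omega)]
  · exact Or.inl hc

theorem Good.prep (hk : 0 < k) (h : s.Good k a L N) (r : Page) :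
    (s.prep k L r).Ready k a L N r := by
  have hv := h.valid.next hk r
  have hm := Track.mem_pages_next k s.track r
  have hq := Track.mem_req_next k s.track r
  by_cases hr : s.track.Reset k r
  · have hw := Track.clean_pos_of_reset hr
    rw [prep_reset L hr]
    have hX : (if s.track.NewPhase k r then trim k s.track.req else s.cache k)
        ⊆ (s.track.next k r).pages ∧
        (if s.track.NewPhase k r then trim k s.track.req else s.cache k).card ≤ k ∧
        ((if s.track.NewPhase k r then trim k s.track.req else s.cache k).card = k ∨
        ((if s.track.NewPhase k r then trim k s.track.req else s.cache k).card < k ∧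
          (s.track.next k r).pages =
            insert r (if s.track.NewPhase k r then trim k s.track.req else s.cache k))) := by
      split_ifs with hp
      · rw [trim_eq_self h.valid.card_req, (Track.next_of_newPhase hp).2]
        exact ⟨Finset.subset_union_left, h.valid.card_req,
          Or.inl (le_antisymm h.valid.card_req hp.2)⟩
      · rw [h.cache_eq]
        refine ⟨?_, h.card_cached, h.card_cached_old hp⟩
        rw [Track.pages_next_of_not_newPhase hp]
        exact (h.cached_sub.trans h.ref_sub).trans (Finset.subset_insert _ _)
    exact
      { valid := hv
        cached_sub := hX.1
        ref_sub := le_rfl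
        card_cached := hX.2.1
        lev_le := Nat.zero_le _
        marked_sub := Finset.empty_subset _
        marked_req := Finset.empty_subset _
        marked_eq := fun _ => rfl
        final := fun _ => ⟨rfl, rfl⟩
        cnt_le := fun _ => Nat.zero_le _
        sel_some := fun l hl => by simp at hl
        fresh := fun hf => by simp at hf
        num := h.num
        pos_le := h.pos_le
        w_pos := fun _ => hw.2
        mem_ref := hm
        mem_req := hq
        card_eq := hX.2.2
        mem_of_w := fun h0 => absurd h0 hw.2.ne' }
  · obtain ⟨hp, he, hc, hc'⟩ := Track.next_of_not_reset hr
    have hw : (s.track.next k r).w = s.track.w := by rw [he]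
    have hpages := Track.pages_next_of_not_newPhase hp
    have hsub : s.cached ⊆ (s.track.next k r).pages := by
      rw [hpages]
      exact (h.cached_sub.trans h.ref_sub).trans (Finset.subset_insert _ _)
    -- Weight 0 means that no clean page has appeared yet; then all pages fit into the cache and are
    -- in it.
    have hmw : (s.track.next k r).w = 0 → r ∈ s.cached := by
      intro h0
      have h1 : s.track.pages.card ≤ k := by
        have := s.track.card_pages
        have := h.valid.card_base
        have := h.valid.clean_lt
        omega
      have h2 := h.card_eq
      rw [Finset.eq_of_subset_of_card_le (h.cached_sub.trans h.ref_sub) (by omega)]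
      by_contra h3
      rw [if_neg h3] at hc
      omega
    by_cases hf : s.Fails k L r
    · rw [prep_fails hf, h.cache_eq]
      exact
        { valid := hv
          cached_sub := hsub
          ref_sub := le_rfl
          card_cached := h.card_cached
          lev_le := hf.2.1
          marked_sub := Finset.empty_subset _
          marked_req := Finset.empty_subset _
          marked_eq := fun _ => rfl
          final := fun _ => ⟨rfl, rfl⟩
          cnt_le := fun _ => Nat.zero_le _
          sel_some := fun l hl => by simp at hl
          fresh := fun hf => by simp at hf
          num := h.num
          pos_le := h.pos_le
          w_pos := fun hn => hw.symm ▸ h.w_pos hn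
          mem_ref := hm
          mem_req := hq
          card_eq := h.card_cached_old hp
          mem_of_w := hmw }
    · rw [prep_regular hr hf, h.cache_eq]
      exact
        { valid := hv
          cached_sub := h.cached_sub.trans (Finset.subset_insert _ _)
          ref_sub := by
            simp only
            rw [hpages]
            exact Finset.insert_subset_insert _ h.ref_sub
          card_cached := h.card_cached
          lev_le := h.lev_le
          marked_sub := h.marked_sub
          marked_req := by
            simp only [he]
            exact h.marked_req.trans (Finset.subset_insert _ _)
          marked_eq := h.marked_eq
          final := fun hl => ⟨by simp only; rw [hpages, (h.final hl).1], (h.final hl).2⟩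
          cnt_le := fun hl => by
            simp only [hw]
            by_contra hlt
            exact hf ⟨hr, hl, by omega⟩
          sel_some := h.sel_some
          fresh := h.fresh
          num := h.num
          pos_le := h.pos_le
          w_pos := fun hn => hw.symm ▸ h.w_pos hn
          mem_ref := Finset.mem_insert_self _ _
          mem_req := hq
          card_eq := h.card_cached_old hp
          mem_of_w := hmw }

theorem Ready.launch (ha : 0 < a) (h : s.Ready k a L N r) (hs : s.Starts a L N r) {l : ℕ}
    (hl : l < N s.lev) : (s.launch N l).Ready k a L N r :=
  { valid := h.valid
    cached_sub := h.cached_sub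
    ref_sub := h.ref_sub
    card_cached := h.card_cached
    lev_le := h.lev_le
    marked_sub := h.marked_sub
    marked_req := h.marked_req
    marked_eq := h.marked_eq
    final := fun hl => absurd hl hs.2.2.1.ne
    cnt_le := h.cnt_le
    sel_some := fun l' hl' => by
      have h1 : l = l' := Option.some.inj hl'
      subst h1
      exact ⟨hl, Nat.mul_pos (Nat.succ_pos l) ha, rfl⟩
    fresh := fun _ => rfl
    num := Or.inr ⟨s.lev, hs.2.2.1, rfl⟩
    pos_le := Nat.zero_le _
    -- A period starts with a fault, and there are no faults at weight 0.
    w_pos := fun _ => Nat.pos_of_ne_zero fun h0 => hs.2.1 (h.mem_of_w h0)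
    mem_ref := h.mem_ref
    mem_req := h.mem_req
    card_eq := h.card_eq
    mem_of_w := h.mem_of_w }

/-- All marked pages and `r` are among the at most `k` pages of the phase, and `r` is unmarked
because it is not cached. -/
theorem Ready.card_unmarked (h : s.Ready k a L N r) (hr : r ∉ s.cached)
    (hc : s.cached.card = k) :
    (s.cached \ s.marked).card = k - s.marked.card ∧ s.marked.card < k := by
  refine ⟨by rw [Finset.card_sdiff_of_subset h.marked_sub, hc], ?_⟩
  have h1 : insert r s.marked ⊆ s.track.req :=
    Finset.insert_subset h.mem_req h.marked_req
  have h2 := Finset.card_le_card h1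
  rw [Finset.card_insert_of_notMem fun h' => hr (h.marked_sub h')] at h2
  have := h.valid.card_req
  omega

theorem Ready.unmarked_nonempty (h : s.Ready k a L N r) (hr : r ∉ s.cached)
    (hc : s.cached.card = k) : (s.cached \ s.marked).Nonempty := by
  have := h.card_unmarked hr hc
  exact Finset.card_pos.1 (by omega)

/-- The possible contents of the cache after the eviction. -/
theorem Ready.evict_cases (h : s.Ready k a L N r) {X : Finset Page}
    (hX : X ∈ (evict k r s.cached s.marked).support) :
    r ∈ X ∧ X ⊆ s.ref ∧ s.marked ⊆ X ∧ X.card = min k s.track.pages.card ∧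
      (X \ s.cached).card = (if r ∈ s.cached then 0 else 1) := by
  have hle := Finset.card_le_card (h.cached_sub.trans h.ref_sub)
  rcases mem_support_evict_cases h.card_cached (fun h1 h2 => h.unmarked_nonempty h1 h2) hX with
    ⟨hr, rfl⟩ | ⟨hr, hc, rfl⟩ | ⟨hr, hc, p, hp, rfl⟩
  · refine ⟨hr, h.cached_sub, h.marked_sub, ?_, by simp [hr]⟩
    rcases h.card_eq with hc | ⟨hc, he⟩
    · omega
    · rw [he, Finset.insert_eq_of_mem hr]; omega
  · refine ⟨Finset.mem_insert_self _ _, Finset.insert_subset h.mem_ref h.cached_sub,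
      h.marked_sub.trans (Finset.subset_insert _ _), ?_, ?_⟩
    · rcases h.card_eq with hc' | ⟨-, he⟩
      · omega
      · rw [he, Finset.card_insert_of_notMem hr]; omega
    · rw [Finset.insert_sdiff_of_notMem _ hr, if_neg hr]; simp
  · rw [Finset.mem_sdiff] at hp
    have hr' : r ∉ s.cached.erase p := fun h' => hr (Finset.mem_of_mem_erase h')
    refine ⟨Finset.mem_insert_self _ _, Finset.insert_subset h.mem_ref
      ((Finset.erase_subset _ _).trans h.cached_sub), ?_, ?_, ?_⟩
    · intro y hy
      refine Finset.mem_insert_of_mem (Finset.mem_erase.2 ⟨?_, h.marked_sub hy⟩)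
      rintro rfl
      exact hp.2 hy
    · have := Finset.card_pos.2 ⟨p, hp.1⟩
      rw [Finset.card_insert_of_notMem hr', Finset.card_erase_of_mem hp.1]
      omega
    · rw [Finset.insert_sdiff_of_notMem _ hr, if_neg hr,
        Finset.sdiff_eq_empty_iff_subset.2 (Finset.erase_subset _ _)]
      simp

theorem Ready.card_erase (h : s.Ready k a L N r) :
    (s.ref.erase r).card + 1 = s.ref.card := Finset.card_erase_add_one h.mem_ref

/-- The new reference set is as large as possible. -/
theorem Ready.card_sync (hk : 0 < k) (h : s.Ready k a L N r) {R : Finset Page}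
    (hR : R.card ≤ (s.ref.erase r).card + 1 - k) :
    (insert r (trim (k - 1) (s.ref.erase r \ R))).card = min k s.track.pages.card := by
  have h1 : r ∉ trim (k - 1) (s.ref.erase r \ R) := fun h' =>
    Finset.notMem_erase r s.ref (Finset.mem_sdiff.1 (trim_subset _ _ h')).1
  rw [Finset.card_insert_of_notMem h1, card_trim]
  have h2 := h.card_erase
  have h3 := Finset.card_le_card h.cached_sub
  have h4 := Finset.card_le_card h.ref_sub
  have h5 := Finset.le_card_sdiff R (s.ref.erase r)
  have h6 := Finset.card_le_card (Finset.sdiff_subset (s := s.ref.erase r) (t := R))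
  have h7 : s.ref.card = s.track.pages.card ∨ k ≤ s.ref.card := by
    rcases h.card_eq with hc | ⟨hc, he⟩
    · right; omega
    · left
      apply le_antisymm h4
      rw [he]
      exact Finset.card_le_card (Finset.insert_subset h.mem_ref h.cached_sub)
  omega

theorem sync_subset (k : ℕ) {s : Conf Page} {r : Page} (h : r ∈ s.ref) (R : Finset Page) :
    insert r (trim (k - 1) (s.ref.erase r \ R)) ⊆ s.ref :=
  Finset.insert_subset h
    ((trim_subset _ _).trans (Finset.sdiff_subset.trans (Finset.erase_subset _ _)))

theorem Ready.sync (hk : 0 < k) (h : s.Ready k a L N r) {R : Finset Page}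
    (hR : R.card ≤ (s.ref.erase r).card + 1 - k) (hd : s.Due a) :
    (s.sync k r R).Good k a L N := by
  have hlev := h.sel_lev hd.2
  have hc := h.card_sync hk hR
  exact
    { valid := h.valid
      cached_sub := le_rfl
      ref_sub := (sync_subset k h.mem_ref R).trans h.ref_sub
      card_cached := hc.le.trans (min_le_left _ _)
      lev_le := h.lev_le
      marked_sub := by
        change s.marked ⊆ _
        rw [h.marked_eq hlev]; exact Finset.empty_subset _
      marked_req := h.marked_req
      marked_eq := h.marked_eq
      final := fun hl => absurd hl hlev.ne
      cnt_le := h.cnt_le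
      sel_some := fun l hl => by simp [Conf.sync] at hl
      fresh := h.fresh
      num := h.num
      pos_le := hd.1.1
      w_pos := h.w_pos
      card_eq := hc }

/-- Query number `l` of a period is made at position `(l + 1) * a - 1`, and the selected one is
`Due` there. Hence the selected position is never overrun. -/
theorem Core.pos_succ_lt (ha : 0 < a) (h : s.Core k a L N) (hd : ¬ s.Due a) {l : ℕ}
    (hl : s.sel = some l) : s.pos < s.num * a ∧ s.pos + 1 < (l + 1) * a := by
  obtain ⟨h1, h2, -⟩ := h.sel_some l hl
  have h3 : (l + 1) * a ≤ s.num * a := Nat.mul_le_mul_right a h1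
  refine ⟨by omega, ?_⟩
  by_contra h4
  have h5 : s.pos + 1 = (l + 1) * a := by omega
  refine hd ⟨⟨by omega, ⟨l + 1, by rw [h5, mul_comm]⟩⟩, ?_⟩
  rw [hl, h5, Nat.mul_div_cancel _ ha, Nat.add_sub_cancel]

theorem Ready.serve (ha : 0 < a) (h : s.Ready k a L N r) (hd : ¬ s.Due a) {X : Finset Page}
    (hX : X ∈ (evict k r s.cached s.marked).support) : (s.serve a L r X).Good k a L N := by
  obtain ⟨h1, h2, h3, h4, -⟩ := h.evict_cases hX
  exact
    { valid := h.valid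
      cached_sub := h2
      ref_sub := h.ref_sub
      card_cached := h4.le.trans (min_le_left _ _)
      lev_le := h.lev_le
      marked_sub := by
        change (if s.lev < L then s.marked else insert r s.marked) ⊆ X
        split_ifs
        · exact h3
        · exact Finset.insert_subset h1 h3
      marked_req := by
        change (if s.lev < L then s.marked else insert r s.marked) ⊆ s.track.req
        split_ifs
        · exact h.marked_req
        · exact Finset.insert_subset h.mem_req h.marked_req
      marked_eq := fun hl => by
        change (if s.lev < L then s.marked else insert r s.marked) = ∅
        rw [if_pos (show s.lev < L from hl)]
        exact h.marked_eq hl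
      final := h.final
      cnt_le := h.cnt_le
      sel_some := fun l hl => by
        have h5 := h.pos_succ_lt ha hd hl
        have h6 := h.sel_some l hl
        refine ⟨h6.1, ?_, h6.2.2⟩
        change (if s.pos < s.num * a then s.pos + 1 else s.pos) < _
        split_ifs <;> omega
      fresh := h.fresh
      num := h.num
      pos_le := by
        have := h.pos_le
        change (if s.pos < s.num * a then s.pos + 1 else s.pos) ≤ s.num * a
        split_ifs <;> omega
      w_pos := h.w_pos
      card_eq := h4 }

theorem Ready.finish (hk : 0 < k) (ha : 0 < a) (h : s.Ready k a L N r) {R : Finset Page}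
    (hR : s.Due a → R.card ≤ (s.ref.erase r).card + 1 - k) {s' : Conf Page}
    (hs' : s' ∈ (s.finish k a L r R).support) : s'.Good k a L N := by
  rcases mem_support_finish hs' with ⟨hd, rfl⟩ | ⟨hd, X, hX, rfl⟩
  · exact h.sync hk (hR hd) hd
  · exact h.serve ha hd hX

end Conf

end Caching

namespace Caching

/-! ### Induction over the runs of the algorithm; times and subjects of the queries -/

namespace Conf

variable {Page : Type u} [DecidableEq Page] {k a L : ℕ} {N : ℕ → ℕ} {p q : Conf Page} {r : Page}

/-- `q` is the configuration `p`, with a new period if there has to be one. -/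
def Launched {Page : Type u} (a L : ℕ) (N : ℕ → ℕ) (p : Conf Page) (r : Page) (q : Conf Page) :
    Prop :=
  (p.Starts a L N r ∧ ∃ l < N p.lev, q = p.launch N l) ∨ (¬ p.Starts a L N r ∧ q = p)

theorem Launched.ready (ha : 0 < a) (h : p.Launched a L N r q) (hp : p.Ready k a L N r) :
    q.Ready k a L N r := by
  rcases h with ⟨hs, l, hl, rfl⟩ | ⟨-, rfl⟩
  · exact hp.launch ha hs hl
  · exact hp

theorem Launched.same {Page : Type u} {p q : Conf Page} {r : Page}
    (h : p.Launched a L N r q) :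
    q.ref = p.ref ∧ q.cached = p.cached ∧ q.track = p.track ∧ q.lev = p.lev ∧ q.cnt = p.cnt := by
  rcases h with ⟨-, l, -, rfl⟩ | ⟨-, rfl⟩ <;> exact ⟨rfl, rfl, rfl, rfl, rfl⟩

theorem Launched.asks_iff {s : Conf Page} (h : (s.prep k L r).Launched a L N r q) :
    q.Asks a ↔ (s.lead k a L N r).Asks a := by
  unfold lead
  rcases h with ⟨hs, l, -, rfl⟩ | ⟨hs, rfl⟩
  · rw [if_pos hs]; rfl
  · rw [if_neg hs]

theorem exists_launched {s s' : Conf Page} {R : Finset Page}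
    (h : s' ∈ (s.move k a L N r R).support) :
    ∃ q, (s.prep k L r).Launched a L N r q ∧ s' ∈ (q.finish k a L r R).support := by
  rcases mem_support_move h with ⟨hs, l, hl, h⟩ | ⟨hs, h⟩
  · exact ⟨_, Or.inl ⟨hs, l, hl, rfl⟩, h⟩
  · exact ⟨_, Or.inr ⟨hs, rfl⟩, h⟩

/-- The query in reaction to request `r`, made in configuration `q`. -/
def query (k : ℕ) (q : Conf Page) (r : Page) (t : ℕ) : Query Page :=
  ⟨t, q.ref.erase r, (q.ref.erase r).card + 1 - k⟩

/-- The answer of the predictor to the query in configuration `q`, if there is any. -/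
def reply (P : Predictor Page k) (a : ℕ) (q : Conf Page) (r : Page) (t : ℕ) : Finset Page :=
  if q.Asks a then P.report t (q.ref.erase r) ((q.ref.erase r).card + 1 - k) else ∅

theorem card_reply_le (P : Predictor Page k) (a : ℕ) (q : Conf Page) (r : Page) (t : ℕ) :
    (q.reply P a r t).card ≤ (q.ref.erase r).card + 1 - k := by
  unfold reply
  split_ifs
  · rw [P.card_report]; exact min_le_left _ _
  · simp

end Conf

section algorithm

variable {Page : Type u} [DecidableEq Page] {k a L : ℕ} {N : ℕ → ℕ} (hk : 0 < k)
  {init : Finset Page} (hinit : init.card ≤ k)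

theorem finitelyBranching_levelAlgorithm :
    (levelAlgorithm k a L N hk init hinit).FinitelyBranching :=
  fun s r R => Conf.finite_support_move s r R

theorem answer_eq (P : Predictor Page k) (req : ℕ → Page) (t : ℕ) {s q : Conf Page}
    (h : (s.prep k L (req t)).Launched a L N (req t) q) :
    (levelAlgorithm k a L N hk init hinit).answer P req t s = q.reply P a (req t) t := by
  have h1 : (levelAlgorithm k a L N hk init hinit).ask s (req t) = s.ask k a L N (req t) := rfl
  unfold OnlineAlgorithm.answer
  rw [h1, Conf.ask, Conf.reply, h.same.1]
  by_cases h2 : q.Asks a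
  · rw [if_pos h2, if_pos (h.asks_iff.1 h2)]
  · rw [if_neg h2, if_neg (fun h3 => h2 (h.asks_iff.2 h3))]

theorem newQueries_eq (req : ℕ → Page) (t : ℕ) {s q : Conf Page}
    (h : (s.prep k L (req t)).Launched a L N (req t) q) (c : ℕ) (Q : List (Query Page)) :
    (levelAlgorithm k a L N hk init hinit).newQueries req t ⟨s, c, Q⟩
      = if q.Asks a then q.query k (req t) t :: Q else Q := by
  have h1 : (levelAlgorithm k a L N hk init hinit).ask s (req t) = s.ask k a L N (req t) := rfl
  unfold OnlineAlgorithm.newQueries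
  rw [h1, Conf.ask, Conf.query, h.same.1]
  by_cases h2 : q.Asks a
  · rw [if_pos h2, if_pos (h.asks_iff.1 h2)]
  · rw [if_neg h2, if_neg (fun h3 => h2 (h.asks_iff.2 h3))]

/-- Induction over the steps of a run of the algorithm. -/
theorem levelAlgorithm_induction (ha : 0 < a) (P : Predictor Page k) (req : ℕ → Page)
    (J : ℕ → Conf Page → List (Query Page) → Prop)
    (h0 : J 0 (levelAlgorithm k a L N hk init hinit).start [])
    (hstep : ∀ t (s q s' : Conf Page) (Q : List (Query Page)), s.Good k a L N →
      s.track = Track.at_ k init req t → J t s Q → (s.prep k L (req t)).Ready k a L N (req t) →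
      (s.prep k L (req t)).Launched a L N (req t) q → q.Ready k a L N (req t) →
      s' ∈ (q.finish k a L (req t) (q.reply P a (req t) t)).support →
      J (t + 1) s' (if q.Asks a then q.query k (req t) t :: Q else Q)) :
    ∀ T, ∀ o ∈ ((levelAlgorithm k a L N hk init hinit).run P req T).support,
      Conf.Good k a L N o.state ∧ Conf.track o.state = Track.at_ k init req T ∧
        J T o.state o.queries := by
  refine OnlineAlgorithm.run_induction (A := levelAlgorithm k a L N hk init hinit) P req
    (fun t o => Conf.Good k a L N o.state ∧ Conf.track o.state = Track.at_ k init req t ∧ J t o.state o.queries) ⟨?_, rfl, h0⟩ ?_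
  · exact
      { valid := (Track.meaning req hk hinit 0).valid
        cached_sub := le_rfl
        ref_sub := Finset.subset_union_left
        card_cached := hinit
        lev_le := Nat.zero_le _
        marked_sub := Finset.empty_subset _
        marked_req := Finset.empty_subset _
        marked_eq := fun _ => rfl
        final := fun _ => ⟨by simp [levelAlgorithm, Track.pages], rfl⟩
        cnt_le := fun _ => Nat.zero_le _
        sel_some := fun l hl => by simp [levelAlgorithm] at hl
        fresh := fun hf => by simp [levelAlgorithm] at hf
        num := Or.inl rfl
        pos_le := Nat.zero_le _
        w_pos := fun hn => absurd rfl hn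
        card_eq := by
          simp only [levelAlgorithm, Track.pages, Finset.union_empty]
          omega }
  · rintro t ⟨s, c, Q⟩ ⟨hG, hT, hJ⟩ s' hs'
    change Conf Page at s s'
    change s.Good k a L N at hG
    change s.track = _ at hT
    have hs'' : s' ∈ (s.move k a L N (req t)
      ((levelAlgorithm k a L N hk init hinit).answer P req t s)).support := hs'
    obtain ⟨q, hq, hf⟩ := Conf.exists_launched hs''
    rw [answer_eq hk hinit P req t hq] at hf
    have hp := hG.prep hk (req t)
    have hR := hq.ready ha hp
    refine ⟨hR.finish hk ha (fun _ => Conf.card_reply_le _ _ _ _ _) hf, ?_, ?_⟩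
    · have h1 : s'.track = q.track := by
        rcases Conf.mem_support_finish hf with ⟨-, rfl⟩ | ⟨-, X, -, rfl⟩ <;> rfl
      change s'.track = _
      rw [h1, hq.same.2.2.1, Conf.track_prep, hT]
      rfl
    · rw [newQueries_eq hk hinit req t hq]
      exact hstep t s q s' Q hG hT hJ hp hq hR hf

theorem good_of_mem_run (ha : 0 < a) (P : Predictor Page k) (req : ℕ → Page) (T : ℕ)
    (o : (levelAlgorithm k a L N hk init hinit).Outcome)
    (ho : o ∈ ((levelAlgorithm k a L N hk init hinit).run P req T).support) :
    Conf.Good k a L N o.state ∧ Conf.track o.state = Track.at_ k init req T := by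
  obtain ⟨h1, h2, -⟩ := levelAlgorithm_induction hk hinit ha P req (fun _ _ _ => True) trivial
    (fun _ _ _ _ _ _ _ _ _ _ _ _ => trivial) T o ho
  exact ⟨h1, h2⟩

/-- Queries are made in the last step of each block of `a` steps of a period, so even a period that
starts right after another one waits long enough. The invariant is that more than `pos % a` time
units have passed since every earlier query. -/
theorem wellSeparated_levelAlgorithm (ha : 0 < a) :
    (levelAlgorithm k a L N hk init hinit).WellSeparated a := by
  intro P req T o ho
  refine (levelAlgorithm_induction hk hinit ha P req (fun t s Q =>
    Q.Pairwise (fun later earlier => earlier.time + a ≤ later.time) ∧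
      ∀ x ∈ Q, x.time + s.pos % a < t) ⟨List.Pairwise.nil, by simp⟩ ?_ T o ho).2.2.1
  rintro t s q s' Q hG hT ⟨hJ1, hJ2⟩ hp hq hR hf
  have h1 : ∀ x ∈ Q, x.time + q.pos % a < t := by
    rcases hq with ⟨-, l, -, rfl⟩ | ⟨-, rfl⟩
    · intro x hx
      have h2 := hJ2 x hx
      have h3 : (Conf.launch N (s.prep k L (req t)) l).pos % a = 0 := Nat.zero_mod a
      omega
    · intro x hx
      rw [(Conf.num_prep k L s (req t)).2]
      exact hJ2 x hx
  have h2 : s'.pos = if q.pos < q.num * a then q.pos + 1 else q.pos := by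
    rcases Conf.mem_support_finish hf with ⟨hd, rfl⟩ | ⟨-, X, -, rfl⟩
    · rw [if_pos hd.1.1]; rfl
    · rfl
  by_cases hA : q.Asks a
  · rw [if_pos hA]
    have h3 : s'.pos % a = 0 := by
      rw [h2, if_pos hA.1]; exact Nat.mod_eq_zero_of_dvd hA.2
    have h4 : q.pos % a + 1 = a := by
      obtain ⟨c, hc⟩ := hA.2
      have h5 := Nat.mod_lt q.pos ha
      have h6 : (q.pos % a + 1) % a = 0 := by
        rw [Nat.mod_add_mod, hc]; exact Nat.mul_mod_right a c
      by_contra h7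
      rw [Nat.mod_eq_of_lt (by omega)] at h6
      omega
    refine ⟨List.pairwise_cons.2 ⟨fun x hx => ?_, hJ1⟩, fun x hx => ?_⟩
    · have := h1 x hx
      change x.time + a ≤ t
      omega
    · rw [h3]
      rcases List.mem_cons.1 hx with rfl | hx
      · exact Nat.lt_succ_self t
      · have := h1 x hx
        omega
  · rw [if_neg hA]
    refine ⟨hJ1, fun x hx => ?_⟩
    have h3 := h1 x hx
    rw [h2]
    split_ifs with h4
    · have h5 : (q.pos + 1) % a ≤ q.pos % a + 1 := by
        rw [← Nat.mod_add_mod]; exact Nat.mod_le _ _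
      omega
    · omega

theorem pages_subset (hk : 0 < k) (hinit : init.card ≤ k) (req : ℕ → Page) (t : ℕ) :
    (Track.at_ k init req t).pages ⊆ init ∪ (Finset.range t).image req := by
  have hm := Track.meaning req hk hinit t
  refine Finset.union_subset ?_ ?_
  · rcases hm.base_eq with ⟨-, -, h⟩ | ⟨h, -⟩
    · rw [h]; exact Finset.subset_union_left
    · rw [h]
      refine (Finset.image_subset_image fun x hx => ?_).trans Finset.subset_union_right
      have := hm.phase_le
      simp only [Finset.mem_Ico, Finset.mem_range] at hx ⊢
      omega
  · rw [hm.req_eq]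
    refine (Finset.image_subset_image fun x hx => ?_).trans Finset.subset_union_right
    simp only [Finset.mem_Ico, Finset.mem_range] at hx ⊢
    omega

theorem asksAboutKnownPages_levelAlgorithm (ha : 0 < a) :
    (levelAlgorithm k a L N hk init hinit).AsksAboutKnownPages := by
  intro P req T o ho
  refine (levelAlgorithm_induction hk hinit ha P req (fun t s Q =>
    ∀ q ∈ Q, q.pages ⊆ init ∪ (Finset.range q.time).image req) (by simp) ?_ T o ho).2.2
  rintro t s q s' Q hG hT hJ hp hq hR hf
  split_ifs
  · intro x hx
    rcases List.mem_cons.1 hx with rfl | hx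
    · change q.ref.erase (req t) ⊆ init ∪ (Finset.range t).image req
      intro y hy
      have h1 := hR.ref_sub (Finset.mem_of_mem_erase hy)
      have h2 : q.track = Track.at_ k init req (t + 1) := by
        rw [hq.same.2.2.1, Conf.track_prep, hT]; rfl
      rw [h2] at h1
      have h3 := pages_subset hk hinit req (t + 1) h1
      rw [Finset.range_add_one, Finset.image_insert] at h3
      -- The current page may be requested for the first time; it is known only because queries
      -- leave it out.
      have h4 := Finset.ne_of_mem_erase hy
      simp only [Finset.mem_union, Finset.mem_insert] at h3 ⊢
      tauto
    · exact hJ x hx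
  · exact hJ

end algorithm

end Caching

namespace Caching

/-! ### The number of predictions -/

namespace Conf

variable {Page : Type u} [DecidableEq Page] {k a L : ℕ} {N : ℕ → ℕ} {s q : Conf Page} {r : Page}

/-- The number of pages of the reference set that are not in the cache. -/
def missing (s : Conf Page) : ℕ := (s.ref \ s.cached).card

/-- The number of queries that remain in the current period. -/
def remaining {Page : Type u} (a : ℕ) (s : Conf Page) : ℕ := s.num - s.pos / a

/-- A budget for the predictions that will be used in the current epoch. -/
def budget (a L : ℕ) (N : ℕ → ℕ) (s : Conf Page) : ℕ :=
  s.remaining a * (if s.fresh then s.missing + 1 else 4 * s.track.w) +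
    if s.lev < L then
      (if s.sel.isSome then 0 else 2 * N s.lev * s.missing) +
        3 * N s.lev * (7 * s.track.w - s.cnt) + 4 * s.track.w * N s.lev +
        40 * s.track.w * ∑ j ∈ Finset.Ico (s.lev + 1) L, N j
    else 0

theorem Core.num_le (h : s.Core k a L N) : s.num ≤ ∑ j ∈ Finset.range L, N j := by
  rcases h.num with h | ⟨i, hi, h⟩
  · omega
  · rw [h]
    exact Finset.single_le_sum (f := N) (fun _ _ => Nat.zero_le _) (Finset.mem_range.2 hi)

theorem sum_Ico_split (N : ℕ → ℕ) {i L : ℕ} (h : i < L) :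
    ∑ j ∈ Finset.Ico i L, N j = N i + ∑ j ∈ Finset.Ico (i + 1) L, N j :=
  Finset.sum_eq_sum_Ico_succ_bot h N

theorem missing_insert_le (X D : Finset Page) (r : Page) :
    (insert r D \ X).card ≤ (D \ X).card + if r ∈ D then 0 else 1 := by
  split_ifs with h
  · rw [Finset.insert_eq_of_mem h]; omega
  · refine (Finset.card_le_card ?_).trans (Finset.card_insert_le r (D \ X))
    intro y hy
    simp only [Finset.mem_sdiff, Finset.mem_insert] at hy ⊢
    tauto

/-- At most `2 * w` pages are missing, so the terms of the new level are at most `(4 + 21 + 4) * w *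
N`, below `40 * w * N`. -/
theorem budget_new_level (h : s.Ready k a L N r) (hlev : s.lev < L) (hcnt : s.cnt = 0)
    (hsel : s.sel = none) (hf : s.fresh = false) :
    s.budget a L N ≤ s.remaining a * (4 * s.track.w) +
      40 * s.track.w * ∑ j ∈ Finset.Ico s.lev L, N j := by
  have h1 : s.missing ≤ 2 * s.track.w := h.card_sdiff_le
  rw [budget, if_pos hlev, hcnt, hsel, hf, sum_Ico_split N hlev]
  simp only [Bool.false_eq_true, if_false, Option.isSome_none, Nat.sub_zero]
  have h2 : 2 * N s.lev * s.missing ≤ 2 * N s.lev * (2 * s.track.w) :=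
    Nat.mul_le_mul_left _ h1
  have h3 : s.track.w * N s.lev = N s.lev * s.track.w := mul_comm _ _
  nlinarith [h2, h3, Nat.zero_le (N s.lev * s.track.w)]

/-- A request outside of `ref` adds one missing page, which may cost `N` in the running period and
`2 * N` in the next one: the `3 * N` reserved for it. At a failure the remaining queries of a fresh
period are revalued at `4 * w` each, out of `4 * w * N`. At a reset, `40` pays for the levels and
`4` for the leftover period. -/
theorem budget_prep (hk : 0 < k) (h : s.Good k a L N) (r : Page) :
    (s.prep k L r).budget a L N ≤ s.budget a L N +
      if s.track.Reset k r then
        44 * (∑ j ∈ Finset.range L, N j) * (s.track.next k r).w else 0 := by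
  have hR := h.prep hk r
  have hn := num_prep k L s r
  have ht := track_prep k L s r
  have hrem : (s.prep k L r).remaining a = s.remaining a := by
    rw [remaining, remaining, hn.1, hn.2]
  by_cases hr : s.track.Reset k r
  · rw [if_pos hr]
    have hlev : (s.prep k L r).lev = 0 := by rw [prep_reset L hr]
    have hcnt : (s.prep k L r).cnt = 0 := by rw [prep_reset L hr]
    have hsel : (s.prep k L r).sel = none := by rw [prep_reset L hr]
    have hf : (s.prep k L r).fresh = false := by rw [prep_reset L hr]
    have h1 : (s.prep k L r).remaining a ≤ ∑ j ∈ Finset.range L, N j :=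
      (Nat.sub_le _ _).trans hR.num_le
    rw [← ht]
    rcases Nat.eq_zero_or_pos L with hL | hL
    · rw [budget, hlev, hf, if_neg (show ¬ 0 < L by omega)]
      simp only [Bool.false_eq_true, if_false]
      nlinarith [Nat.mul_le_mul_right (s.prep k L r).track.w h1]
    · have h2 := budget_new_level hR (by omega) hcnt hsel hf
      rw [hlev, ← Finset.range_eq_Ico] at h2
      nlinarith [Nat.mul_le_mul_right (s.prep k L r).track.w h1]
  · rw [if_neg hr, Nat.add_zero]
    have hw : (s.prep k L r).track.w = s.track.w := by
      rw [ht, (Track.next_of_not_reset hr).2.1]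
    by_cases hfail : s.Fails k L r
    · have hlev : (s.prep k L r).lev = s.lev + 1 := by rw [prep_fails hfail]
      have hcnt : (s.prep k L r).cnt = 0 := by rw [prep_fails hfail]
      have hsel : (s.prep k L r).sel = none := by rw [prep_fails hfail]
      have hf : (s.prep k L r).fresh = false := by rw [prep_fails hfail]
      have h3 : s.remaining a * (4 * s.track.w) ≤
          s.remaining a * (if s.fresh then s.missing + 1 else 4 * s.track.w) +
            4 * s.track.w * N s.lev := by
        split_ifs with h4
        · have h5 : s.remaining a ≤ N s.lev := by
            rw [← h.fresh h4]; exact Nat.sub_le _ _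
          nlinarith [Nat.mul_le_mul_right s.track.w h5]
        · omega
      have h4 : (s.prep k L r).budget a L N ≤ s.remaining a * (4 * s.track.w) +
          40 * s.track.w * ∑ j ∈ Finset.Ico (s.lev + 1) L, N j := by
        by_cases hl : s.lev + 1 < L
        · have h2 := budget_new_level hR (by omega) hcnt hsel hf
          rw [hlev, hw, hrem] at h2
          exact h2
        · rw [budget, hlev, hf, if_neg hl, hw, hrem]
          simp only [Bool.false_eq_true, if_false]
          omega
      conv_rhs => rw [budget, if_pos hfail.2.1]
      omega
    · have he := prep_regular hr hfail
      have hlev : (s.prep k L r).lev = s.lev := by rw [he]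
      have hcnt : (s.prep k L r).cnt = s.cnt + if r ∈ s.ref then 0 else 1 := by rw [he]
      have hsel : (s.prep k L r).sel = s.sel := by rw [he]
      have hf : (s.prep k L r).fresh = s.fresh := by rw [he]
      have hmiss : (s.prep k L r).missing ≤ s.missing + if r ∈ s.ref then 0 else 1 := by
        rw [missing, he, h.cache_eq]
        exact missing_insert_le _ _ _
      rw [budget, budget, hlev, hcnt, hsel, hf, hw, hrem]
      by_cases hl : s.lev < L
      · rw [if_pos hl, if_pos hl]
        have hle := hR.cnt_le (hlev.symm ▸ hl)
        rw [hcnt, hw] at hle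
        by_cases hm : r ∈ s.ref
        · rw [if_pos hm] at hmiss hle ⊢
          simp only [Nat.add_zero] at hmiss ⊢
          gcongr
          · split_ifs <;> omega
          · split_ifs
            · exact le_rfl
            · gcongr
        · rw [if_neg hm] at hmiss hle ⊢
          have h1 : s.remaining a * (if s.fresh then (s.prep k L r).missing + 1 else 4 * s.track.w)
              ≤ s.remaining a * (if s.fresh then s.missing + 1 else 4 * s.track.w)
                + N s.lev := by
            split_ifs with h4
            · have h5 : s.remaining a ≤ N s.lev := by
                rw [← h.fresh h4]; exact Nat.sub_le _ _
              nlinarith [Nat.mul_le_mul_left (s.remaining a) hmiss]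
            · omega
          have h2 : (if s.sel.isSome then 0 else 2 * N s.lev * (s.prep k L r).missing)
              ≤ (if s.sel.isSome then 0 else 2 * N s.lev * s.missing) + 2 * N s.lev := by
            split_ifs
            · omega
            · nlinarith [Nat.mul_le_mul_left (2 * N s.lev) hmiss]
          have h3 : 3 * N s.lev * (7 * s.track.w - s.cnt)
              = 3 * N s.lev * (7 * s.track.w - (s.cnt + 1)) + 3 * N s.lev := by
            obtain ⟨v, hv⟩ : ∃ v, 7 * s.track.w - s.cnt = v + 1 :=
              ⟨7 * s.track.w - s.cnt - 1, by omega⟩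
            have hv' : 7 * s.track.w - (s.cnt + 1) = v := by omega
            rw [hv, hv']
            ring
          omega
      · rw [if_neg hl, if_neg hl]
        have hL : s.lev = L := le_antisymm h.lev_le (by omega)
        rw [(h.final hL).2]
        simp

/-- A period starts at a fault, so some page is missing and `N * (missing + 1) ≤ 2 * N * missing`,
the reserve held while no query is selected. -/
theorem budget_launched (h : s.Ready k a L N r) (hq : s.Launched a L N r q) :
    q.budget a L N ≤ s.budget a L N := by
  rcases hq with ⟨hs, l, hl, rfl⟩ | ⟨-, rfl⟩
  · have h1 : 1 ≤ s.missing :=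
      Finset.card_pos.2 ⟨r, Finset.mem_sdiff.2 ⟨h.mem_ref, hs.2.1⟩⟩
    have h2 : s.sel = none := by
      by_contra h3
      obtain ⟨l', hl'⟩ := Option.ne_none_iff_exists'.1 h3
      have h4 := h.sel_some l' hl'
      have h5 : (l' + 1) * a ≤ s.num * a := Nat.mul_le_mul_right a h4.1
      have h6 := hs.1
      omega
    have h3 : (s.launch N l).budget a L N = N s.lev * (s.missing + 1) +
        (0 + 3 * N s.lev * (7 * s.track.w - s.cnt) + 4 * s.track.w * N s.lev +
        40 * s.track.w * ∑ j ∈ Finset.Ico (s.lev + 1) L, N j) := by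
      simp [budget, launch, remaining, missing, hs.2.2.1]
    rw [h3, budget, if_pos hs.2.2.1, h2]
    simp only [Option.isSome_none, Bool.false_eq_true, if_false]
    have h4 : N s.lev * (s.missing + 1) ≤ 2 * N s.lev * s.missing := by
      nlinarith [Nat.mul_le_mul_left (N s.lev) h1]
    omega
  · exact le_rfl

theorem Ready.number_le (h : q.Ready k a L N r) :
    (q.ref.erase r).card + 1 - k ≤ q.missing := by
  rw [h.card_erase, missing, Finset.card_sdiff_of_subset h.cached_sub]
  have := h.card_cached
  omega

theorem missing_finish_le (h : q.Ready k a L N r) {R : Finset Page} {s' : Conf Page}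
    (hs' : s' ∈ (q.finish k a L r R).support) : s'.missing ≤ q.missing := by
  rcases mem_support_finish hs' with ⟨hd, rfl⟩ | ⟨hd, X, hX, rfl⟩
  · simp [missing, sync]
  · obtain ⟨-, h2, -, h4, -⟩ := h.evict_cases hX
    change (q.ref \ X).card ≤ (q.ref \ q.cached).card
    rw [Finset.card_sdiff_of_subset h2, Finset.card_sdiff_of_subset h.cached_sub, h4]
    have := h.card_cached
    have := Finset.card_le_card (h.cached_sub.trans h.ref_sub)
    omega

/-- A query consumes one remaining query. It asks for at most `missing` indices, plus 1 for the
query itself; in a leftover period `missing ≤ 2 * w` and `w ≥ 1` keep this below `4 * w`. -/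
theorem budget_finish (ha : 0 < a) (h : q.Ready k a L N r) {R : Finset Page} {s' : Conf Page}
    (hs' : s' ∈ (q.finish k a L r R).support) :
    (if q.Asks a then (q.ref.erase r).card + 1 - k + 1 else 0) + s'.budget a L N
      ≤ q.budget a L N := by
  have hm := missing_finish_le h hs'
  have hsame : s'.track = q.track ∧ s'.lev = q.lev ∧ s'.cnt = q.cnt ∧ s'.num = q.num ∧
      s'.fresh = q.fresh := by
    rcases mem_support_finish hs' with ⟨hd, rfl⟩ | ⟨hd, X, hX, rfl⟩ <;>
      exact ⟨rfl, rfl, rfl, rfl, rfl⟩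
  obtain ⟨h1, h2, h3, h4, h5⟩ := hsame
  have hpos : s'.pos = if q.pos < q.num * a then q.pos + 1 else q.pos := by
    rcases mem_support_finish hs' with ⟨hd, rfl⟩ | ⟨-, X, -, rfl⟩
    · rw [if_pos hd.1.1]; rfl
    · rfl
  have hsel : (if s'.sel.isSome then 0 else 2 * N q.lev * s'.missing)
      ≤ (if q.sel.isSome then 0 else 2 * N q.lev * q.missing) := by
    rcases mem_support_finish hs' with ⟨hd, rfl⟩ | ⟨hd, X, hX, rfl⟩
    · simp [missing, sync]
    · change (if q.sel.isSome then 0 else _) ≤ _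
      split_ifs
      · exact le_rfl
      · exact Nat.mul_le_mul_left _ hm
  have hrest : (if q.Asks a then (q.ref.erase r).card + 1 - k + 1 else 0) +
      s'.remaining a * (if q.fresh then s'.missing + 1 else 4 * q.track.w)
      ≤ q.remaining a * (if q.fresh then q.missing + 1 else 4 * q.track.w) := by
    have hfac : (if q.fresh then s'.missing + 1 else 4 * q.track.w)
        ≤ (if q.fresh then q.missing + 1 else 4 * q.track.w) := by
      split_ifs <;> omega
    by_cases hA : q.Asks a
    · have h6 : q.remaining a = s'.remaining a + 1 := by
        rw [remaining, remaining, hpos, if_pos hA.1, h4, Nat.succ_div_of_dvd hA.2]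
        have : q.pos / a < q.num := (Nat.div_lt_iff_lt_mul ha).2 hA.1
        omega
      have h7 : (q.ref.erase r).card + 1 - k + 1
          ≤ (if q.fresh then q.missing + 1 else 4 * q.track.w) := by
        have h8 := h.number_le
        split_ifs
        · omega
        · have h9 : q.missing ≤ 2 * q.track.w := h.card_sdiff_le
          have h10 : 0 < q.track.w := h.w_pos (by
            rintro h0
            have := hA.1
            rw [h0] at this
            omega)
          omega
      rw [if_pos hA, h6, Nat.add_mul, Nat.one_mul, Nat.add_comm]
      exact Nat.add_le_add (Nat.mul_le_mul_left _ hfac) h7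
    · rw [if_neg hA, Nat.zero_add]
      refine Nat.mul_le_mul ?_ hfac
      rw [remaining, remaining, h4]
      refine Nat.sub_le_sub_left (Nat.div_le_div_right ?_) _
      rw [hpos]
      split_ifs <;> omega
  rw [budget, budget, h1, h2, h3, h5]
  split_ifs at hrest hsel ⊢ <;> omega

end Conf

section algorithm

variable {Page : Type u} [DecidableEq Page] {k a L : ℕ} {N : ℕ → ℕ} (hk : 0 < k)
  {init : Finset Page} (hinit : init.card ≤ k)

theorem queries_le (ha : 0 < a) (P : Predictor Page k) (req : ℕ → Page) (T : ℕ)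
    (o : (levelAlgorithm k a L N hk init hinit).Outcome)
    (ho : o ∈ ((levelAlgorithm k a L N hk init hinit).run P req T).support) :
    (o.queries.map fun q => q.number + 1).sum
      ≤ 44 * (∑ j ∈ Finset.range L, N j) * Track.totalWeight k init req T := by
  have key := (levelAlgorithm_induction hk hinit ha P req (fun t s Q =>
    (Q.map fun q => q.number + 1).sum + s.budget a L N
      ≤ 44 * (∑ j ∈ Finset.range L, N j) * Track.totalWeight k init req t) ?_ ?_ T o ho).2.2
  · exact (Nat.le_add_right _ _).trans key
  · simp [levelAlgorithm, Conf.budget, Conf.remaining, Conf.missing]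
  · intro t s q s' Q hG hT hJ hp hq hR hf
    have h1 := Conf.budget_prep hk hG (req t)
    have h2 := Conf.budget_launched hp hq
    have h3 := Conf.budget_finish ha hR hf
    have h4 : ((if q.Asks a then q.query k (req t) t :: Q else Q).map
        fun q => q.number + 1).sum
        = (if q.Asks a then (q.ref.erase (req t)).card + 1 - k + 1 else 0)
          + (Q.map fun q => q.number + 1).sum := by
      split_ifs
      · simp [Conf.query]
      · simp
    have h5 : Track.totalWeight k init req (t + 1) = Track.totalWeight k init req t +
        if s.track.Reset k (req t) then (s.track.next k (req t)).w else 0 := by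
      rw [hT]; rfl
    rw [h4, h5, Nat.mul_add]
    have h6 : 44 * (∑ j ∈ Finset.range L, N j) *
        (if s.track.Reset k (req t) then (s.track.next k (req t)).w else 0)
        = if s.track.Reset k (req t) then
          44 * (∑ j ∈ Finset.range L, N j) * (s.track.next k (req t)).w else 0 := by
      split_ifs <;> simp
    omega

end algorithm

end Caching

namespace Caching

/-! ### The expected cost -/

section drift

variable {Page : Type u} [DecidableEq Page]

/-- Expected change of the weight of the missing pages when a page is loaded. -/
theorem ev_evict_le {k : ℕ} {r : Page} {X M D : Finset Page} (hX : X.card ≤ k)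
    (hne : r ∉ X → X.card = k → (X \ M).Nonempty) (g : Page → ℝ)
    (hg : ∀ y, 0 ≤ g y) (v : ℝ) (hv : r ∉ X → 1 ≤ v)
    (havg : r ∉ X → X.card = k → (∑ p ∈ X \ M, g p) / (X \ M).card ≤ v - 1) :
    ev (evict k r X M) (fun Y => ((Y \ X).card : ℝ) + ∑ y ∈ D \ Y, g y)
      ≤ (if r ∈ X then 0 else v) + ∑ y ∈ (D \ X).erase r, g y := by
  unfold evict
  by_cases hr : r ∈ X
  · rw [if_pos hr, if_pos hr, ev_pure, Finset.erase_eq_of_notMem (by simp [hr])]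
    simp
  · rw [if_neg hr, if_neg hr]
    have hsub : ∀ p, D \ insert r (X.erase p) ⊆ insert p ((D \ X).erase r) := by
      intro p y hy
      simp only [Finset.mem_sdiff, Finset.mem_insert, Finset.mem_erase] at hy ⊢
      tauto
    by_cases hc : X.card < k
    · rw [if_pos hc, ev_pure, Finset.insert_sdiff_of_notMem _ hr]
      have h1 : D \ insert r X = (D \ X).erase r := by
        ext y
        simp only [Finset.mem_sdiff, Finset.mem_insert, Finset.mem_erase]
        tauto
      rw [h1]
      have := hv hr
      simp
      linarith
    · have hc' : X.card = k := by omega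
      have hn := hne hr hc'
      rw [if_neg hc, dif_pos hn, ev_map (finite_support_uniform _ hn), ev_uniform]
      have h1 : ∀ p ∈ X \ M, (((insert r (X.erase p)) \ X).card : ℝ)
          + ∑ y ∈ D \ insert r (X.erase p), g y
          ≤ (1 + ∑ y ∈ (D \ X).erase r, g y) + g p := by
        intro p hp
        have h2 : ((insert r (X.erase p)) \ X).card = 1 := by
          rw [Finset.insert_sdiff_of_notMem _ hr,
            Finset.sdiff_eq_empty_iff_subset.2 (Finset.erase_subset _ _)]
          simp
        have h3 : ∑ y ∈ D \ insert r (X.erase p), g y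
            ≤ ∑ y ∈ insert p ((D \ X).erase r), g y :=
          Finset.sum_le_sum_of_subset_of_nonneg (hsub p) fun y _ _ => hg y
        have h4 : p ∉ (D \ X).erase r := by
          simp only [Finset.mem_sdiff] at hp
          simp [hp.1]
        rw [Finset.sum_insert h4] at h3
        rw [h2]
        push_cast
        linarith
      have h2 := (Finset.sum_le_sum h1).trans_eq Finset.sum_add_distrib
      rw [Finset.sum_const, nsmul_eq_mul] at h2
      have hpos : (0 : ℝ) < (X \ M).card := by exact_mod_cast Finset.card_pos.2 hn
      have h3 := havg hr hc'
      rw [div_le_iff₀ hpos] at h3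
      rw [div_le_iff₀ hpos]
      nlinarith

end drift

namespace Conf

variable {Page : Type u} [DecidableEq Page] {k a L : ℕ} {N : ℕ → ℕ} {s q : Conf Page} {r : Page}

/-- Potential for the analysis of the expected cost: an upper bound for the expected cost before
the next change of level or epoch. -/
noncomputable def potential (k a L : ℕ) (req : ℕ → Page) (T t : ℕ) (s : Conf Page) : ℝ :=
  if s.lev < L then
    -- The sum pays for the rest of the period. A missing page keeps 1 for its load at the adoption,
    -- or 9 = 8 + 1 if the next period has not begun. Each request outside of `ref` that the level
    -- still tolerates has 17 = 8 + 9. The term `12 * w * lev` is saved for the last level, and `2 *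
    -- w` for the change of the cache at a new phase.
    ∑ y ∈ s.ref \ s.cached, randWeight k req y t (s.num * a - s.pos)
      + (if s.sel.isSome then 1 else 9) * (s.missing : ℝ)
      + 17 * (7 * (s.track.w : ℝ) - s.cnt) + 12 * s.track.w * s.lev + 2 * s.track.w
  else
    -- A clean page adds a missing page of weight at most `harmonic k`, paid by the decrease of `2 *
    -- w - clean`.
    ∑ y ∈ s.ref \ s.cached, markWeight k req y s.marked t (T - t)
      + (((harmonic k : ℚ) : ℝ) + 1) * (2 * (s.track.w : ℝ) - s.track.clean) + 2 * s.track.w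

theorem Core.clean_le (h : s.Core k a L N) : (s.track.clean : ℝ) ≤ 2 * s.track.w := by
  have := h.valid.clean_lt
  have h2 : s.track.clean ≤ 2 * s.track.w := by omega
  exact_mod_cast h2

theorem Core.cnt_le_real (h : s.Core k a L N) (hl : s.lev < L) :
    (s.cnt : ℝ) ≤ 7 * s.track.w := by
  exact_mod_cast h.cnt_le hl

theorem Core.two_mul_w_le_potential (h : s.Core k a L N) (req : ℕ → Page) (T t : ℕ) :
    (if s.lev < L then 12 * (s.track.w : ℝ) * s.lev else 0) + 2 * s.track.w
      ≤ s.potential k a L req T t := by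
  unfold potential
  split_ifs with hl h1
  all_goals
    have hc := h.clean_le
    have hH := harmonic_nonneg k
  · have h2 := h.cnt_le_real hl
    have h3 : 0 ≤ ∑ y ∈ s.ref \ s.cached, randWeight k req y t (s.num * a - s.pos) :=
      Finset.sum_nonneg fun y _ => randWeight_nonneg _ _ _ _ _
    have h4 : (0 : ℝ) ≤ s.missing := Nat.cast_nonneg _
    linarith
  · have h2 := h.cnt_le_real hl
    have h3 : 0 ≤ ∑ y ∈ s.ref \ s.cached, randWeight k req y t (s.num * a - s.pos) :=
      Finset.sum_nonneg fun y _ => randWeight_nonneg _ _ _ _ _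
    have h4 : (0 : ℝ) ≤ s.missing := Nat.cast_nonneg _
    linarith
  · have h3 : 0 ≤ ∑ y ∈ s.ref \ s.cached, markWeight k req y s.marked t (T - t) :=
      Finset.sum_nonneg fun y _ => markWeight_nonneg _ _ _ _ _ _
    have h4 : 0 ≤ (((harmonic k : ℚ) : ℝ) + 1) * (2 * (s.track.w : ℝ) - s.track.clean) :=
      mul_nonneg (by linarith) (by linarith)
    linarith

theorem Core.potential_nonneg (h : s.Core k a L N) (req : ℕ → Page) (T t : ℕ) :
    0 ≤ s.potential k a L req T t := by
  refine le_trans ?_ (h.two_mul_w_le_potential req T t)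
  split_ifs <;> positivity

theorem Core.randWeight_le (hk : 0 < k) (hN : ∀ i < L, N i * a ≤ 2 * k) (h : s.Core k a L N)
    (req : ℕ → Page) (y : Page) (t : ℕ) :
    randWeight k req y t (s.num * a - s.pos) ≤ 8 := by
  refine (Caching.randWeight_le _ _ _ _ _).trans (growth_pow_le hk ?_)
  rcases h.num with h1 | ⟨i, hi, h1⟩
  · rw [h1]; omega
  · have := hN i hi
    rw [h1]; omega

/-- With at most `2 * w` missing pages, 155 = 8 * 2 + 9 * 2 + 17 * 7 + 2. -/
theorem potential_new_level (hk : 0 < k) (hN : ∀ i < L, N i * a ≤ 2 * k)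
    (h : s.Ready k a L N r) (hlev : s.lev < L) (hcnt : s.cnt = 0) (hsel : s.sel = none)
    (req : ℕ → Page) (T t : ℕ) :
    s.potential k a L req T t ≤ 155 * s.track.w + 12 * s.track.w * s.lev := by
  have h1 : (s.missing : ℝ) ≤ 2 * s.track.w := by exact_mod_cast h.card_sdiff_le
  have h2 : ∑ y ∈ s.ref \ s.cached, randWeight k req y t (s.num * a - s.pos)
      ≤ 8 * s.missing := by
    refine (Finset.sum_le_card_nsmul _ _ 8 fun y _ => h.randWeight_le hk hN req y t).trans_eq ?_
    rw [nsmul_eq_mul, mul_comm]; rfl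
  rw [potential, if_pos hlev, hcnt, hsel]
  simp only [Option.isSome_none, Bool.false_eq_true, if_false, Nat.cast_zero, sub_zero]
  linarith

/-- The missing pages and the future clean pages take `(4 * H + 2) * w`, and `H ≤ 3 * L`; hence the
rate of 12 per level. -/
theorem potential_last_level (hH : ((harmonic k : ℚ) : ℝ) ≤ 3 * L)
    (h : s.Ready k a L N r) (hlev : s.lev = L) (req : ℕ → Page) (T t : ℕ) :
    s.potential k a L req T t ≤ 12 * s.track.w * L + 4 * s.track.w := by
  have h1 : (s.missing : ℝ) ≤ 2 * s.track.w := by exact_mod_cast h.card_sdiff_le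
  have h0 := harmonic_nonneg k
  have h2 : ∑ y ∈ s.ref \ s.cached, markWeight k req y s.marked t (T - t)
      ≤ ((harmonic k : ℚ) : ℝ) * s.missing := by
    refine (Finset.sum_le_card_nsmul _ _ _ fun y _ => markWeight_le k req y _ t _).trans_eq ?_
    rw [nsmul_eq_mul, mul_comm]; rfl
  have h3 : (0 : ℝ) ≤ s.track.clean := Nat.cast_nonneg _
  have h4 : (0 : ℝ) ≤ s.track.w := Nat.cast_nonneg _
  rw [potential, if_neg (by omega)]
  have h5 : ((harmonic k : ℚ) : ℝ) * s.missing ≤ ((harmonic k : ℚ) : ℝ) * (2 * s.track.w) :=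
    mul_le_mul_of_nonneg_left h1 h0
  have h6 : ((harmonic k : ℚ) : ℝ) * s.track.w ≤ 3 * L * s.track.w :=
    mul_le_mul_of_nonneg_right hH h4
  have h7 : 0 ≤ (((harmonic k : ℚ) : ℝ) + 1) * s.track.clean := by positivity
  nlinarith

/-- Pages that have to be loaded at the beginning of a phase. -/
theorem Good.card_load_le (h : s.Good k a L N) (L' : ℕ) (r : Page) :
    ((s.prep k L' r).cached \ s.cached).card
      ≤ if s.track.Reset k r then 2 * s.track.w else 0 := by
  by_cases hr : s.track.Reset k r
  · rw [if_pos hr, prep_reset L' hr]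
    simp only
    by_cases hp : s.track.NewPhase k r
    · rw [if_pos hp, trim_eq_self h.valid.card_req]
      have h1 := h.card_eq
      have h2 : s.track.req.card ≤ s.track.pages.card :=
        Finset.card_le_card Finset.subset_union_right
      have h3 := h.valid.card_req
      have h4 := hp.2
      have h5 := Finset.card_sdiff_add_card_inter s.track.req s.cached
      have h6 := Finset.card_sdiff_add_card_inter s.cached s.track.req
      rw [Finset.inter_comm] at h6
      -- Old cache and new base both have `k` pages, so the loads are as many as the cached pages
      -- not requested in the old phase. Those lie in the old `base`, and there are at most `clean ≤
      -- 2 * w` of them.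
      have h7 : s.cached \ s.track.req ⊆ s.track.base \ s.track.req := by
        intro y hy
        have := h.ref_sub (h.cached_sub (Finset.mem_sdiff.1 hy).1)
        simp only [Track.pages, Finset.mem_sdiff, Finset.mem_union] at this hy ⊢
        tauto
      have h8 := Finset.card_le_card h7
      have h9 := Finset.card_sdiff_add_card_inter s.track.base s.track.req
      have h10 := Finset.card_sdiff_add_card_inter s.track.req s.track.base
      rw [Finset.inter_comm] at h10
      have h11 := h.valid.card_base
      have h12 : s.track.clean = (s.track.req \ s.track.base).card := rfl
      have h13 := h.valid.clean_lt
      omega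
    · rw [if_neg hp, h.cache_eq]; simp
  · rw [if_neg hr]
    have : (s.prep k L' r).cached = s.cache k := by
      by_cases hf : s.Fails k L' r
      · rw [prep_fails hf]
      · rw [prep_regular hr hf]
    rw [this, h.cache_eq]; simp

/-- A failure keeps the savings `12 * w * lev` and needs at most `(155 + 12) * w` more; a reset
needs `155` times the new weight, and its loads come from the old reserve `2 * w`. -/
theorem potential_prep (hk : 0 < k) (hL : 0 < L) (hN : ∀ i < L, N i * a ≤ 2 * k)
    (hH : ((harmonic k : ℚ) : ℝ) ≤ 3 * L) (h : s.Good k a L N) (req : ℕ → Page) (T t : ℕ) :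
    (((s.prep k L (req t)).cached \ s.cached).card : ℝ)
      + (s.prep k L (req t)).potential k a L req T t ≤ s.potential k a L req T t
      + 170 * ((if s.track.Reset k (req t) then ((s.track.next k (req t)).w : ℝ) else 0)
        + if s.Fails k L (req t) then (s.track.w : ℝ) else 0) := by
  have hR := h.prep hk (req t)
  have ht := track_prep k L s (req t)
  have hn := num_prep k L s (req t)
  have hload := h.card_load_le L (req t)
  have hold := h.two_mul_w_le_potential req T t
  have hw0 : (0 : ℝ) ≤ s.track.w := Nat.cast_nonneg _
  by_cases hr : s.track.Reset k (req t)
  · have hlev : (s.prep k L (req t)).lev = 0 := by rw [prep_reset L hr]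
    have hcnt : (s.prep k L (req t)).cnt = 0 := by rw [prep_reset L hr]
    have hsel : (s.prep k L (req t)).sel = none := by rw [prep_reset L hr]
    have hnf : ¬ s.Fails k L (req t) := fun hf => hf.1 hr
    rw [if_pos hr] at hload
    rw [if_pos hr, if_neg hnf]
    have h1 := potential_new_level hk hN hR (by omega) hcnt hsel req T t
    rw [hlev, ht] at h1
    have h2 : (((s.prep k L (req t)).cached \ s.cached).card : ℝ) ≤ 2 * s.track.w := by
      exact_mod_cast hload
    have h3 : (0 : ℝ) ≤ (s.track.next k (req t)).w := Nat.cast_nonneg _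
    have h4 : (0 : ℝ) ≤ if s.lev < L then 12 * (s.track.w : ℝ) * s.lev else 0 := by
      split_ifs <;> positivity
    push_cast at h1
    linarith
  · rw [if_neg hr] at hload
    have h0 : ((s.prep k L (req t)).cached \ s.cached).card = 0 := by omega
    obtain ⟨hp, hnext, hclean, hclean'⟩ := Track.next_of_not_reset hr
    have hw : (s.prep k L (req t)).track.w = s.track.w := by rw [ht, hnext]
    rw [if_neg hr, h0]
    by_cases hf : s.Fails k L (req t)
    · have hlev : (s.prep k L (req t)).lev = s.lev + 1 := by rw [prep_fails hf]
      have hcnt : (s.prep k L (req t)).cnt = 0 := by rw [prep_fails hf]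
      have hsel : (s.prep k L (req t)).sel = none := by rw [prep_fails hf]
      rw [if_pos hf]
      rw [if_pos hf.2.1] at hold
      by_cases hl : s.lev + 1 < L
      · have h1 := potential_new_level hk hN hR (by omega) hcnt hsel req T t
        rw [hlev, hw] at h1
        push_cast at h1 ⊢
        linarith
      · have hl' : s.lev + 1 = L := by have := hf.2.1; omega
        have h1 := potential_last_level hH hR (by omega) req T t
        rw [hw] at h1
        have h2 : (L : ℝ) = s.lev + 1 := by exact_mod_cast hl'.symm
        rw [h2] at h1
        push_cast
        linarith
    · rw [if_neg hf]
      have he := prep_regular hr hf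
      have hlev : (s.prep k L (req t)).lev = s.lev := by rw [he]
      have hcnt : (s.prep k L (req t)).cnt = s.cnt + if req t ∈ s.ref then 0 else 1 := by rw [he]
      have hsel : (s.prep k L (req t)).sel = s.sel := by rw [he]
      have hM : (s.prep k L (req t)).marked = s.marked := by rw [he]
      have href : (s.prep k L (req t)).ref = insert (req t) s.ref := by rw [he]
      have hX : (s.prep k L (req t)).cached = s.cached := by rw [he, ← h.cache_eq]
      have hsum : ∀ g : Page → ℝ, 0 ≤ g (req t) →
          ∑ y ∈ insert (req t) s.ref \ s.cached, g y ≤ ∑ y ∈ s.ref \ s.cached, g y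
            + if req t ∈ s.ref then 0 else g (req t) := by
        intro g hg
        split_ifs with hm
        · rw [Finset.insert_eq_of_mem hm]; simp
        · have hnx : req t ∉ s.cached := fun h' => hm (h.cached_sub h')
          rw [Finset.insert_sdiff_of_notMem _ hnx, Finset.sum_insert (by simp [hm])]
          linarith
      by_cases hl : s.lev < L
      · have hmiss : ((s.prep k L (req t)).missing : ℝ)
            ≤ s.missing + if req t ∈ s.ref then 0 else 1 := by
          have := missing_insert_le s.cached s.ref (req t)
          rw [missing, missing, href, hX]
          split_ifs at this ⊢ <;> exact_mod_cast this
        rw [potential, potential, hlev, hcnt, hsel, hw, hn.1, hn.2, if_pos hl, if_pos hl, href, hX]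
        have h1 := hsum (fun y => randWeight k req y t (s.num * a - s.pos))
          (randWeight_nonneg _ _ _ _ _)
        have h2 := h.randWeight_le hk hN req (req t) t
        by_cases hm : req t ∈ s.ref
        · rw [if_pos hm] at h1 hmiss ⊢
          have : (if s.sel.isSome then (1 : ℝ) else 9) * ((s.prep k L (req t)).missing : ℝ)
              ≤ (if s.sel.isSome then 1 else 9) * (s.missing : ℝ) := by
            split_ifs <;> linarith
          push_cast
          linarith
        · rw [if_neg hm] at h1 hmiss ⊢
          have : (if s.sel.isSome then (1 : ℝ) else 9) * ((s.prep k L (req t)).missing : ℝ)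
              ≤ (if s.sel.isSome then 1 else 9) * (s.missing : ℝ) + 9 := by
            split_ifs <;> linarith
          push_cast
          linarith
      · have hL' : s.lev = L := le_antisymm h.lev_le (by omega)
        have h1 := hsum (fun y => markWeight k req y s.marked t (T - t))
          (markWeight_nonneg _ _ _ _ _ _)
        have h2 := markWeight_le k req (req t) s.marked t (T - t)
        have h3 := harmonic_nonneg k
        have hc2 : ((s.prep k L (req t)).track.clean : ℝ)
            = s.track.clean + if req t ∈ s.ref then 0 else 1 := by
          rw [ht, hclean, (h.final hL').1]
          split_ifs <;> push_cast <;> rfl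
        rw [potential, potential, hlev, if_neg hl, if_neg hl, hw, hM, href, hX, hc2]
        by_cases hm : req t ∈ s.ref
        · rw [if_pos hm] at h1 ⊢
          push_cast
          linarith
        · rw [if_neg hm] at h1 ⊢
          push_cast
          linarith

/-- The old period is over and its weights are 0. A new one needs at most 8 per missing page, and
the coefficient of `missing` falls from 9 to 1. -/
theorem potential_launched (hk : 0 < k) (hN : ∀ i < L, N i * a ≤ 2 * k)
    (h : s.Ready k a L N r) (hq : s.Launched a L N r q) (req : ℕ → Page) (T t : ℕ) :
    q.potential k a L req T t ≤ s.potential k a L req T t := by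
  rcases hq with ⟨hs, l, hl, rfl⟩ | ⟨-, rfl⟩
  · have h2 : s.sel = none := by
      by_contra h3
      obtain ⟨l', hl'⟩ := Option.ne_none_iff_exists'.1 h3
      have h4 := h.sel_some l' hl'
      have h5 : (l' + 1) * a ≤ s.num * a := Nat.mul_le_mul_right a h4.1
      have h6 := hs.1
      omega
    have h3 : s.num * a - s.pos = 0 := by have := hs.1; omega
    have h4 : ∑ y ∈ s.ref \ s.cached, randWeight k req y t (N s.lev * a - 0)
        ≤ 8 * s.missing := by
      refine (Finset.sum_le_card_nsmul _ _ 8 fun y _ => ?_).trans_eq ?_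
      · refine (Caching.randWeight_le _ _ _ _ _).trans (growth_pow_le hk ?_)
        have := hN s.lev hs.2.2.1
        omega
      · rw [nsmul_eq_mul, mul_comm]; rfl
    have h5 : (s.launch N l).potential k a L req T t
        = ∑ y ∈ s.ref \ s.cached, randWeight k req y t (N s.lev * a - 0) + 1 * (s.missing : ℝ)
      + 17 * (7 * (s.track.w : ℝ) - s.cnt) + 12 * s.track.w * s.lev + 2 * s.track.w := by
      simp [potential, launch, hs.2.2.1, missing]
    rw [h5, potential, if_pos hs.2.2.1, h2, h3]
    simp only [Option.isSome_none, Bool.false_eq_true, if_false, randWeight,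
      Finset.sum_const_zero]
    linarith
  · exact le_rfl

end Conf

end Caching

namespace Caching

/-! ### Drift of the potential when a request is served -/

namespace Conf

variable {Page : Type u} [DecidableEq Page] {k a L : ℕ} {N : ℕ → ℕ} {s q : Conf Page} {r : Page}

/-- The weight of the requested page, and the weights of the other missing pages. -/
theorem sum_sdiff_split (D X : Finset Page) {r : Page} (hr : r ∈ D) (g : Page → ℝ) :
    ∑ y ∈ D \ X, g y = (if r ∈ X then 0 else g r) + ∑ y ∈ (D \ X).erase r, g y := by
  split_ifs with h
  · rw [Finset.erase_eq_of_notMem (by simp [h])]; simp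
  · rw [Finset.add_sum_erase]
    simp [hr, h]

/-- The step is part of a period, or the page is in the cache, or the level is the last one. -/
theorem Launched.active (ha : 0 < a) (hN : ∀ i < L, 0 < N i) (h : s.Launched a L N r q) :
    q.pos < q.num * a ∨ r ∈ q.cached ∨ L ≤ q.lev := by
  rcases h with ⟨hs, l, hl, rfl⟩ | ⟨hs, rfl⟩
  · left
    exact Nat.mul_pos hs.2.2.2 ha
  · by_contra hcon
    push Not at hcon
    exact hs ⟨hcon.1, hcon.2.1, hcon.2.2, hN _ hcon.2.2⟩

/-- A fault releases the weight `(1 + 1 / k) ^ n`, enough for one load and the average weight of the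
victim by `sum_randWeight_le`. Outside of periods there are no faults to be served. -/
theorem ev_finish_level (hk : 0 < k) (h : q.Ready k a L N r) (hd : ¬ q.Due a) (hlev : q.lev < L)
    (req : ℕ → Page) (t : ℕ) (hr : req t = r) (T : ℕ)
    (hact : q.pos < q.num * a ∨ r ∈ q.cached) (R : Finset Page) :
    ev (q.finish k a L r R) (fun s' => ((s'.cached \ q.cached).card : ℝ)
      + s'.potential k a L req T (t + 1)) ≤ q.potential k a L req T t := by
  set n := q.num * a - (if q.pos < q.num * a then q.pos + 1 else q.pos) with hn
  have hg : ∀ y, 0 ≤ randWeight k req y (t + 1) n := fun y => randWeight_nonneg _ _ _ _ _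
  have hsum : ∑ y ∈ q.ref \ q.cached, randWeight k req y t (q.num * a - q.pos)
      = (if r ∈ q.cached then 0 else (1 + 1 / (k : ℝ)) ^ n)
        + ∑ y ∈ (q.ref \ q.cached).erase r, randWeight k req y (t + 1) n := by
    by_cases hp : q.pos < q.num * a
    · have h1 : q.num * a - q.pos = n + 1 := by rw [hn, if_pos hp]; omega
      rw [h1, sum_sdiff_split q.ref q.cached h.mem_ref, ← hr, randWeight_self]
      congr 1
      exact Finset.sum_congr rfl fun y hy =>
        randWeight_of_ne k req (Finset.ne_of_mem_erase hy) n
    · have hrc : r ∈ q.cached := by tauto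
      have h1 : q.num * a - q.pos = 0 := by omega
      have h2 : n = 0 := by rw [hn, if_neg hp]; omega
      rw [h1, h2, if_pos hrc]
      simp [randWeight]
  have hM := h.marked_eq hlev
  have hE := ev_evict_le (k := k) (r := r) (X := q.cached) (M := q.marked) (D := q.ref)
    h.card_cached (fun h1 h2 => h.unmarked_nonempty h1 h2)
    (fun y => randWeight k req y (t + 1) n) hg ((1 + 1 / (k : ℝ)) ^ n)
    (fun _ => one_le_pow₀ (one_le_growth k)) (by
      intro _ hc
      rw [hM, Finset.sdiff_empty, hc, div_le_iff₀ (by exact_mod_cast hk)]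
      have := sum_randWeight_le hk req q.cached (t + 1) n
      linarith)
  rw [← hsum] at hE
  rw [finish, if_neg hd, ev_map (finite_support_evict _ _ _ _)]
  have hfin := finite_support_evict k r q.cached q.marked
  have h1 : ev (evict k r q.cached q.marked)
      (fun X => (((q.serve a L r X).cached \ q.cached).card : ℝ)
        + (q.serve a L r X).potential k a L req T (t + 1))
      ≤ ev (evict k r q.cached q.marked) (fun X => (((X \ q.cached).card : ℝ)
        + ∑ y ∈ q.ref \ X, randWeight k req y (t + 1) n)
        + ((if q.sel.isSome then 1 else 9) * (q.missing : ℝ)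
      + 17 * (7 * (q.track.w : ℝ) - q.cnt) + 12 * q.track.w * q.lev + 2 * q.track.w)) := by
    refine ev_mono hfin fun X hX => ?_
    have h2 : (q.serve a L r X).potential k a L req T (t + 1)
        = ∑ y ∈ q.ref \ X, randWeight k req y (t + 1) n
          + (if q.sel.isSome then 1 else 9) * ((q.serve a L r X).missing : ℝ)
          + 17 * (7 * (q.track.w : ℝ) - q.cnt) + 12 * q.track.w * q.lev + 2 * q.track.w := by
      rw [potential, if_pos (show (q.serve a L r X).lev < L from hlev)]
      rfl
    have h3 : ((q.serve a L r X).missing : ℝ) ≤ q.missing := by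
      have h4 : q.serve a L r X ∈ (q.finish k a L r R).support := by
        rw [finish, if_neg hd, PMF.mem_support_map_iff]
        exact ⟨X, hX, rfl⟩
      exact_mod_cast missing_finish_le h h4
    have h5 : (if q.sel.isSome then (1 : ℝ) else 9) * ((q.serve a L r X).missing : ℝ)
        ≤ (if q.sel.isSome then 1 else 9) * (q.missing : ℝ) := by
      split_ifs <;> linarith
    rw [h2]
    change ((X \ q.cached).card : ℝ) + _ ≤ _
    linarith
  refine h1.trans ?_
  rw [ev_add hfin, ev_const hfin, potential, if_pos hlev]
  linarith

/-- The same exchange, with harmonic weights and `sum_markWeight_div_le`. -/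
theorem ev_finish_last (h : q.Ready k a L N r) (hlev : q.lev = L)
    (req : ℕ → Page) (t : ℕ) (hr : req t = r) {T : ℕ} (hT : t < T) (R : Finset Page) :
    ev (q.finish k a L r R) (fun s' => ((s'.cached \ q.cached).card : ℝ)
      + s'.potential k a L req T (t + 1)) ≤ q.potential k a L req T t := by
  have hd : ¬ q.Due a := fun hd => by
    have := h.sel_lev hd.2
    omega
  have hl : ¬ q.lev < L := by omega
  set n := T - (t + 1) with hn
  have hg : ∀ y, 0 ≤ markWeight k req y (insert r q.marked) (t + 1) n :=
    fun y => markWeight_nonneg _ _ _ _ _ _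
  have hsum : ∑ y ∈ q.ref \ q.cached, markWeight k req y q.marked t (T - t)
      = (if r ∈ q.cached then 0 else ((harmonic (k - q.marked.card) : ℚ) : ℝ))
        + ∑ y ∈ (q.ref \ q.cached).erase r, markWeight k req y (insert r q.marked) (t + 1) n := by
    have h1 : T - t = n + 1 := by omega
    rw [h1, sum_sdiff_split q.ref q.cached h.mem_ref, ← hr, markWeight_self]
    congr 1
    exact Finset.sum_congr rfl fun y hy =>
      markWeight_of_ne k req (Finset.ne_of_mem_erase hy) _ n
  have hE := ev_evict_le (k := k) (r := r) (X := q.cached) (M := q.marked) (D := q.ref)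
    h.card_cached (fun h1 h2 => h.unmarked_nonempty h1 h2)
    (fun y => markWeight k req y (insert r q.marked) (t + 1) n) hg
    ((harmonic (k - q.marked.card) : ℚ) : ℝ)
    (fun hrc => by
      have h1 : q.marked.card < k := by
        rcases h.card_eq with hc | ⟨hc, -⟩
        · exact (h.card_unmarked hrc hc).2
        · exact (Finset.card_le_card h.marked_sub).trans_lt hc
      have h2 := harmonic_mono (show 1 ≤ k - q.marked.card by omega)
      simpa [harmonic] using h2)
    (by
      intro hrc hc
      have h1 := h.card_unmarked hrc hc
      exact sum_markWeight_div_le k req _ _ r _ _ Finset.sdiff_disjoint h1.1 (by omega)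
        (by simp [hrc]) (fun h' => hrc (h.marked_sub h')))
  rw [← hsum] at hE
  rw [finish, if_neg hd, ev_map (finite_support_evict _ _ _ _)]
  have hfin := finite_support_evict k r q.cached q.marked
  have h1 : (fun X => (((q.serve a L r X).cached \ q.cached).card : ℝ)
        + (q.serve a L r X).potential k a L req T (t + 1))
      = fun X => (((X \ q.cached).card : ℝ)
        + ∑ y ∈ q.ref \ X, markWeight k req y (insert r q.marked) (t + 1) n)
        + ((((harmonic k : ℚ) : ℝ) + 1) * (2 * (q.track.w : ℝ) - q.track.clean)
          + 2 * q.track.w) := by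
    funext X
    rw [potential, if_neg (show ¬ (q.serve a L r X).lev < L from hl)]
    simp only [serve, if_neg hl]
    ring
  rw [h1, ev_add hfin, ev_const hfin, potential, if_neg hl]
  linarith

/-- What is left is the adoption of an answer: only missing pages of `ref` are loaded, at 1 each,
and afterwards nothing is missing. -/
theorem ev_finish_le (hk : 0 < k) (ha : 0 < a) (hN : ∀ i < L, 0 < N i) {p : Conf Page}
    (hq : p.Launched a L N r q) (h : q.Ready k a L N r)
    (req : ℕ → Page) (t : ℕ) (hr : req t = r) {T : ℕ} (hT : t < T) (R : Finset Page) :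
    ev (q.finish k a L r R) (fun s' => ((s'.cached \ q.cached).card : ℝ)
      + s'.potential k a L req T (t + 1)) ≤ q.potential k a L req T t := by
  rcases h.lev_le.lt_or_eq with hl | hl
  · by_cases hd : q.Due a
    · have h1 : (q.sync k r R).potential k a L req T (t + 1)
          = 17 * (7 * (q.track.w : ℝ) - q.cnt) + 12 * q.track.w * q.lev + 2 * q.track.w := by
        rw [potential, if_pos (show (q.sync k r R).lev < L from hl)]
        simp [sync, missing]
      have h2 : (((q.sync k r R).cached \ q.cached).card : ℝ) ≤ q.missing := by
        have := Finset.card_le_card (Finset.sdiff_subset_sdiff (sync_subset k h.mem_ref R)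
          (le_refl q.cached))
        exact_mod_cast this
      have h3 : 0 ≤ ∑ y ∈ q.ref \ q.cached, randWeight k req y t (q.num * a - q.pos) :=
        Finset.sum_nonneg fun y _ => randWeight_nonneg _ _ _ _ _
      rw [finish, if_pos hd, ev_pure, h1, potential, if_pos hl, hd.2]
      simp only [Option.isSome_some, if_true]
      linarith
    · refine ev_finish_level hk h hd hl req t hr T ?_ R
      rcases hq.active ha hN with h1 | h1 | h1
      · exact Or.inl h1
      · exact Or.inr h1
      · omega
  · exact ev_finish_last h hl req t hr hT R

/-- Expectation over a step, in terms of the configurations in which the request is served. -/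
theorem ev_move_le (s : Conf Page) (r : Page) (R : Finset Page) (Z : Conf Page → ℝ)
    (g : Conf Page → ℝ) (b : ℝ)
    (h1 : ∀ q, (s.prep k L r).Launched a L N r q → ev (q.finish k a L r R) Z ≤ g q)
    (h2 : ¬ (s.prep k L r).Starts a L N r → g (s.prep k L r) ≤ b)
    (h3 : (s.prep k L r).Starts a L N r →
      (∑ l ∈ Finset.range (N (s.prep k L r).lev), g ((s.prep k L r).launch N l))
        / N (s.prep k L r).lev ≤ b) :
    ev (s.move k a L N r R) Z ≤ b := by
  unfold move
  split_ifs with hs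
  · rw [ev_bind (finite_support_uniform _ _) fun l _ => finite_support_finish _ _ _, ev_uniform]
    refine le_trans ?_ (h3 hs)
    rw [Finset.card_range]
    gcongr with l hl
    exact h1 _ (Or.inl ⟨hs, l, Finset.mem_range.1 hl, rfl⟩)
  · exact (h1 _ (Or.inr ⟨hs, rfl⟩)).trans (h2 hs)

/-- Expected cost and change of the potential in one step. -/
theorem ev_move_potential_le (hk : 0 < k) (ha : 0 < a) (hL : 0 < L) (hN0 : ∀ i < L, 0 < N i)
    (hN : ∀ i < L, N i * a ≤ 2 * k) (hH : ((harmonic k : ℚ) : ℝ) ≤ 3 * L)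
    (h : s.Good k a L N) (req : ℕ → Page) {T t : ℕ} (hT : t < T) {R : Finset Page} :
    ev (s.move k a L N (req t) R) (fun s' => ((s'.cache k \ s.cache k).card : ℝ)
      + s'.potential k a L req T (t + 1)) ≤ s.potential k a L req T t
      + 170 * ((if s.track.Reset k (req t) then ((s.track.next k (req t)).w : ℝ) else 0)
        + if s.Fails k L (req t) then (s.track.w : ℝ) else 0) := by
  have hp := h.prep hk (req t)
  have h0 := potential_prep hk hL hN hH h req T t
  refine ev_move_le s (req t) R _ (fun q => ((s.prep k L (req t)).cached \ s.cached).card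
    + q.potential k a L req T t) _ ?_ (fun _ => h0) ?_
  · intro q hq
    have hR := hq.ready ha hp
    have h1 := ev_finish_le hk ha hN0 hq hR req t rfl hT R
    have hfin := finite_support_finish (k := k) (a := a) (L := L) q (req t) R
    calc _ ≤ ev (q.finish k a L (req t) R) (fun s' =>
          (((s.prep k L (req t)).cached \ s.cached).card : ℝ) +
          (((s'.cached \ q.cached).card : ℝ) + s'.potential k a L req T (t + 1))) := by
          refine ev_mono hfin fun s' hs' => ?_
          have hc := (of_mem_support_finish hk hR.card_cached hs').2
          have h2 : s'.cache k = s'.cached := if_pos hc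
          rw [h2, h.cache_eq, ← hq.same.2.1]
          have h3 : s'.cached \ s.cached ⊆ (q.cached \ s.cached) ∪ (s'.cached \ q.cached) := by
            intro y hy
            simp only [Finset.mem_sdiff, Finset.mem_union] at hy ⊢
            tauto
          have h4 : ((s'.cached \ s.cached).card : ℝ)
              ≤ (q.cached \ s.cached).card + (s'.cached \ q.cached).card := by
            exact_mod_cast (Finset.card_le_card h3).trans (Finset.card_union_le _ _)
          linarith
      _ ≤ _ := by
          rw [ev_add hfin, ev_const hfin]
          linarith
  · intro hs
    have hpos : (0 : ℝ) < N (s.prep k L (req t)).lev := by exact_mod_cast hs.2.2.2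
    rw [div_le_iff₀ hpos]
    refine (Finset.sum_le_card_nsmul _ _ (s.potential k a L req T t
        + 170 * ((if s.track.Reset k (req t) then ((s.track.next k (req t)).w : ℝ) else 0)
        + if s.Fails k L (req t) then (s.track.w : ℝ) else 0)) fun l hl => ?_).trans_eq ?_
    · have h1 := potential_launched hk hN hp
        (Or.inl ⟨hs, l, Finset.mem_range.1 hl, rfl⟩) req T t
      linarith
    · rw [Finset.card_range, nsmul_eq_mul, mul_comm]

end Conf

end Caching

namespace Caching

/-! ### The expected error -/

namespace Conf

variable {Page : Type u} [DecidableEq Page] {k a L : ℕ} {N : ℕ → ℕ} {s q : Conf Page} {r : Page}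

/-- The pages of Belady's cache that are lost when the answer of the predictor is adopted are no
more than the error of the prediction. -/
theorem card_lost_le (hk : 0 < k) (P : Predictor Page k) (t : ℕ)
    (hq : q.Asks a) {C : Finset Page} (hr : r ∈ C) :
    (C ∩ (q.ref \ insert r (trim (k - 1) (q.ref.erase r \ q.reply P a r t)))).card
      ≤ (C \ P.state t).card := by
  set E := q.ref.erase r with hE
  have hR : q.reply P a r t = P.report t E (E.card + 1 - k) := by rw [reply, if_pos hq]
  rw [hR]
  set R := P.report t E (E.card + 1 - k) with hRdef
  have hsub : R ⊆ E \ P.state t := P.report_subset _ _ _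
  have hcard : R.card = min (E.card + 1 - k) (E \ P.state t).card := P.card_report _ _ _
  have hRE : R ⊆ E := hsub.trans Finset.sdiff_subset
  have hCR : C ∩ R ⊆ C \ P.state t := by
    intro y hy
    have h1 := Finset.mem_sdiff.1 (hsub (Finset.mem_inter.1 hy).2)
    exact Finset.mem_sdiff.2 ⟨(Finset.mem_inter.1 hy).1, h1.2⟩
  have hrR : r ∉ R := fun h' => Finset.notMem_erase r q.ref (hRE h')
  have hER := Finset.card_sdiff_add_card_eq_card hRE
  by_cases hc : (E \ R).card ≤ k - 1
  · refine Finset.card_le_card (Finset.Subset.trans ?_ hCR)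
    rw [trim_eq_self hc]
    intro y hy
    simp only [Finset.mem_inter, Finset.mem_sdiff, Finset.mem_insert, hE, Finset.mem_erase] at hy ⊢
    tauto
  -- If more than `k - 1` pages are left, the predictor has reported all it could and the rest is
  -- exactly the predicted cache. It has `k` pages and does not contain `r ∈ C`; this error makes up
  -- for the one page that is trimmed.
  · have h1 : R = E \ P.state t :=
      Finset.eq_of_subset_of_card_le hsub (by omega)
    have h2 : E \ R ⊆ P.state t := by
      rw [h1]
      intro y hy
      simp only [Finset.mem_sdiff] at hy
      tauto
    have h3 := Finset.card_le_card h2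
    have h4 := P.card_state t
    have h5 : E \ R = P.state t := Finset.eq_of_subset_of_card_le h2 (by omega)
    have h6 : r ∉ P.state t := by
      rw [← h5]
      simp [hE]
    have h7 : insert r (C ∩ R) ⊆ C \ P.state t :=
      Finset.insert_subset (Finset.mem_sdiff.2 ⟨hr, h6⟩) hCR
    have h8 := Finset.card_le_card h7
    rw [Finset.card_insert_of_notMem (by simp [hrR])] at h8
    have h9 : C ∩ (q.ref \ insert r (trim (k - 1) (E \ R)))
        ⊆ (C ∩ R) ∪ ((E \ R) \ trim (k - 1) (E \ R)) := by
      intro y hy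
      simp only [Finset.mem_inter, Finset.mem_sdiff, Finset.mem_insert, Finset.mem_union, hE,
        Finset.mem_erase] at hy ⊢
      tauto
    have h10 := (Finset.card_le_card h9).trans (Finset.card_union_le _ _)
    rw [Finset.card_sdiff_of_subset (trim_subset _ _), card_trim] at h10
    omega

/-- The number of requests outside of the reference set, and of pages in Belady's cache that are
not in the reference set, beyond those that are explained by new pages and faults of Belady's
algorithm. -/
noncomputable def excess (init : Finset Page) (k : ℕ) (req : ℕ → Page) (B : ℕ → Finset Page)
    (t : ℕ) (s : Conf Page) : ℝ :=
  s.cnt + ((B t ∩ s.track.pages) \ s.ref).card - s.track.clean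
    - ((faults req t B : ℝ) - faults req (Track.phaseStart k init req t) B)

/-- The error of the prediction at step `t`, if there is any. -/
def errorAt (P : Predictor Page k) (B : ℕ → Finset Page) (T t : ℕ) : ℕ :=
  if t < T then (B (t + 1) \ P.state t).card else 0

/-- Error of the prediction that will be adopted in the current period, times the number of
queries, minus the total error of the remaining predictions of the period. -/
noncomputable def pending (a : ℕ) (e : ℕ → ℕ) (t : ℕ) (s : Conf Page) : ℝ :=
  (match s.sel with
    | none => 0
    | some l => (s.num : ℝ) * e (t + ((l + 1) * a - s.pos) - 1))
  - ∑ i ∈ Finset.range s.num, if s.pos < (i + 1) * a then (e (t + ((i + 1) * a - s.pos) - 1) : ℝ)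
      else 0

/-- The excess of the current level, weighted with the number of queries in a period. -/
noncomputable def charge (L : ℕ) (N : ℕ → ℕ) (init : Finset Page) (k : ℕ) (req : ℕ → Page)
    (B : ℕ → Finset Page) (t : ℕ) (s : Conf Page) : ℝ :=
  if s.lev < L then N s.lev * max (s.excess init k req B t) 0 else 0

theorem charge_nonneg (init : Finset Page) (req : ℕ → Page) (B : ℕ → Finset Page) (t : ℕ)
    (s : Conf Page) : 0 ≤ s.charge L N init k req B t := by
  unfold charge
  split_ifs
  · have := le_max_right (s.excess init k req B t) 0
    positivity
  · exact le_rfl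

variable {init : Finset Page} {req : ℕ → Page} {B : ℕ → Finset Page} {T : ℕ}

/-- Withdrawing the selection drops a nonnegative term; the subtracted errors stay because the
period goes on. -/
theorem pending_prep_le (a k L : ℕ) (e : ℕ → ℕ) (t : ℕ) (s : Conf Page) (r : Page) :
    (s.prep k L r).pending a e t ≤ s.pending a e t := by
  have hn := num_prep k L s r
  have hs : (s.prep k L r).sel = none ∨ (s.prep k L r).sel = s.sel := by
    by_cases hr : s.track.Reset k r
    · rw [prep_reset L hr]
      exact Or.inl rfl
    · by_cases hf : s.Fails k L r
      · rw [prep_fails hf]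
        exact Or.inl rfl
      · rw [prep_regular hr hf]
        exact Or.inr rfl
  unfold pending
  rw [hn.1, hn.2]
  rcases hs with hs | hs
  · rw [hs]
    rcases s.sel with _ | l
    · exact le_rfl
    · have : (0 : ℝ) ≤ (s.num : ℝ) * e (t + ((l + 1) * a - s.pos) - 1) := by positivity
      simp only
      linarith
  · rw [hs]

/-- The counter grows only if Belady's algorithm faults, the page is new, or the page is in
Belady's cache. -/
theorem excess_step (hB : IsBelady k init req T B) {t : ℕ} (ht : t < T)
    (htr : s.track = Track.at_ k init req t) (hr : ¬ s.track.Reset k (req t)) :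
    ((s.cnt + if req t ∈ s.ref then 0 else 1 : ℕ) : ℝ)
      + ((B (t + 1) ∩ (s.track.next k (req t)).pages) \ insert (req t) s.ref).card
      - (s.track.next k (req t)).clean
      - ((faults req (t + 1) B : ℝ) - faults req (Track.phaseStart k init req (t + 1)) B)
      ≤ s.excess init k req B t := by
  obtain ⟨hp, hnext, hclean, -⟩ := Track.next_of_not_reset hr
  have hps : Track.phaseStart k init req (t + 1) = Track.phaseStart k init req t := by
    rw [htr] at hp
    simp only [Track.phaseStart, if_neg hp]
  have hpages := Track.pages_next_of_not_newPhase hp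
  have hsub : (B (t + 1) ∩ (s.track.next k (req t)).pages) \ insert (req t) s.ref
      ⊆ ((B t ∩ s.track.pages) \ s.ref).erase (req t) := by
    intro y hy
    rw [hpages] at hy
    simp only [Finset.mem_inter, Finset.mem_sdiff, Finset.mem_insert, Finset.mem_erase] at hy ⊢
    have := hB.subset_insert ht hy.1.1
    rw [Finset.mem_insert] at this
    tauto
  have hcard := Finset.card_le_card hsub
  have hfa := faults_succ req B t
  have hnat : (if req t ∈ s.ref then 0 else 1) +
      ((B (t + 1) ∩ (s.track.next k (req t)).pages) \ insert (req t) s.ref).card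
      ≤ ((B t ∩ s.track.pages) \ s.ref).card + (if req t ∈ s.track.pages then 0 else 1)
        + (if req t ∈ B t then 0 else 1) := by
    -- In this case the page leaves the difference set, which offsets the counter. Otherwise a
    -- counted page is clean or a fault of Belady's algorithm.
    by_cases h1 : req t ∈ (B t ∩ s.track.pages) \ s.ref
    · have h2 := Finset.card_erase_add_one h1
      have h3 : (if req t ∈ s.ref then 0 else 1) ≤ 1 := by split_ifs <;> simp
      omega
    · rw [Finset.erase_eq_of_notMem h1] at hcard
      rw [Finset.mem_sdiff, Finset.mem_inter] at h1
      have h3 : (if req t ∈ s.ref then 0 else 1) ≤ (if req t ∈ s.track.pages then 0 else 1)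
          + (if req t ∈ B t then 0 else 1) := by
        by_cases h4 : req t ∈ s.ref
        · rw [if_pos h4]
          exact Nat.zero_le _
        · by_cases h5 : req t ∈ s.track.pages
          · rw [if_neg h4, if_pos h5, if_neg fun h6 => h1 ⟨⟨h6, h5⟩, h4⟩]
          · rw [if_neg h4, if_neg h5]
            exact Nat.le_add_right _ _
      omega
  have hnat' : ((s.cnt + if req t ∈ s.ref then 0 else 1) : ℕ) +
      ((B (t + 1) ∩ (s.track.next k (req t)).pages) \ insert (req t) s.ref).card
        + s.track.clean + faults req t B
      ≤ s.cnt + ((B t ∩ s.track.pages) \ s.ref).card + (s.track.next k (req t)).clean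
        + faults req (t + 1) B := by
    omega
  have hreal : (((s.cnt + if req t ∈ s.ref then 0 else 1 : ℕ) : ℝ) +
      ((B (t + 1) ∩ (s.track.next k (req t)).pages) \ insert (req t) s.ref).card
        + s.track.clean + faults req t B)
      ≤ s.cnt + ((B t ∩ s.track.pages) \ s.ref).card + (s.track.next k (req t)).clean
        + faults req (t + 1) B := by
    exact_mod_cast hnat'
  rw [excess, hps]
  linarith

theorem charge_prep_of_ref (hk : 0 < k) (hinit : init.card ≤ k) {t : ℕ} {s : Conf Page}
    (h1 : s.ref = s.track.pages) (h2 : s.cnt = 0) :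
    s.charge L N init k req B t = 0 := by
  unfold charge
  have : s.excess init k req B t ≤ 0 := by
    rw [excess, h1, h2, Finset.sdiff_eq_empty_iff_subset.2 Finset.inter_subset_right]
    have h3 := (Track.meaning (init := init) req hk hinit t).phase_le
    have h4 : (faults req (Track.phaseStart k init req t) B : ℝ) ≤ faults req t B := by
      exact_mod_cast faults_mono req B h3
    have h5 : (0 : ℝ) ≤ s.track.clean := Nat.cast_nonneg _
    simp only [Finset.card_empty, Nat.cast_zero]
    linarith
  rw [max_eq_right this]
  simp

/-- Effect of the deterministic part of a step. -/
theorem charge_prep_le (hk : 0 < k) (hinit : init.card ≤ k)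
    (hB : IsBelady k init req T B) {t : ℕ} (ht : t < T)
    (htr : s.track = Track.at_ k init req t) :
    (s.prep k L (req t)).charge L N init k req B (t + 1)
      ≤ s.charge L N init k req B t
        - if s.Fails k L (req t) then (N s.lev : ℝ) * s.track.w else 0 := by
  have h0 := charge_nonneg (L := L) (N := N) (k := k) init req B t s
  by_cases hr : s.track.Reset k (req t)
  · have hnf : ¬ s.Fails k L (req t) := fun hf => hf.1 hr
    rw [if_neg hnf, charge_prep_of_ref hk hinit (by rw [prep_reset L hr])
      (by rw [prep_reset L hr])]
    linarith
  · have hex := excess_step hB ht htr hr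
    obtain ⟨hp, hnext, hclean, hclean'⟩ := Track.next_of_not_reset hr
    by_cases hf : s.Fails k L (req t)
    · rw [if_pos hf, charge_prep_of_ref hk hinit (by rw [prep_fails hf]) (by rw [prep_fails hf])]
      -- The reason for the threshold 7: there are at most `2 * w` clean pages and, by
      -- `Track.faults_le`, at most `4 * w` faults in the phase, so more than `7 * w` counted
      -- requests leave an excess of `w`.
      have h1 : (s.track.w : ℝ) ≤ s.excess init k req B t := by
        refine le_trans ?_ hex
        have h2 := Track.faults_le hk hinit hB (t := t + 1) ht
        have h3 : s.track.next k (req t) = Track.at_ k init req (t + 1) := by rw [htr]; rfl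
        rw [← h3] at h2
        have h4 := hf.2.2
        have h6 : s.track.w + (s.track.next k (req t)).clean + faults req (t + 1) B
            ≤ (s.cnt + if req t ∈ s.ref then 0 else 1)
              + faults req (Track.phaseStart k init req (t + 1)) B := by
          omega
        have h7 : (s.track.w : ℝ) + (s.track.next k (req t)).clean + faults req (t + 1) B
            ≤ ((s.cnt + if req t ∈ s.ref then 0 else 1 : ℕ) : ℝ)
              + faults req (Track.phaseStart k init req (t + 1)) B := by
          exact_mod_cast h6
        have h8 : (0 : ℝ) ≤ ((B (t + 1) ∩ (s.track.next k (req t)).pages)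
          \ insert (req t) s.ref).card := Nat.cast_nonneg _
        linarith
      rw [charge, if_pos hf.2.1]
      have h2 : (N s.lev : ℝ) * s.track.w ≤ N s.lev * max (s.excess init k req B t) 0 :=
        mul_le_mul_of_nonneg_left (h1.trans (le_max_left _ _)) (Nat.cast_nonneg _)
      linarith
    · rw [if_neg hf, sub_zero, prep_regular hr hf]
      unfold charge
      simp only
      by_cases hl : s.lev < L
      · rw [if_pos hl, if_pos hl]
        refine mul_le_mul_of_nonneg_left (max_le_max ?_ le_rfl) (Nat.cast_nonneg _)
        rw [excess]
        exact hex
      · rw [if_neg hl, if_neg hl]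

/-- The adopted prediction is chosen uniformly at random. -/
theorem sum_pending_launch (h : s.Core k a L N) (ha : 0 < a) (hs : s.Starts a L N r) (e : ℕ → ℕ)
    (t : ℕ) :
    ∑ l ∈ Finset.range (N s.lev), (s.launch N l).pending a e t = 0 ∧ s.pending a e t = 0 := by
  constructor
  · have h1 : ∀ l, (s.launch N l).pending a e t = (N s.lev : ℝ) * e (t + (l + 1) * a - 1)
        - ∑ i ∈ Finset.range (N s.lev), (e (t + (i + 1) * a - 1) : ℝ) := by
      intro l
      simp only [pending, launch, Nat.sub_zero]
      congr 1
      refine Finset.sum_congr rfl fun i _ => if_pos ?_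
      exact Nat.mul_pos (Nat.succ_pos i) ha
    simp only [h1]
    rw [Finset.sum_sub_distrib, ← Finset.mul_sum, Finset.sum_const, Finset.card_range,
      nsmul_eq_mul, sub_self]
  · have h2 : s.sel = none := by
      by_contra h3
      obtain ⟨l', hl'⟩ := Option.ne_none_iff_exists'.1 h3
      have h4 := h.sel_some l' hl'
      have h5 : (l' + 1) * a ≤ s.num * a := Nat.mul_le_mul_right a h4.1
      have h6 := hs.1
      omega
    rw [pending, h2, Finset.sum_eq_zero]
    · simp
    · intro i hi
      rw [Finset.mem_range] at hi
      have h5 : (i + 1) * a ≤ s.num * a := Nat.mul_le_mul_right a hi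
      have h6 := hs.1
      exact if_neg (by omega)

/-- Change of the sum over the remaining queries of the period in one step. -/
theorem sum_remaining_succ {Page : Type u} (ha : 0 < a) (q : Conf Page) (e : ℕ → ℕ) (t : ℕ)
    (hp : q.pos < q.num * a) :
    ∑ i ∈ Finset.range q.num, (if q.pos < (i + 1) * a then
        (e (t + ((i + 1) * a - q.pos) - 1) : ℝ) else 0)
      = ∑ i ∈ Finset.range q.num, (if q.pos + 1 < (i + 1) * a then
        (e (t + 1 + ((i + 1) * a - (q.pos + 1)) - 1) : ℝ) else 0)
        + if q.Asks a then (e t : ℝ) else 0 := by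
  have h1 : ∀ i ∈ Finset.range q.num, (if q.pos < (i + 1) * a then
        (e (t + ((i + 1) * a - q.pos) - 1) : ℝ) else 0)
      = (if q.pos + 1 < (i + 1) * a then
        (e (t + 1 + ((i + 1) * a - (q.pos + 1)) - 1) : ℝ) else 0)
        + if q.pos + 1 = (i + 1) * a then (e t : ℝ) else 0 := by
    intro i _
    rcases lt_trichotomy (q.pos + 1) ((i + 1) * a) with h | h | h
    · rw [if_pos (by omega), if_pos h, if_neg (by omega), add_zero]
      congr 2
      omega
    · rw [if_pos (by omega), if_neg (by omega), if_pos h, zero_add]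
      congr 2
      omega
    · rw [if_neg (by omega), if_neg (by omega), if_neg (by omega), add_zero]
  rw [Finset.sum_congr rfl h1, Finset.sum_add_distrib]
  congr 1
  by_cases hA : q.Asks a
  · rw [if_pos hA]
    obtain ⟨c, hc⟩ := hA.2
    have hc0 : 0 < c := by
      rcases Nat.eq_zero_or_pos c with h | h
      · rw [h] at hc; omega
      · exact h
    have hcn : c ≤ q.num := by
      have : a * c ≤ a * q.num := by rw [mul_comm a q.num]; omega
      exact Nat.le_of_mul_le_mul_left this ha
    rw [Finset.sum_eq_single (c - 1)]
    · rw [if_pos]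
      rw [Nat.sub_add_cancel hc0, hc, mul_comm]
    · intro i _ hi
      refine if_neg fun h => hi ?_
      rw [hc, mul_comm] at h
      have := Nat.eq_of_mul_eq_mul_right ha h
      omega
    · intro h
      exact absurd (Finset.mem_range.2 (by omega)) h
  · rw [if_neg hA, Finset.sum_eq_zero]
    intro i _
    refine if_neg fun h => hA ⟨hp, ⟨i + 1, ?_⟩⟩
    rw [h, mul_comm]

/-- Effect of serving the request. -/
theorem charge_finish_le (hk : 0 < k) (ha : 0 < a) (h : q.Ready k a L N r)
    (hB : IsBelady k init req T B) {t : ℕ} (ht : t < T) (hr : req t = r) (P : Predictor Page k)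
    {s' : Conf Page} (hs' : s' ∈ (q.finish k a L r (q.reply P a r t)).support) :
    s'.charge L N init k req B (t + 1) + s'.pending a (errorAt P B T) (t + 1)
      ≤ q.charge L N init k req B (t + 1) + q.pending a (errorAt P B T) t
        + if q.Asks a then (errorAt P B T t : ℝ) else 0 := by
  rcases mem_support_finish hs' with ⟨hd, rfl⟩ | ⟨hd, X, hX, rfl⟩
  · have hlev := h.sel_lev hd.2
    have hsum := sum_remaining_succ ha q (errorAt P B T) t hd.1.1
    obtain ⟨l, hl⟩ : ∃ l, q.pos + 1 = (l + 1) * a := by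
      obtain ⟨c, hc⟩ := hd.1.2
      have hc0 : 0 < c := by
        rcases Nat.eq_zero_or_pos c with h' | h'
        · rw [h'] at hc; omega
        · exact h'
      exact ⟨c - 1, by rw [Nat.sub_add_cancel hc0, hc, mul_comm]⟩
    have hsel : q.sel = some l := by
      rw [hd.2, hl, Nat.mul_div_cancel _ ha, Nat.add_sub_cancel]
    have hnum := h.fresh (h.sel_some l hsel).2.2
    have hpend : q.pending a (errorAt P B T) t = (N q.lev : ℝ) * errorAt P B T t
        - ∑ i ∈ Finset.range q.num, (if q.pos < (i + 1) * a then
        (errorAt P B T (t + ((i + 1) * a - q.pos) - 1) : ℝ) else 0) := by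
      have h1 : t + ((l + 1) * a - q.pos) - 1 = t := by omega
      rw [pending, hsel]
      simp only
      rw [h1, hnum]
    have hpend' : (q.sync k r (q.reply P a r t)).pending a (errorAt P B T) (t + 1)
        = 0 - ∑ i ∈ Finset.range q.num, (if q.pos + 1 < (i + 1) * a then
        (errorAt P B T (t + 1 + ((i + 1) * a - (q.pos + 1)) - 1) : ℝ) else 0) := rfl
    have hlost := card_lost_le hk P t hd.1 (C := B (t + 1)) (hr ▸ hB.mem_succ ht)
    -- Adoption raises the excess by at most the error of the prediction. The resulting increase of
    -- the charge, `N` times the error, is the term that disappears from `pending`.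
    have hex : (q.sync k r (q.reply P a r t)).excess init k req B (t + 1)
        ≤ q.excess init k req B (t + 1) + errorAt P B T t := by
      have h1 : ((B (t + 1) ∩ q.track.pages)
          \ insert r (trim (k - 1) (q.ref.erase r \ q.reply P a r t))).card
          ≤ ((B (t + 1) ∩ q.track.pages) \ q.ref).card + errorAt P B T t := by
        rw [errorAt, if_pos ht]
        refine le_trans ?_ (Nat.add_le_add_left hlost _)
        refine le_trans (Finset.card_le_card ?_) (Finset.card_union_le _ _)
        intro y hy
        simp only [Finset.mem_inter, Finset.mem_sdiff, Finset.mem_union] at hy ⊢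
        tauto
      have h2 : (((B (t + 1) ∩ q.track.pages)
          \ insert r (trim (k - 1) (q.ref.erase r \ q.reply P a r t))).card : ℝ)
          ≤ ((B (t + 1) ∩ q.track.pages) \ q.ref).card + errorAt P B T t := by
        exact_mod_cast h1
      simp only [excess, sync]
      linarith
    have hmax : max ((q.sync k r (q.reply P a r t)).excess init k req B (t + 1)) 0
        ≤ max (q.excess init k req B (t + 1)) 0 + errorAt P B T t := by
      refine max_le (hex.trans ?_) ?_
      · linarith [le_max_left (q.excess init k req B (t + 1)) 0]
      · have := le_max_right (q.excess init k req B (t + 1)) 0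
        positivity
    have hmul := mul_le_mul_of_nonneg_left hmax (Nat.cast_nonneg (α := ℝ) (N q.lev))
    rw [hpend, hpend', charge, charge, if_pos hlev,
      if_pos (show (q.sync k r (q.reply P a r t)).lev < L from hlev), if_pos hd.1]
    rw [if_pos hd.1] at hsum
    change (N q.lev : ℝ) * _ + _ ≤ _
    linarith
  · have hch : (q.serve a L r X).charge L N init k req B (t + 1)
        = q.charge L N init k req B (t + 1) := rfl
    rw [hch]
    by_cases hp : q.pos < q.num * a
    · have hsum := sum_remaining_succ ha q (errorAt P B T) t hp
      have hpos : (q.serve a L r X).pos = q.pos + 1 := if_pos hp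
      have hnum : (q.serve a L r X).num = q.num := rfl
      have hsel' : (q.serve a L r X).sel = q.sel := rfl
      rw [pending, pending, hpos, hnum, hsel']
      rcases hsel : q.sel with _ | l
      · simp only
        linarith
      · have h1 := h.pos_succ_lt ha hd hsel
        have h2 : t + 1 + ((l + 1) * a - (q.pos + 1)) - 1 = t + ((l + 1) * a - q.pos) - 1 := by
          omega
        simp only
        rw [h2]
        linarith
    · have hA : ¬ q.Asks a := fun hA => hp hA.1
      have hsel : q.sel = none := by
        by_contra h3
        obtain ⟨l', hl'⟩ := Option.ne_none_iff_exists'.1 h3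
        exact hp (h.pos_succ_lt ha hd hl').1
      have hz : ∀ t', ∑ i ∈ Finset.range q.num, (if q.pos < (i + 1) * a then
          (errorAt P B T (t' + ((i + 1) * a - q.pos) - 1) : ℝ) else 0) = 0 := by
        intro t'
        refine Finset.sum_eq_zero fun i hi => if_neg ?_
        rw [Finset.mem_range] at hi
        have h5 : (i + 1) * a ≤ q.num * a := Nat.mul_le_mul_right a hi
        omega
      have hpos : (q.serve a L r X).pos = q.pos := if_neg hp
      have hnum : (q.serve a L r X).num = q.num := rfl
      have hsel' : (q.serve a L r X).sel = q.sel := rfl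
      rw [pending, pending, hpos, hnum, hsel', hz, hz, hsel, if_neg hA]
      simp

/-- Expected change of the charge in one step. -/
theorem ev_move_charge_le (hk : 0 < k) (ha : 0 < a) (hinit : init.card ≤ k)
    (h : s.Good k a L N) (hB : IsBelady k init req T B) {t : ℕ} (ht : t < T)
    (htr : s.track = Track.at_ k init req t) (P : Predictor Page k) {R : Finset Page}
    (hR : ∀ q, (s.prep k L (req t)).Launched a L N (req t) q → R = q.reply P a (req t) t) :
    ev (s.move k a L N (req t) R) (fun s' => s'.charge L N init k req B (t + 1)
        + s'.pending a (errorAt P B T) (t + 1))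
      ≤ s.charge L N init k req B t + s.pending a (errorAt P B T) t
        + (if (s.lead k a L N (req t)).Asks a then (errorAt P B T t : ℝ) else 0)
        - if s.Fails k L (req t) then (N s.lev : ℝ) * s.track.w else 0 := by
  have hp := h.prep hk (req t)
  have h1 := charge_prep_le (L := L) (N := N) hk hinit hB ht htr
  have h2 := pending_prep_le a k L (errorAt P B T) t s (req t)
  refine ev_move_le s (req t) R _ (fun q => q.charge L N init k req B (t + 1)
    + q.pending a (errorAt P B T) t
    + if (s.lead k a L N (req t)).Asks a then (errorAt P B T t : ℝ) else 0) _ ?_ ?_ ?_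
  · intro q hq
    rw [hR q hq]
    have hRd := hq.ready ha hp
    refine ev_le_of_le (finite_support_finish _ _ _) fun s' hs' => ?_
    have h3 := charge_finish_le (init := init) hk ha hRd hB ht rfl P hs'
    simp only [hq.asks_iff] at h3
    exact h3
  · intro _
    linarith
  · intro hs
    have hpos : (0 : ℝ) < N (s.prep k L (req t)).lev := by exact_mod_cast hs.2.2.2
    obtain ⟨h3, h4⟩ := sum_pending_launch hp.toCore ha hs (errorAt P B T) t
    have h5 : ∀ l, ((s.prep k L (req t)).launch N l).charge L N init k req B (t + 1)
        = (s.prep k L (req t)).charge L N init k req B (t + 1) := fun l => rfl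
    rw [div_le_iff₀ hpos]
    simp only [h5]
    rw [Finset.sum_add_distrib, Finset.sum_add_distrib, h3, Finset.sum_const, Finset.sum_const,
      Finset.card_range, nsmul_eq_mul, nsmul_eq_mul, add_zero, ← mul_add, mul_comm]
    refine mul_le_mul_of_nonneg_right ?_ hpos.le
    linarith

end Conf

end Caching

namespace Caching

/-! ### Bounds on the expected cost -/

namespace Conf

variable {Page : Type u} [DecidableEq Page] {k a L : ℕ} {N : ℕ → ℕ} {s : Conf Page} {r : Page}

theorem launched_lead (k a L : ℕ) (N : ℕ → ℕ) (s : Conf Page) (r : Page) :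
    (s.prep k L r).Launched a L N r (s.lead k a L N r) := by
  unfold lead
  by_cases h : (s.prep k L r).Starts a L N r
  · rw [if_pos h]
    exact Or.inl ⟨h, 0, h.2.2.2, rfl⟩
  · rw [if_neg h]
    exact Or.inr ⟨h, rfl⟩

theorem lev_of_mem_support_move {s' : Conf Page} {R : Finset Page}
    (h : s' ∈ (s.move k a L N r R).support) :
    s'.lev = (s.prep k L r).lev ∧ s'.track = s.track.next k r := by
  obtain ⟨q, hq, hf⟩ := exists_launched h
  rw [← track_prep k L s r, ← hq.same.2.2.1, ← hq.same.2.2.2.1]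
  rcases mem_support_finish hf with ⟨-, rfl⟩ | ⟨-, X, -, rfl⟩ <;> exact ⟨rfl, rfl⟩

/-- Queries after the end of the input are never made; `errorAt` counts them as 0, so a period cut
off by the end does no harm. -/
theorem pending_nonneg (a : ℕ) (P : Predictor Page k) (B : ℕ → Finset Page) (T : ℕ)
    (s : Conf Page) : 0 ≤ s.pending a (errorAt P B T) T := by
  have h : ∑ i ∈ Finset.range s.num, (if s.pos < (i + 1) * a then
      (errorAt P B T (T + ((i + 1) * a - s.pos) - 1) : ℝ) else 0) = 0 := by
    refine Finset.sum_eq_zero fun i _ => ?_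
    by_cases hi : s.pos < (i + 1) * a
    · rw [if_pos hi, errorAt, if_neg (by omega), Nat.cast_zero]
    · rw [if_neg hi]
  rw [pending, h, sub_zero]
  rcases s.sel with _ | l
  · exact le_rfl
  · positivity

end Conf

section algorithm

variable {Page : Type u} [DecidableEq Page] {k a L : ℕ} {N : ℕ → ℕ} (hk : 0 < k)
  {init : Finset Page} (hinit : init.card ≤ k)

theorem totalError_newQueries (P : Predictor Page k) (req : ℕ → Page) (B : ℕ → Finset Page)
    {T t : ℕ} (ht : t < T) (s : Conf Page) (c : ℕ) (Q : List (Query Page)) :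
    totalError P B ((levelAlgorithm k a L N hk init hinit).newQueries req t ⟨s, c, Q⟩)
      = totalError P B Q
        + if (s.lead k a L N (req t)).Asks a then Conf.errorAt P B T t else 0 := by
  rw [newQueries_eq hk hinit req t (Conf.launched_lead k a L N s (req t))]
  by_cases h : (s.lead k a L N (req t)).Asks a
  · rw [if_pos h, if_pos h, Conf.errorAt, if_pos ht, totalError, totalError, List.map_cons,
      List.sum_cons, add_comm]
    rfl
  · rw [if_neg h, if_neg h, add_zero]

/-- The change of a term that depends on the weight and the level only. -/
theorem level_step {G : ℕ → ℝ} {σ c S : ℝ} (hG : ∀ i ≤ L, 0 ≤ G i) (hG0 : σ + G 0 ≤ S)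
    (hGs : ∀ i < L, G (i + 1) + σ ≤ G i + c * N i) {s : Conf Page} (hs : s.lev ≤ L) (r : Page) :
    (s.track.next k r).w * G (s.prep k L r).lev
      + σ * ((if s.track.Reset k r then ((s.track.next k r).w : ℝ) else 0)
        + if s.Fails k L r then (s.track.w : ℝ) else 0)
      ≤ s.track.w * G s.lev + S * (if s.track.Reset k r then ((s.track.next k r).w : ℝ) else 0)
        + c * if s.Fails k L r then (N s.lev : ℝ) * s.track.w else 0 := by
  by_cases hr : s.track.Reset k r
  · have hf : ¬ s.Fails k L r := fun hf => hf.1 hr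
    rw [Conf.prep_reset L hr, if_pos hr, if_neg hf, if_neg hf]
    have h1 := mul_le_mul_of_nonneg_left hG0 (Nat.cast_nonneg (α := ℝ) (s.track.next k r).w)
    have h2 := mul_nonneg (Nat.cast_nonneg (α := ℝ) s.track.w) (hG _ hs)
    simp only
    linarith
  · have hw : (s.track.next k r).w = s.track.w := by rw [(Track.next_of_not_reset hr).2.1]
    rw [if_neg hr, hw]
    by_cases hf : s.Fails k L r
    · rw [Conf.prep_fails hf, if_pos hf, if_pos hf]
      have h1 := mul_le_mul_of_nonneg_left (hGs _ hf.2.1) (Nat.cast_nonneg (α := ℝ) s.track.w)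
      simp only
      linarith
    · rw [Conf.prep_regular hr hf, if_neg hf, if_neg hf]
      simp

theorem start_eq_zero (hL : 0 < L) (P : Predictor Page k) (req : ℕ → Page) (T : ℕ)
    (B : ℕ → Finset Page) :
    Conf.potential k a L req T 0 (levelAlgorithm k a L N hk init hinit).start = 0 ∧
      Conf.charge L N init k req B 0 (levelAlgorithm k a L N hk init hinit).start = 0 ∧
      Conf.pending a (Conf.errorAt P B T) 0 (levelAlgorithm k a L N hk init hinit).start = 0 := by
  refine ⟨?_, Conf.charge_prep_of_ref hk hinit ?_ rfl, ?_⟩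
  · simp [levelAlgorithm, Conf.potential, hL, Conf.missing]
  · simp [levelAlgorithm, Track.pages]
  · simp [levelAlgorithm, Conf.pending]

/-- A family of bounds on the expected cost. -/
theorem mul_ev_cost_le (ha : 0 < a) (hL : 0 < L) (hN0 : ∀ i < L, 0 < N i)
    (hN : ∀ i < L, N i * a ≤ 2 * k) (hH : ((harmonic k : ℚ) : ℝ) ≤ 3 * L)
    {G : ℕ → ℝ} {σ c S : ℝ} (hσ : 0 ≤ σ) (hc : 0 ≤ c) (hG : ∀ i ≤ L, 0 ≤ G i)
    (hG0 : σ + G 0 ≤ S) (hGs : ∀ i < L, G (i + 1) + σ ≤ G i + c * N i)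
    (P : Predictor Page k) (req : ℕ → Page) (T : ℕ) {B : ℕ → Finset Page}
    (hB : IsBelady k init req T B) :
    σ * ev ((levelAlgorithm k a L N hk init hinit).run P req T) (fun o => (o.cost : ℝ))
      ≤ 170 * (S * Track.totalWeight k init req T
        + c * ev ((levelAlgorithm k a L N hk init hinit).run P req T)
          fun o => (totalError P B o.queries : ℝ)) := by
  set A := levelAlgorithm k a L N hk init hinit with hA
  have hfb : A.FinitelyBranching := finitelyBranching_levelAlgorithm hk hinit
  -- `potential` reduces the cost to the weights of epochs and failures. The term `w * G lev` turns
  -- the weight of a failure into `c * N * w`, and `charge` and `pending` turn this into error.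
  let Z : ℕ → A.Outcome → ℝ := fun t o =>
    σ * ((o.cost : ℝ) + Conf.potential k a L req T t o.state)
      + 170 * ((Conf.track o.state).w * G (Conf.lev o.state))
      + 170 * c * (Conf.charge L N init k req B t o.state
        + Conf.pending a (Conf.errorAt P B T) t o.state - totalError P B o.queries)
      - 170 * S * Track.totalWeight k init req t
  have hdrift := hfb.drift P req T (fun t o => Conf.Good k a L N o.state ∧
    Conf.track o.state = Track.at_ k init req t) Z
    (fun t o ho => good_of_mem_run hk hinit ha P req t o ho) ?_
  · have hZ0 : Z 0 ⟨A.start, 0, []⟩ = 0 := by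
      obtain ⟨h1, h2, h3⟩ : Conf.potential k a L req T 0 A.start = 0 ∧
          Conf.charge L N init k req B 0 A.start = 0 ∧
          Conf.pending a (Conf.errorAt P B T) 0 A.start = 0 :=
        start_eq_zero hk hinit hL P req T B
      have h4 : (Conf.track A.start).w = 0 := rfl
      simp only [Z]
      rw [h1, h2, h3, h4]
      simp [Track.totalWeight, totalError]
    rw [hZ0] at hdrift
    have hfin := hfb.run P req T
    have hlow : ev (A.run P req T) (fun o => σ * (o.cost : ℝ)
        + ((-(170 * c)) * (totalError P B o.queries : ℝ)
          + (-(170 * S * Track.totalWeight k init req T)))) ≤ ev (A.run P req T) (Z T) := by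
      refine ev_mono hfin fun o ho => ?_
      have hg := (good_of_mem_run hk hinit ha P req T o ho).1
      have h1 := mul_nonneg hσ (hg.potential_nonneg req T T)
      have h2 := mul_nonneg (Nat.cast_nonneg (α := ℝ) (Conf.track o.state).w) (hG _ hg.lev_le)
      have h3 := Conf.charge_nonneg (L := L) (N := N) (k := k) init req B T o.state
      have h4 := Conf.pending_nonneg a P B T o.state
      have h5 := mul_nonneg hc (add_nonneg h3 h4)
      simp only [Z]
      linarith
    rw [ev_add hfin, ev_add hfin, ev_const hfin, ev_const_mul hfin, ev_const_mul hfin] at hlow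
    linarith
  · rintro t ht ⟨s, C, Q⟩ ⟨hg, htr⟩
    change Conf Page at s
    change s.Good k a L N at hg
    change s.track = _ at htr
    rw [hfb.ev_step]
    change ev (s.move k a L N (req t) (A.answer P req t s)) _ ≤ _
    set R := A.answer P req t s with hRdef
    have hR : ∀ q, (s.prep k L (req t)).Launched a L N (req t) q →
        R = q.reply P a (req t) t := fun q hq => answer_eq hk hinit P req t hq
    have hfin : (s.move k a L N (req t) R).support.Finite := Conf.finite_support_move s (req t) R
    have hpot := Conf.ev_move_potential_le hk ha hL hN0 hN hH hg req ht (R := R)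
    have hcha := Conf.ev_move_charge_le hk ha hinit hg hB ht htr P hR
    have herr := totalError_newQueries (a := a) (L := L) (N := N) hk hinit P req B ht s C Q
    have hlev := level_step (k := k) hG hG0 hGs hg.lev_le (req t)
    have hW : (Track.totalWeight k init req (t + 1) : ℝ) = Track.totalWeight k init req t
        + if s.track.Reset k (req t) then ((s.track.next k (req t)).w : ℝ) else 0 := by
      rw [htr, Track.totalWeight]
      push_cast
      rfl
    have herr' : (totalError P B (A.newQueries req t ⟨s, C, Q⟩) : ℝ) = totalError P B Q
        + if (s.lead k a L N (req t)).Asks a then (Conf.errorAt P B T t : ℝ) else 0 := by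
      rw [herr]
      push_cast
      rfl
    have hup : ev (s.move k a L N (req t) R) (fun s' => Z (t + 1) ⟨s', C
          + (A.cache s' \ A.cache s).card, A.newQueries req t ⟨s, C, Q⟩⟩)
        ≤ ev (s.move k a L N (req t) R) (fun s' =>
          σ * (((s'.cache k \ s.cache k).card : ℝ) + s'.potential k a L req T (t + 1))
          + (170 * c * (s'.charge L N init k req B (t + 1)
            + s'.pending a (Conf.errorAt P B T) (t + 1))
          + (σ * C + 170 * ((s.track.next k (req t)).w * G (s.prep k L (req t)).lev)
            - 170 * c * totalError P B (A.newQueries req t ⟨s, C, Q⟩)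
            - 170 * S * Track.totalWeight k init req (t + 1)))) := by
      refine ev_mono hfin fun s' hs' => ?_
      obtain ⟨h1, h2⟩ := Conf.lev_of_mem_support_move hs'
      have h3 : A.cache s' \ A.cache s = s'.cache k \ s.cache k := rfl
      simp only [Z]
      rw [h1, h2, h3]
      push_cast
      linarith
    refine hup.trans ?_
    rw [ev_add hfin, ev_add hfin, ev_const hfin, ev_const_mul hfin, ev_const_mul hfin, hW, herr']
    have h1 := mul_le_mul_of_nonneg_left hpot hσ
    have h2 := mul_le_mul_of_nonneg_left hcha (mul_nonneg (by norm_num : (0 : ℝ) ≤ 170) hc)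
    simp only [Z]
    linarith

end algorithm

end Caching

namespace Caching

/-! ### Convex functions on the natural numbers -/

section convex

variable {f : ℝ → ℝ}

/-- Increment of `f` between `i` and `i + 1`. -/
def increment (f : ℝ → ℝ) (i : ℕ) : ℝ := f (i + 1) - f i

theorem increment_mono (hconv : ConvexOn ℝ (Set.Ici 0) f) : Monotone (increment f) := by
  refine monotone_nat_of_le_succ fun n => ?_
  have hn : (0 : ℝ) ≤ n := Nat.cast_nonneg n
  have h := hconv.2 (Set.mem_Ici.2 hn) (Set.mem_Ici.2 (by linarith : (0 : ℝ) ≤ n + 2))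
    (by norm_num : (0 : ℝ) ≤ 1 / 2) (by norm_num : (0 : ℝ) ≤ 1 / 2) (by norm_num)
  have h1 : (1 / 2 : ℝ) • (n : ℝ) + (1 / 2 : ℝ) • ((n : ℝ) + 2) = n + 1 := by
    simp only [smul_eq_mul]
    ring
  rw [h1, smul_eq_mul, smul_eq_mul] at h
  have h2 : (n : ℝ) + 1 + 1 = n + 2 := by ring
  simp only [increment, Nat.cast_add, Nat.cast_one, h2]
  linarith

theorem one_le_increment (hconv : ConvexOn ℝ (Set.Ici 0) f) (h0 : f 0 = 0) (h1 : 1 ≤ f 1) (i : ℕ) :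
    1 ≤ increment f i := by
  refine le_trans ?_ (increment_mono hconv (Nat.zero_le i))
  simpa [increment, h0] using h1

/-- The graph of `f` lies above its secants. -/
theorem add_increment_mul_le (hconv : ConvexOn ℝ (Set.Ici 0) f) (i j : ℕ) :
    f j + increment f j * ((i : ℝ) - j) ≤ f i := by
  have hs := increment_mono hconv
  have hsucc : ∀ m : ℕ, f ((m + 1 : ℕ) : ℝ) = f m + increment f m := by
    intro m
    rw [increment, Nat.cast_add, Nat.cast_one]
    ring
  rcases le_total j i with h | h
  · induction i, h using Nat.le_induction with
    | base => simp
    | succ m hm ih =>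
      have h1 := hs hm
      rw [hsucc]
      push_cast
      linarith
  · induction j, h using Nat.le_induction with
    | base => simp
    | succ m hm ih =>
      have h1 := hs (Nat.le_succ m)
      have h2 : (0 : ℝ) ≤ (m : ℝ) + 1 - i := by
        have : (i : ℝ) ≤ m := by exact_mod_cast hm
        linarith
      have h3 := mul_le_mul_of_nonneg_right h1 h2
      rw [hsucc]
      push_cast
      simp only [Nat.succ_eq_add_one] at h3
      linarith

theorem natCast_le (hconv : ConvexOn ℝ (Set.Ici 0) f) (h0 : f 0 = 0) (h1 : 1 ≤ f 1) (i : ℕ) :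
    (i : ℝ) ≤ f i := by
  have h2 := add_increment_mul_le hconv i 0
  have h3 := one_le_increment hconv h0 h1 0
  have h4 := mul_le_mul_of_nonneg_right h3 (Nat.cast_nonneg (α := ℝ) i)
  rw [Nat.cast_zero, h0] at h2
  linarith

/-- Makes `Function.invFunOn` a true right inverse. Convexity yields continuity only in the open
half-line, so the intermediate value theorem starts at some `x₀ > 0` with `f x₀ ≤ x₀ * f 1 ≤ y`. -/
theorem exists_eq_of_nonneg (hconv : ConvexOn ℝ (Set.Ici 0) f) (h0 : f 0 = 0) (h1 : 1 ≤ f 1)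
    {y : ℝ} (hy : 0 ≤ y) : ∃ x ∈ Set.Ici (0 : ℝ), f x = y := by
  rcases hy.eq_or_lt with rfl | hy
  · exact ⟨0, Set.mem_Ici.2 le_rfl, h0⟩
  have hf1 : 0 < f 1 := by linarith
  set x₀ := min 1 (y / f 1) with hx₀
  have hpos : 0 < x₀ := lt_min one_pos (div_pos hy hf1)
  have hle : x₀ ≤ 1 := min_le_left _ _
  have hfx : f x₀ ≤ y := by
    have h := hconv.2 (Set.mem_Ici.2 (le_refl (0 : ℝ))) (Set.mem_Ici.2 (zero_le_one (α := ℝ)))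
      (sub_nonneg.2 hle) hpos.le (by ring)
    simp only [smul_eq_mul, mul_zero, mul_one, zero_add, h0] at h
    refine h.trans ?_
    rw [← le_div_iff₀ hf1]
    exact min_le_right _ _
  set n := ⌈y⌉₊ + 1 with hn
  have hyn : y ≤ f n := by
    refine le_trans ?_ (natCast_le hconv h0 h1 n)
    rw [hn]
    push_cast
    linarith [Nat.le_ceil y]
  have hxn : x₀ ≤ n := hle.trans (by rw [hn]; push_cast; linarith [Nat.cast_nonneg (α := ℝ) ⌈y⌉₊])
  have hcont : ContinuousOn f (Set.Icc x₀ n) := by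
    have h := hconv.continuousOn_interior
    rw [interior_Ici] at h
    exact h.mono fun x hx => Set.mem_Ioi.2 (hpos.trans_le hx.1)
  obtain ⟨x, hx, hxy⟩ := intermediate_value_Icc hxn hcont ⟨hfx, hyn⟩
  exact ⟨x, Set.mem_Ici.2 (hpos.le.trans hx.1), hxy⟩

theorem sum_increment (h0 : f 0 = 0) (n : ℕ) :
    ∑ i ∈ Finset.range n, increment f i = f n := by
  have h := Finset.sum_range_sub (fun i : ℕ => f i) n
  simp only [Nat.cast_zero, h0, sub_zero] at h
  rw [← h]
  exact Finset.sum_congr rfl fun i _ => by rw [increment, Nat.cast_add, Nat.cast_one]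

end convex

/-! ### Choice of the parameters -/

section parameters

variable {f : ℝ → ℝ} {k a : ℕ}

/-- The number of queries in a period of level `i`. -/
noncomputable def periodLength (f : ℝ → ℝ) (a i : ℕ) : ℕ := ⌈increment f i / a⌉₊

theorem increment_le_mul (ha : 0 < a) (i : ℕ) : increment f i ≤ a * periodLength f a i := by
  have ha' : (0 : ℝ) < a := by exact_mod_cast ha
  rw [mul_comm, ← div_le_iff₀ ha']
  exact Nat.le_ceil _

theorem mul_periodLength_le (hconv : ConvexOn ℝ (Set.Ici 0) f) (h0 : f 0 = 0) (h1 : 1 ≤ f 1)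
    (ha : 0 < a) (i : ℕ) : a * (periodLength f a i : ℝ) ≤ increment f i + a := by
  have ha' : (0 : ℝ) < a := by exact_mod_cast ha
  have h2 := one_le_increment hconv h0 h1 i
  have h3 := (Nat.ceil_lt_add_one (div_nonneg (by linarith) ha'.le : 0 ≤ increment f i / a)).le
  have h4 := mul_le_mul_of_nonneg_left h3 ha'.le
  rwa [mul_add, mul_div_cancel₀ _ ha'.ne', mul_one] at h4

theorem periodLength_le (hconv : ConvexOn ℝ (Set.Ici 0) f) (h0 : f 0 = 0) (h1 : 1 ≤ f 1)
    (ha : 0 < a) (i : ℕ) : (periodLength f a i : ℝ) ≤ 2 * increment f i := by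
  have ha' : (1 : ℝ) ≤ a := by exact_mod_cast ha
  have h2 := one_le_increment hconv h0 h1 i
  have h3 := (Nat.ceil_lt_add_one (div_nonneg (by linarith) (by linarith) :
    0 ≤ increment f i / a)).le
  have h4 : increment f i / a ≤ increment f i := div_le_self (by linarith) ha'
  unfold periodLength
  linarith

theorem periodLength_pos (hconv : ConvexOn ℝ (Set.Ici 0) f) (h0 : f 0 = 0) (h1 : 1 ≤ f 1)
    (ha : 0 < a) (i : ℕ) : 0 < periodLength f a i := by
  have ha' : (0 : ℝ) < a := by exact_mod_cast ha
  have h2 := one_le_increment hconv h0 h1 i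
  exact Nat.ceil_pos.2 (div_pos (by linarith) ha')

/-- Here the growth bound on `f` enters: an increment below level `L` is at most `2 ^ L - 1 ≤ k`,
and rounding up adds at most `a ≤ k`. -/
theorem periodLength_mul_le (hmono : StrictMonoOn f (Set.Ici 0)) (hconv : ConvexOn ℝ (Set.Ici 0) f)
    (h0 : f 0 = 0) (h1 : 1 ≤ f 1) (hf : ∀ i : ℕ, f i ≤ 2 ^ i - 1) (hk : 0 < k) (ha : 0 < a)
    (hak : a ≤ k) {i : ℕ} (hi : i < Nat.log 2 k) : periodLength f a i * a ≤ 2 * k := by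
  have h2 := mul_periodLength_le hconv h0 h1 ha i
  have h3 : increment f i ≤ k := by
    have h4 : f (i + 1) ≤ f (Nat.log 2 k : ℕ) := by
      refine hmono.monotoneOn ?_ ?_ ?_
      · exact Set.mem_Ici.2 (by positivity)
      · exact Set.mem_Ici.2 (by positivity)
      · exact_mod_cast hi
    have h5 := hf (Nat.log 2 k)
    have h6 : ((2 : ℝ) ^ Nat.log 2 k) ≤ k := by
      exact_mod_cast Nat.pow_log_le_self 2 hk.ne'
    have h7 := natCast_le hconv h0 h1 i
    have h8 : (0 : ℝ) ≤ i := Nat.cast_nonneg i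
    rw [increment]
    linarith
  have h4 : (a : ℝ) ≤ k := by exact_mod_cast hak
  have h5 : (periodLength f a i : ℝ) * a ≤ 2 * k := by linarith
  exact_mod_cast h5

/-- The increments telescope, and as they are at least 1, rounding costs a factor of at most 2. -/
theorem sum_periodLength_le (hconv : ConvexOn ℝ (Set.Ici 0) f) (h0 : f 0 = 0) (h1 : 1 ≤ f 1)
    (ha : 0 < a) (n : ℕ) :
    ((∑ i ∈ Finset.range n, periodLength f a i : ℕ) : ℝ) ≤ 2 * f n := by
  rw [← sum_increment h0 n, Finset.mul_sum]
  push_cast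
  exact Finset.sum_le_sum fun i _ => periodLength_le hconv h0 h1 ha i

end parameters

/-! ### The theorem -/

section final

variable {Page : Type u} [DecidableEq Page] {f : ℝ → ℝ} {k a : ℕ} {init : Finset Page}

theorem expectedCost_eq {L : ℕ} {N : ℕ → ℕ} (hk : 0 < k) (hinit : init.card ≤ k)
    (P : Predictor Page k) (req : ℕ → Page) (T : ℕ) :
    (levelAlgorithm k a L N hk init hinit).expectedCost P req T = ENNReal.ofReal
      (ev ((levelAlgorithm k a L N hk init hinit).run P req T) fun o => (o.cost : ℝ)) :=
  expect_eq_ofReal_ev ((finitelyBranching_levelAlgorithm hk hinit).run P req T) _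

theorem toReal_expectedError {L : ℕ} {N : ℕ → ℕ} (hk : 0 < k) (hinit : init.card ≤ k)
    (P : Predictor Page k) (req : ℕ → Page) (T : ℕ) (B : ℕ → Finset Page) :
    ((levelAlgorithm k a L N hk init hinit).expectedError P req T B).toReal
      = ev ((levelAlgorithm k a L N hk init hinit).run P req T)
        fun o => (totalError P B o.queries : ℝ) := by
  rw [OnlineAlgorithm.expectedError,
    expect_eq_ofReal_ev ((finitelyBranching_levelAlgorithm hk hinit).run P req T),
    ENNReal.toReal_ofReal (ev_nonneg fun _ => Nat.cast_nonneg _)]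

theorem ev_totalError_eq_zero {L : ℕ} {N : ℕ → ℕ} (hk : 0 < k) (hinit : init.card ≤ k)
    (ha : 0 < a) (P : Predictor Page k) (req : ℕ → Page) (T : ℕ) (B : ℕ → Finset Page)
    (hP : ∀ t < T, P.state t = B (t + 1)) :
    ev ((levelAlgorithm k a L N hk init hinit).run P req T)
      (fun o => (totalError P B o.queries : ℝ)) = 0 := by
  refine le_antisymm (ev_le_of_le ((finitelyBranching_levelAlgorithm hk hinit).run P req T)
    fun o ho => ?_) (ev_nonneg fun _ => Nat.cast_nonneg _)
  have htime := (levelAlgorithm_induction hk hinit ha P req (fun t _ Q => ∀ x ∈ Q, x.time < t)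
    (by simp) ?_ T o ho).2.2
  · have h : totalError P B o.queries = 0 := by
      rw [totalError]
      refine List.sum_eq_zero fun n hn => ?_
      obtain ⟨x, hx, rfl⟩ := List.mem_map.1 hn
      rw [hP _ (htime x hx), Finset.sdiff_self, Finset.card_empty]
    rw [h, Nat.cast_zero]
  · intro t s q s' Q _ _ hJ _ _ _ _ x hx
    by_cases hA : q.Asks a
    · rw [if_pos hA, List.mem_cons] at hx
      rcases hx with rfl | hx
      · exact Nat.lt_succ_self t
      · exact (hJ x hx).trans (Nat.lt_succ_self t)
    · rw [if_neg hA] at hx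
      exact (hJ x hx).trans (Nat.lt_succ_self t)

/-- The algorithm for the function `f`. -/
noncomputable abbrev predictionAlgorithm (f : ℝ → ℝ) (k a : ℕ) (hk : 0 < k) (init : Finset Page)
    (hinit : init.card ≤ k) : OnlineAlgorithm Page k init :=
  levelAlgorithm k a (Nat.log 2 k) (periodLength f a) hk init hinit

/-- With `c = 0` predictions do not matter: an epoch has at most `L` failures of weight `w` each,
which `G i = L - i` counts. The constant is 170 * 2 * 4. -/
theorem ev_cost_le_log
    (hmono : StrictMonoOn f (Set.Ici 0)) (hconv : ConvexOn ℝ (Set.Ici 0) f) (h0 : f 0 = 0)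
    (h1 : 1 ≤ f 1) (hf : ∀ i : ℕ, f i ≤ 2 ^ i - 1) (hk : 0 < k) (hk2 : 2 ≤ k) (ha : 0 < a)
    (hak : a ≤ k) (hinit : init.card ≤ k) (P : Predictor Page k) (req : ℕ → Page) (T : ℕ)
    {B : ℕ → Finset Page} (hB : IsBelady k init req T B) :
    ev ((predictionAlgorithm f k a hk init hinit).run P req T) (fun o => (o.cost : ℝ))
      ≤ 1360 * Real.logb 2 k * faults req T B := by
  have hL : 0 < Nat.log 2 k := Nat.log_pos (by norm_num) hk2
  have h := mul_ev_cost_le (σ := 1) (c := 0) (S := 1 + Nat.log 2 k)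
    (G := fun i => (Nat.log 2 k : ℝ) - i) hk hinit ha hL
    (fun i _ => periodLength_pos hconv h0 h1 ha i)
    (fun i hi => periodLength_mul_le hmono hconv h0 h1 hf hk ha hak hi)
    (harmonic_le_three_mul_log hk2) zero_le_one le_rfl
    (fun i hi => sub_nonneg.2 (by exact_mod_cast hi)) (by simp)
    (fun i _ => by push_cast; linarith) P req T hB
  rw [one_mul, zero_mul, add_zero] at h
  refine h.trans ?_
  have hW : (Track.totalWeight k init req T : ℝ) ≤ 4 * faults req T B := by
    exact_mod_cast Track.totalWeight_le hk hinit hB le_rfl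
  have hlog : (Nat.log 2 k : ℝ) ≤ Real.logb 2 k := by
    exact_mod_cast Real.natLog_le_logb k 2
  have hlog1 : (1 : ℝ) ≤ Nat.log 2 k := by exact_mod_cast hL
  have h2 : (1 + (Nat.log 2 k : ℝ)) * Track.totalWeight k init req T
      ≤ (2 * Real.logb 2 k) * (4 * faults req T B) :=
    mul_le_mul (by linarith) hW (Nat.cast_nonneg _) (by linarith)
  linarith

/-- The bound given by the increment of `f` at `j`. -/
theorem increment_mul_ev_cost_le
    (hmono : StrictMonoOn f (Set.Ici 0)) (hconv : ConvexOn ℝ (Set.Ici 0) f) (h0 : f 0 = 0)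
    (h1 : 1 ≤ f 1) (hf : ∀ i : ℕ, f i ≤ 2 ^ i - 1) (hk : 0 < k) (hk2 : 2 ≤ k) (ha : 0 < a)
    (hak : a ≤ k) (hinit : init.card ≤ k) (P : Predictor Page k) (req : ℕ → Page) (T : ℕ)
    {B : ℕ → Finset Page} (hB : IsBelady k init req T B)
    (j : ℕ) :
    increment f j * ev ((predictionAlgorithm f k a hk init hinit).run P req T)
        (fun o => (o.cost : ℝ))
      ≤ 170 * (4 * (increment f j * (1 + j) - f j) * faults req T B
        + a * ev ((predictionAlgorithm f k a hk init hinit).run P req T)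
          fun o => (totalError P B o.queries : ℝ)) := by
  have hL : 0 < Nat.log 2 k := Nat.log_pos (by norm_num) hk2
  have hs := one_le_increment hconv h0 h1 j
  have hb := add_increment_mul_le hconv 0 j
  rw [Nat.cast_zero, h0] at hb
  -- `G` is the height of `f` above its secant line at `j`. It is nonnegative by convexity, and its
  -- increase plus `σ` is the increment at `i`, at most `a * N i` by the choice of the period
  -- length.
  have h := mul_ev_cost_le (σ := increment f j) (c := a) (S := increment f j * (1 + j) - f j)
    (G := fun i => increment f j * j - f j + f i - increment f j * i) hk hinit ha hL
    (fun i _ => periodLength_pos hconv h0 h1 ha i)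
    (fun i hi => periodLength_mul_le hmono hconv h0 h1 hf hk ha hak hi)
    (harmonic_le_three_mul_log hk2) (by linarith) (Nat.cast_nonneg a)
    (fun i _ => by linarith [add_increment_mul_le hconv i j])
    (by simp only [Nat.cast_zero, h0]; linarith)
    (fun i _ => by
      have h3 := increment_le_mul (f := f) ha i
      rw [increment] at h3
      push_cast
      linarith) P req T hB
  refine h.trans ?_
  have hW : (Track.totalWeight k init req T : ℝ) ≤ 4 * faults req T B := by
    exact_mod_cast Track.totalWeight_le hk hinit hB le_rfl
  have h2 := mul_le_mul_of_nonneg_left hW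
    (by linarith : 0 ≤ increment f j * (1 + j) - f j)
  linarith

/-- For `j` the floor of the preimage of `y`, `y ≤ f (j + 1) = f j + increment f j`. So the error
adds at most `increment f j * (1 + j)` per fault to four times that amount, and 850 = 170 * 5. If
there are no faults, `ev_cost_le_log` already gives cost 0. -/
theorem ev_cost_le_of_error
    (hmono : StrictMonoOn f (Set.Ici 0)) (hconv : ConvexOn ℝ (Set.Ici 0) f) (h0 : f 0 = 0)
    (h1 : 1 ≤ f 1) (hf : ∀ i : ℕ, f i ≤ 2 ^ i - 1) (hk : 0 < k) (hk2 : 2 ≤ k) (ha : 0 < a)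
    (hak : a ≤ k) (hinit : init.card ≤ k) (P : Predictor Page k) (req : ℕ → Page) (T : ℕ)
    {B : ℕ → Finset Page} (hB : IsBelady k init req T B) :
    ev ((predictionAlgorithm f k a hk init hinit).run P req T) (fun o => (o.cost : ℝ))
      ≤ 850 * (1 + Function.invFunOn f (Set.Ici 0)
        (a * ev ((predictionAlgorithm f k a hk init hinit).run P req T)
          (fun o => (totalError P B o.queries : ℝ)) / faults req T B)) * faults req T B := by
  rcases Nat.eq_zero_or_pos (faults req T B) with hF | hF
  · have h := ev_cost_le_log hmono hconv h0 h1 hf hk hk2 ha hak hinit P req T hB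
    rw [hF] at h ⊢
    simpa using h
  have hF' : (0 : ℝ) < faults req T B := by exact_mod_cast hF
  set η := ev ((predictionAlgorithm f k a hk init hinit).run P req T)
    (fun o => (totalError P B o.queries : ℝ)) with hη
  have hη0 : 0 ≤ η := ev_nonneg fun _ => Nat.cast_nonneg _
  set y := a * η / faults req T B with hy
  have hy0 : 0 ≤ y := by positivity
  have hex := exists_eq_of_nonneg hconv h0 h1 hy0
  set ζ := Function.invFunOn f (Set.Ici 0) y
  have hζ0 : 0 ≤ ζ := Function.invFunOn_mem hex
  have hζ : f ζ = y := Function.invFunOn_eq hex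
  set j := ⌊ζ⌋₊
  have hjζ : (j : ℝ) ≤ ζ := Nat.floor_le hζ0
  have hζj : ζ ≤ (j : ℝ) + 1 := (Nat.lt_floor_add_one ζ).le
  have hj : y ≤ f j + increment f j := by
    rw [← hζ, increment, add_sub_cancel]
    exact hmono.monotoneOn (Set.mem_Ici.2 hζ0) (Set.mem_Ici.2 (by positivity)) hζj
  have haη : a * η = y * faults req T B := by
    rw [hy, div_mul_cancel₀ _ hF'.ne']
  have hs := one_le_increment hconv h0 h1 j
  have h := increment_mul_ev_cost_le hmono hconv h0 h1 hf hk hk2 ha hak hinit P req T hB j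
  rw [← hη, haη, ← add_mul] at h
  have hfj : 0 ≤ f j := (Nat.cast_nonneg j).trans (natCast_le hconv h0 h1 j)
  have hsj : 0 ≤ increment f j * j := mul_nonneg (by linarith) (Nat.cast_nonneg j)
  have h2 : (4 * (increment f j * (1 + j) - f j) + y) * faults req T B
      ≤ (5 * (increment f j * (1 + j))) * faults req T B :=
    mul_le_mul_of_nonneg_right (by linarith) hF'.le
  have h3 : ev ((predictionAlgorithm f k a hk init hinit).run P req T) (fun o => (o.cost : ℝ))
      ≤ 850 * (1 + j) * faults req T B := by
    refine le_of_mul_le_mul_left ?_ (by linarith : 0 < increment f j)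
    linarith
  refine h3.trans (mul_le_mul_of_nonneg_right ?_ hF'.le)
  linarith

theorem ev_cost_le_of_perfect
    (hmono : StrictMonoOn f (Set.Ici 0)) (hconv : ConvexOn ℝ (Set.Ici 0) f) (h0 : f 0 = 0)
    (h1 : 1 ≤ f 1) (hf : ∀ i : ℕ, f i ≤ 2 ^ i - 1) (hk : 0 < k) (hk2 : 2 ≤ k) (ha : 0 < a)
    (hak : a ≤ k) (hinit : init.card ≤ k) (P : Predictor Page k) (req : ℕ → Page) (T : ℕ)
    {B : ℕ → Finset Page} (hB : IsBelady k init req T B)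
    (hP : ∀ t < T, P.state t = B (t + 1)) :
    ev ((predictionAlgorithm f k a hk init hinit).run P req T) (fun o => (o.cost : ℝ))
      ≤ 680 * faults req T B := by
  have h := increment_mul_ev_cost_le hmono hconv h0 h1 hf hk hk2 ha hak hinit P req T hB 0
  rw [ev_totalError_eq_zero hk hinit ha P req T B hP, Nat.cast_zero, h0] at h
  have hs := one_le_increment hconv h0 h1 0
  refine le_of_mul_le_mul_left ?_ (by linarith : 0 < increment f 0)
  linarith

end final

/-- 352 = 44 * 2 * 4, from `queries_le`, `sum_periodLength_le` and `Track.totalWeight_le`. Both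
quantities are bounded at once, since `queries_le` bounds their sum. -/
theorem usesPredictions_predictionAlgorithm {Page : Type u} [DecidableEq Page] {f : ℝ → ℝ}
    {k a : ℕ} {init : Finset Page} (hmono : StrictMonoOn f (Set.Ici 0))
    (hconv : ConvexOn ℝ (Set.Ici 0) f) (h0 : f 0 = 0) (h1 : 1 ≤ f 1) (hk : 0 < k) (ha : 0 < a)
    (hinit : init.card ≤ k) :
    (predictionAlgorithm f k a hk init hinit).UsesPredictions (352 * f (Real.logb 2 k)) := by
  intro P req T B hB o ho
  have h := queries_le hk hinit ha P req T o ho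
  have hsum : (o.queries.map fun q => q.number + 1).sum
      = (o.queries.map fun q => q.number).sum + o.queries.length := by
    simp [List.sum_map_add]
  have hW : (Track.totalWeight k init req T : ℝ) ≤ 4 * faults req T B := by
    exact_mod_cast Track.totalWeight_le hk hinit hB le_rfl
  have hN := sum_periodLength_le hconv h0 h1 ha (Nat.log 2 k)
  have hlog : f (Nat.log 2 k : ℕ) ≤ f (Real.logb 2 k) := by
    have h2 : (Nat.log 2 k : ℝ) ≤ Real.logb 2 k := by exact_mod_cast Real.natLog_le_logb k 2
    have h3 : (0 : ℝ) ≤ (Nat.log 2 k : ℕ) := Nat.cast_nonneg _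
    exact hmono.monotoneOn (Set.mem_Ici.2 h3) (Set.mem_Ici.2 (h3.trans h2)) h2
  have h2 : (((o.queries.map fun q => q.number).sum : ℕ) : ℝ) + o.queries.length
      ≤ 44 * ((∑ i ∈ Finset.range (Nat.log 2 k), periodLength f a i : ℕ) : ℝ)
        * Track.totalWeight k init req T := by
    rw [hsum] at h
    exact_mod_cast h
  have h3 : ((∑ i ∈ Finset.range (Nat.log 2 k), periodLength f a i : ℕ) : ℝ)
      * Track.totalWeight k init req T ≤ (2 * f (Real.logb 2 k)) * (4 * faults req T B) :=
    mul_le_mul (by linarith) hW (Nat.cast_nonneg _)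
      ((Nat.cast_nonneg _).trans (hN.trans (by linarith)))
  have h4 : (0 : ℝ) ≤ ((o.queries.map fun q => q.number).sum : ℕ) := Nat.cast_nonneg _
  have h5 : (0 : ℝ) ≤ o.queries.length := Nat.cast_nonneg _
  constructor <;> linarith

end Caching

theorem theorem4 :
    ∃ C : ℝ, 0 < C ∧
      ∀ (k a : ℕ), 2 ≤ k → 1 ≤ a → a ≤ k →
      ∀ f : ℝ → ℝ, StrictMonoOn f (Set.Ici 0) → ConvexOn ℝ (Set.Ici 0) f → f 0 = 0 →
        (∀ i : ℕ, f i ≤ 2 ^ i - 1) → 1 ≤ f 1 →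
      ∃ α : ℝ, ∀ (Page : Type u) [DecidableEq Page] (init : Finset Page), init.card ≤ k →
      ∃ A : Caching.OnlineAlgorithm Page k init,
        A.WellSeparated a ∧
        A.AsksAboutKnownPages ∧
        A.UsesPredictions (C * f (Real.logb 2 k)) ∧
        A.IsConsistent C α ∧
        A.IsRobust (C * Real.logb 2 k) α ∧
        A.IsSmooth
          (fun η OPT => C * (1 + Function.invFunOn f (Set.Ici 0) (a * η / OPT))) α := by
  refine ⟨1360, by norm_num, ?_⟩
  intro k a hk2 ha hak f hmono hconv h0 hf h1
  -- No additive term is needed: the initial cache serves as the previous phase of the first one, so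
  -- all potentials start at 0.
  refine ⟨0, ?_⟩
  intro Page _ init hinit
  have hk : 0 < k := by omega
  refine ⟨Caching.predictionAlgorithm f k a hk init hinit,
    Caching.wellSeparated_levelAlgorithm hk hinit ha,
    Caching.asksAboutKnownPages_levelAlgorithm hk hinit ha, ?_, ?_, ?_, ?_⟩
  · have hlog : 0 ≤ f (Real.logb 2 k) := by
      have h2 : (0 : ℝ) ≤ Real.logb 2 k :=
        Real.logb_nonneg (by norm_num) (by exact_mod_cast (by omega : 1 ≤ k))
      rw [← h0]
      exact hmono.monotoneOn (Set.mem_Ici.2 le_rfl) (Set.mem_Ici.2 h2) h2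
    intro P req T B hB o ho
    obtain ⟨h2, h3⟩ := Caching.usesPredictions_predictionAlgorithm hmono hconv h0 h1 hk ha hinit
      P req T B hB o ho
    have h4 : 352 * f (Real.logb 2 k) * Caching.faults req T B
        ≤ 1360 * f (Real.logb 2 k) * Caching.faults req T B :=
      mul_le_mul_of_nonneg_right (by linarith) (Nat.cast_nonneg _)
    exact ⟨h2.trans h4, h3.trans h4⟩
  · intro P req T B hB hP
    rw [Caching.expectedCost_eq, add_zero]
    refine ENNReal.ofReal_le_ofReal ((Caching.ev_cost_le_of_perfect hmono hconv h0 h1 hf hk hk2 ha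
      hak hinit P req T hB hP).trans ?_)
    exact mul_le_mul_of_nonneg_right (by norm_num) (Nat.cast_nonneg _)
  · intro P req T B hB
    rw [Caching.expectedCost_eq, add_zero]
    exact ENNReal.ofReal_le_ofReal
      (Caching.ev_cost_le_log hmono hconv h0 h1 hf hk hk2 ha hak hinit P req T hB)
  · intro P req T B hB
    rw [Caching.expectedCost_eq, Caching.toReal_expectedError, add_zero]
    refine ENNReal.ofReal_le_ofReal ((Caching.ev_cost_le_of_error hmono hconv h0 h1 hf hk hk2 ha
      hak hinit P req T hB).trans ?_)
    refine mul_le_mul_of_nonneg_right ?_ (Nat.cast_nonneg _)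
    refine mul_le_mul_of_nonneg_right (by norm_num) (add_nonneg zero_le_one ?_)
    refine Function.invFunOn_mem (Caching.exists_eq_of_nonneg hconv h0 h1 ?_)
    exact div_nonneg (mul_nonneg (Nat.cast_nonneg _)
      (Caching.ev_nonneg fun _ => Nat.cast_nonneg _)) (Nat.cast_nonneg _)
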